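/- Links are smooth links in $\mathbb{R}^3$ with labelled, oriented components. A link is trivial if its components bound pairwise disjoint smoothly embedded disks; a knot is an unknot if it is trivial as a one-component link. A crossing disk for a link $L$ is a smoothly embedded disk $D$ whose interior meets $L$ transversally in exactly two points and whose boundary is disjoint from $L$, the algebraic intersection number being zero (for a suitable choice of orientations of the components). The crossing change along $D$ is $\pm1$-surgery on $\partial D$, i.e. a full twist, of either handedness, of the two strands through $D$. The unknotting number $u(L)\in\{0,1,2,\dots\}\cup\{\infty\}$ is the least number of crossing changes, with ambient isotopies allowed in between, that turn $L$ into a trivial link. For an unknot $c$, a knot $K$ disjoint from $c$ and $n\in\mathbb{Z}$, $K^n$ denotes the knot obtained from $K$ by $n$ full right-handed twists along an embedded disk bounded by $c$, i.e. the image of $K$ after $-1/n$-surgery on $c$ (with $K^0=K$). **Lemma A.3.** Let $L$ be a two-component link with $u(L)=1$ and linking number $0$. Then there is a crossing change that turns $L$ (up to ambient isotopy) into the trivial link, and for every such crossing change the following hold. Its crossing disk meets only one component $K$ of $L$. The other component $c$ of $L$ is an unknot. For every $n\in\mathbb{Z}$ the knot $K^n$ obtained by twisting $K$ about $c$ exists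 (that is, $K$ can be twisted $n$ full times along some smoothly embedded disk bounded by $c$), and, whichever such disk and collar of it are used, $u(K^n)\le 1$. -/

import Mathlib

open scoped ContDiff

noncomputable section

/-- Euclidean three-space, the ambient space of all knots and links. -/
abbrev E3 : Type := EuclideanSpace ℝ (Fin 3)

/-- The determinant (triple product) of three vectors of `E3`. -/
def det3 (u v w : E3) : ℝ := Matrix.det (Matrix.of ![⇑u, ⇑v, ⇑w])

/-- A smooth link with `m` labelled, oriented components: `m` smooth regular closed curves, each
simple with period `1`, and pairwise disjoint. A knot is a `SmoothLink 1`. -/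
structure SmoothLink (m : ℕ) where
  /-- the parametrization of each component -/
  toFun : Fin m → ℝ → E3
  smooth : ∀ i, ContDiff ℝ ∞ (toFun i)
  periodic : ∀ i, Function.Periodic (toFun i) 1
  regular : ∀ i s, deriv (toFun i) s ≠ 0
  injective : ∀ i j s t, toFun i s = toFun j t → i = j ∧ ∃ k : ℤ, s - t = k

/-- `f` restricts to a smooth embedding of the (compact) set `S` into `E3`: it is smooth on an open
neighbourhood of `S`, injective on `S`, and immersive at every point of `S`. -/
def IsSmoothEmbeddingOn {A : Type} [NormedAddCommGroup A] [NormedSpace ℝ A]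
    (f : A → E3) (S : Set A) : Prop :=
  (∃ U : Set A, IsOpen U ∧ S ⊆ U ∧ ContDiffOn ℝ ∞ f U) ∧
    Set.InjOn f S ∧ ∀ p ∈ S, Function.Injective (fderiv ℝ f p)

/-- The closed unit disk. -/
def stdDisk : Set ℂ := Metric.closedBall 0 1

/-- The unit circle, the boundary of `stdDisk`. -/
def stdCircle : Set ℂ := Metric.sphere 0 1

/-- The solid cylinder `D² × [-1, 1]`, the standard thickening of the disk `D² × {0}`. -/
def stdCylinder : Set (ℂ × ℝ) := stdDisk ×ˢ Set.Icc (-1) 1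

/-- The lateral side `∂D² × [-1, 1]` of the solid cylinder. -/
def stdSide : Set (ℂ × ℝ) := stdCircle ×ˢ Set.Icc (-1) 1

/-- `n` full right-handed twists of the cylinder: the disk at height `t` is rotated by an angle that
runs smoothly from `0` (for `t ≤ -1`) to `2πn` (for `t ≥ 1`). -/
def fullTwist (n : ℤ) (p : ℂ × ℝ) : ℂ × ℝ :=
  (Complex.exp (((2 * Real.pi * n * Real.smoothTransition ((p.2 + 1) / 2) : ℝ) : ℂ) * Complex.I)
    * p.1, p.2)

/-- An embedded disk in `E3` together with a bicollar: an orientation-preserving smooth embedding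
of the solid cylinder. The disk itself is the image of `D² × {0}`. -/
def IsThickDisk (Φ : ℂ × ℝ → E3) : Prop :=
  IsSmoothEmbeddingOn Φ stdCylinder ∧
    ∀ p ∈ stdCylinder,
      0 < det3 (fderiv ℝ Φ p (1, 0)) (fderiv ℝ Φ p (Complex.I, 0)) (fderiv ℝ Φ p (0, 1))

namespace SmoothLink

variable {m : ℕ}

/-- The knot formed by the `i`-th component of a link. -/
def component (L : SmoothLink m) (i : Fin m) : SmoothLink 1 where
  toFun := fun _ => L.toFun i
  smooth := fun _ => L.smooth i
  periodic := fun _ => L.periodic i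
  regular := fun _ => L.regular i
  injective := fun _ _ s t h => ⟨Subsingleton.elim _ _, (L.injective i i s t h).2⟩

/-- The trivial link (unlink): the components bound pairwise disjoint embedded disks. For `m = 1`
this says that the knot is the unknot. -/
def IsTrivial (L : SmoothLink m) : Prop :=
  ∃ e : Fin m → ℂ → E3,
    (∀ i, IsSmoothEmbeddingOn (e i) stdDisk) ∧
    (∀ i, e i '' stdCircle = Set.range (L.toFun i)) ∧
    ∀ i j, i ≠ j → Disjoint (e i '' stdDisk) (e j '' stdDisk)

/-- Ambient isotopy of (parametrized) links. -/
def Isotopic (L L' : SmoothLink m) : Prop :=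
  ∃ H G : ℝ × E3 → E3, ContDiff ℝ ∞ H ∧ ContDiff ℝ ∞ G ∧
    (∀ s x, G (s, H (s, x)) = x) ∧ (∀ s x, H (s, G (s, x)) = x) ∧
    (∀ x, H (0, x) = x) ∧ ∀ i s, H (1, L.toFun i s) = L'.toFun i s

/-- `L'` is obtained from `L` by cutting along the disk `Φ (D² × {0})`, whose boundary circle is
disjoint from `L`, and regluing after `n` full right-handed twists, carried out in the collar
`Φ (D² × [-1, 1])`. This is the effect on `L` of `-1/n`-surgery on the circle `Φ (∂D² × {0})`. -/
def TwistAlong (Φ : ℂ × ℝ → E3) (n : ℤ) (L L' : SmoothLink m) : Prop :=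
  (∀ i s, L.toFun i s ∉ Φ '' stdSide) ∧
    ∀ i s,
      (∀ p ∈ stdCylinder, L.toFun i s = Φ p → L'.toFun i s = Φ (fullTwist n p)) ∧
      (L.toFun i s ∉ Φ '' stdCylinder → L'.toFun i s = L.toFun i s)

/-- The thick disk `Φ` is a collar of a crossing disk for `L`, meeting the components `i` and `j`
(possibly `i = j`): the link meets the thickened disk in exactly two fibres `Φ ({p} × [-1, 1])` and
`Φ ({q} × [-1, 1])` over interior points, lying on the components `i` and `j`. If `i = j` then the
two strands traverse the disk in opposite directions, so that the algebraic intersection number is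
zero; if `i ≠ j` this can be achieved by reorienting one component, and nothing is required. -/
def IsCrossingDisk (L : SmoothLink m) (Φ : ℂ × ℝ → E3) (i j : Fin m) : Prop :=
  IsThickDisk Φ ∧
    ∃ p q : ℂ, ‖p‖ < 1 ∧ ‖q‖ < 1 ∧ p ≠ q ∧
      (⋃ k, Set.range (L.toFun k)) ∩ Φ '' stdCylinder = Φ '' (({p, q} : Set ℂ) ×ˢ Set.Icc (-1) 1) ∧
      ∃ a b r r' : ℝ,
        L.toFun i a = Φ (p, 0) ∧ deriv (L.toFun i) a = r • fderiv ℝ Φ (p, 0) (0, 1) ∧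
        L.toFun j b = Φ (q, 0) ∧ deriv (L.toFun j) b = r' • fderiv ℝ Φ (q, 0) (0, 1) ∧
        (i = j → r * r' < 0)

/-- `L'` is obtained from `L` by a crossing change between a strand of component `i` and a strand of
component `j`: a full twist of either handedness along a crossing disk, that is, `±1`-surgery on
the crossing circle. -/
def CrossingChange (i j : Fin m) (L L' : SmoothLink m) : Prop :=
  ∃ Φ : ℂ × ℝ → E3, L.IsCrossingDisk Φ i j ∧ (TwistAlong Φ 1 L L' ∨ TwistAlong Φ (-1) L L')

/-- `L` becomes trivial after `n` crossing changes, with ambient isotopies allowed before each. -/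
def UnlinkableIn : ℕ → SmoothLink m → Prop
  | 0, L => L.IsTrivial
  | n + 1, L => ∃ L₁ L₂ : SmoothLink m, L.Isotopic L₁ ∧ (∃ i j, CrossingChange i j L₁ L₂) ∧
      UnlinkableIn n L₂

/-- The unknotting (unlinking) number `u(L)`: the least number of crossing changes that turn `L`
into a trivial link. -/
def unlinkingNumber (L : SmoothLink m) : ℕ∞ :=
  ⨅ (n : ℕ) (_ : UnlinkableIn n L), (n : ℕ∞)

/-- The linking number of two components, by Gauss's integral. -/
def linkingNumber (L : SmoothLink m) (i j : Fin m) : ℝ :=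
  1 / (4 * Real.pi) * ∫ s in (0 : ℝ)..1, ∫ t in (0 : ℝ)..1,
    det3 (deriv (L.toFun i) s) (deriv (L.toFun j) t) (L.toFun i s - L.toFun j t) /
      ‖L.toFun i s - L.toFun j t‖ ^ 3

/-- Some crossing change of `L`, possibly after an ambient isotopy, between strands of the components
`i` and `j` produces the trivial link. -/
def IsUnlinkingCrossing (L : SmoothLink m) (i j : Fin m) : Prop :=
  ∃ L₁ L₂ : SmoothLink m, L.Isotopic L₁ ∧ CrossingChange i j L₁ L₂ ∧ L₂.IsTrivial

/-- The knot `J` is (a representative of) `K^n`, obtained by `n` full twists of `K` about the disjoint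
unknot `c`, that is, along a disk bounded by `c`. -/
def IsTwistAbout (K c : SmoothLink 1) (n : ℤ) (J : SmoothLink 1) : Prop :=
  ∃ Φ : ℂ × ℝ → E3, IsThickDisk Φ ∧ Φ '' (stdCircle ×ˢ {0}) = Set.range (c.toFun 0) ∧
    TwistAlong Φ n K J

end SmoothLink

end

/-!
# Twisting about a component of a link of unlinking number one

Let a crossing change along a disk `D` make the link `L`, of linking number zero, trivial.

*Both strands through `D` belong to one component.* A crossing change between two different
components changes their Gauss integral, while ambient isotopies preserve it and trivial links have
Gauss integral zero. Invariance is the closedness of the solid angle form: by Stokes' theorem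
(`gauss_homotopy`), Gauss's integral of a closed curve `γ` and an arc changes, when both move, by the
flux through the paths that the ends of the arc describe. To see that a crossing change has an effect,
make the twist by a link homotopy into one that fixes the strand of `γ` and rotates a short arc of the
other strand `k` times around it (`gauss_twistMap`). Only one end of this arc moves, and it describes a
loop around `γ`. So the change is, up to sign, the Gauss integral of `γ` and this loop
(`gaussArc_twist_ne`), which is shrunk to a small meridian of `γ`. For a small meridian the part of the
integrand near the intersection with the disk has constant sign and dominates the rest
(`exists_gauss_meridian_ne_zero`). No integrality of the linking number is used.

*Both strands belong to `K`.* The crossing disk meets the link in two whole fibres of its collar, which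
lie on `K`, so the other component `c` misses the collar, is unchanged by the crossing change, and hence
is an unknot. A disk bounded by `c` has a bicollar along a normal field (`exists_isThickDisk`), so `K`
can be twisted. Given any thick disk `Φ` bounded by `c`, the height of its collar can be reduced by an
ambient isotopy of the twisted knot (`SmoothLink.isotopic_of_twistAlong_thin`), until the lateral side
of the collar misses both the collar of `D` and the disk `e` that `K` bounds after the crossing change;
both are disjoint from `c`. The twist `T` along the thin collar is discontinuous, but away from the
lateral side it is an orientation-preserving embedding. Therefore `T` takes `D` to a crossing disk for
the twisted knot, and the crossing change along `T D` gives a knot that bounds the disk `T e`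
(`SmoothLink.exists_unknotting_of_twist`).

Maps of the solid cylinder `D² × [-1, 1]` are transplanted to `E3` by `push`. All twists, and the isotopies
constructed from them, are of this form.
-/


noncomputable section

open Filter Topology

/-! ### The triple product -/

theorem det3_eq (u v w : E3) :
    det3 u v w = u 0 * (v 1 * w 2 - v 2 * w 1) - u 1 * (v 0 * w 2 - v 2 * w 0)
      + u 2 * (v 0 * w 1 - v 1 * w 0) := by
  simp only [det3, Matrix.det_fin_three, Matrix.of_apply, Matrix.cons_val_zero, Matrix.cons_val_one,
    Matrix.cons_val]
  ring

theorem det3_map (A : E3 →ₗ[ℝ] E3) (u v w : E3) :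
    det3 (A u) (A v) (A w) = LinearMap.det A * det3 u v w := by
  have key : ∀ u v w : E3,
      det3 u v w = (EuclideanSpace.basisFun (Fin 3) ℝ).toBasis.det ![u, v, w] := by
    intro u v w
    rw [Module.Basis.det_apply, det3, ← Matrix.det_transpose]
    congr 1
    ext i j
    fin_cases i <;> fin_cases j <;> rfl
  rw [key, key, ← Module.Basis.det_comp]
  congr 1
  ext i
  fin_cases i <;> rfl

theorem continuous_det3 : Continuous fun q : E3 × E3 × E3 => det3 q.1 q.2.1 q.2.2 := by
  simp only [det3_eq]
  fun_prop

theorem ContinuousLinearMap.apply_eq_coords (B : ℂ × ℝ →L[ℝ] E3) (z : ℂ) (t : ℝ) :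
    B (z, t) = z.re • B (1, 0) + z.im • B (Complex.I, 0) + t • B (0, 1) := by
  rw [← map_smul, ← map_smul, ← map_smul, ← map_add, ← map_add]
  congr 1
  ext <;> simp

/-- A nonzero triple product of the images of the standard basis makes a linear map injective. -/
theorem injective_of_det3_ne_zero (B : ℂ × ℝ →L[ℝ] E3)
    (h : det3 (B (1, 0)) (B (Complex.I, 0)) (B (0, 1)) ≠ 0) : Function.Injective B := by
  rw [injective_iff_map_eq_zero]
  rintro ⟨z, t⟩ hz
  rw [B.apply_eq_coords] at hz
  set a := B (1, 0)
  set b := B (Complex.I, 0)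
  set c := B (0, 1)
  have h0 := congrArg (fun v : E3 => v 0) hz
  have h1 := congrArg (fun v : E3 => v 1) hz
  have h2 := congrArg (fun v : E3 => v 2) hz
  simp only [PiLp.add_apply, PiLp.smul_apply, smul_eq_mul, PiLp.zero_apply] at h0 h1 h2
  rw [det3_eq] at h
  have e1 : z.re = 0 := by
    refine (mul_eq_zero.1 ?_).resolve_right h
    linear_combination (b 1 * c 2 - b 2 * c 1) * h0 - (b 0 * c 2 - b 2 * c 0) * h1
      + (b 0 * c 1 - b 1 * c 0) * h2
  have e2 : z.im = 0 := by
    refine (mul_eq_zero.1 ?_).resolve_right h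
    linear_combination (c 1 * a 2 - c 2 * a 1) * h0 - (c 0 * a 2 - c 2 * a 0) * h1
      + (c 0 * a 1 - c 1 * a 0) * h2
  have e3 : t = 0 := by
    refine (mul_eq_zero.1 ?_).resolve_right h
    linear_combination (a 1 * b 2 - a 2 * b 1) * h0 - (a 0 * b 2 - a 2 * b 0) * h1
      + (a 0 * b 1 - a 1 * b 0) * h2
  ext <;> simp [Complex.ext_iff, e1, e2, e3]

/-! ### Charts -/

/-- `Φ` is a diffeomorphism of the open set `V` onto an open subset of `E3`, with inverse `Ψ`. -/
structure IsChart (Φ : ℂ × ℝ → E3) (V : Set (ℂ × ℝ)) (Ψ : E3 → ℂ × ℝ) : Prop where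
  isOpen : IsOpen V
  smooth : ∀ y ∈ V, ContDiffAt ℝ ∞ Φ y
  inj : ∀ y ∈ V, Function.Injective (fderiv ℝ Φ y)
  left_inv : ∀ y ∈ V, Ψ (Φ y) = y
  smooth_inv : ∀ y ∈ V, ContDiffAt ℝ ∞ Ψ (Φ y)
  nhds : ∀ y ∈ V, map Φ (𝓝 y) = 𝓝 (Φ y)

theorem finrank_cyl : Module.finrank ℝ (ℂ × ℝ) = Module.finrank ℝ E3 := by
  simp [Complex.finrank_real_complex]

/-- An injective linear map between three-dimensional spaces, as an equivalence. -/
def equivOfInjective (B : ℂ × ℝ →L[ℝ] E3) (h : Function.Injective B) : (ℂ × ℝ) ≃L[ℝ] E3 :=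
  (LinearEquiv.ofInjectiveOfFinrankEq B.toLinearMap h finrank_cyl).toContinuousLinearEquiv

theorem coe_equivOfInjective (B : ℂ × ℝ →L[ℝ] E3) (h : Function.Injective B) :
    (equivOfInjective B h : ℂ × ℝ →L[ℝ] E3) = B := by
  ext x <;> rfl

theorem ContDiffAt.hasStrictFDerivAt_equivOfInjective {Φ : ℂ × ℝ → E3} {y : ℂ × ℝ}
    (hs : ContDiffAt ℝ ∞ Φ y) (hi : Function.Injective (fderiv ℝ Φ y)) :
    HasStrictFDerivAt Φ (equivOfInjective _ hi : ℂ × ℝ →L[ℝ] E3) y := by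
  rw [coe_equivOfInjective]
  exact hs.hasStrictFDerivAt (by simp)

/-- An injective immersion of an open subset of `ℂ × ℝ` is a chart. -/
theorem exists_isChart_of_injOn {Φ : ℂ × ℝ → E3} {V : Set (ℂ × ℝ)} (hV : IsOpen V)
    (hs : ∀ y ∈ V, ContDiffAt ℝ ∞ Φ y) (hi : ∀ y ∈ V, Function.Injective (fderiv ℝ Φ y))
    (hinj : Set.InjOn Φ V) : ∃ Ψ, IsChart Φ V Ψ := by
  have hl : ∀ y ∈ V, Function.invFunOn Φ V (Φ y) = y := fun y hy => hinj.leftInvOn_invFunOn hy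
  refine ⟨Function.invFunOn Φ V, hV, hs, hi, hl, fun y hy => ?_, fun y hy =>
    ((hs y hy).hasStrictFDerivAt_equivOfInjective (hi y hy)).map_nhds_eq_of_equiv⟩
  have hd := (hs y hy).hasStrictFDerivAt_equivOfInjective (hi y hy)
  have h1 := (hs y hy).to_localInverse hd.hasFDerivAt (by simp)
  refine h1.congr_of_eventuallyEq ?_
  rw [Filter.EventuallyEq, ← hd.map_nhds_eq_of_equiv, eventually_map]
  filter_upwards [hd.eventually_left_inverse, hV.mem_nhds hy] with y' e1 e2
  rw [hl y' e2]
  exact e1.symm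

/-- A smooth embedding of a compact set extends to a chart on a neighbourhood. -/
theorem exists_isChart {Φ : ℂ × ℝ → E3} {S : Set (ℂ × ℝ)} (hS : IsCompact S)
    (h : IsSmoothEmbeddingOn Φ S) : ∃ V Ψ, S ⊆ V ∧ IsChart Φ V Ψ := by
  obtain ⟨⟨U, hU, hSU, hΦ⟩, hinj, hd⟩ := h
  have hsm : ∀ y ∈ U, ContDiffAt ℝ ∞ Φ y := fun y hy => hΦ.contDiffAt (hU.mem_nhds hy)
  have hloc : ∀ y ∈ S, ∃ u ∈ 𝓝 y, Set.InjOn Φ u := fun y hy => by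
    have := (hsm y (hSU hy)).hasStrictFDerivAt_equivOfInjective (hd y hy)
    refine ⟨_, (this.toOpenPartialHomeomorph Φ).open_source.mem_nhds
      this.mem_toOpenPartialHomeomorph_source, ?_⟩
    exact (this.toOpenPartialHomeomorph Φ).injOn
  obtain ⟨t, ht, htinj⟩ := hinj.exists_mem_nhdsSet hS
    (fun y hy => (hsm y (hSU hy)).continuousAt) hloc
  obtain ⟨W, hW, hSW, hWt⟩ := mem_nhdsSet_iff_exists.1 ht
  -- injectivity of the derivative is an open condition
  have hopen : ∀ y ∈ S, ∀ᶠ y' in 𝓝 y, Function.Injective (fderiv ℝ Φ y') := fun y hy => by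
    have hc : ContinuousAt (fderiv ℝ Φ) y :=
      ((hsm y (hSU hy)).fderiv_right (m := 0) (by simp)).continuousAt
    have := ContinuousLinearEquiv.nhds (equivOfInjective _ (hd y hy))
    rw [coe_equivOfInjective] at this
    filter_upwards [hc this]
    rintro y' ⟨e, he⟩
    rw [← he]
    exact e.injective
  obtain ⟨X, hX, hSX, hXi⟩ := mem_nhdsSet_iff_exists.1 (eventually_nhdsSet_iff_forall.2 hopen)
  obtain ⟨Ψ, hΨ⟩ := exists_isChart_of_injOn (Φ := Φ) (V := U ∩ W ∩ X)
    ((hU.inter hW).inter hX) (fun y hy => hsm y hy.1.1) (fun y hy => hXi hy.2)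
    (htinj.mono fun y hy => hWt hy.1.2)
  exact ⟨_, Ψ, Set.subset_inter (Set.subset_inter hSU hSW) hSX, hΨ⟩

theorem IsChart.injOn {Φ : ℂ × ℝ → E3} {V : Set (ℂ × ℝ)} {Ψ : E3 → ℂ × ℝ} (h : IsChart Φ V Ψ) :
    Set.InjOn Φ V := fun y hy y' hy' e => by rw [← h.left_inv y hy, e, h.left_inv y' hy']

theorem IsChart.isSmoothEmbeddingOn {Φ : ℂ × ℝ → E3} {V : Set (ℂ × ℝ)} {Ψ : E3 → ℂ × ℝ}
    (h : IsChart Φ V Ψ) {S : Set (ℂ × ℝ)} (hS : S ⊆ V) : IsSmoothEmbeddingOn Φ S :=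
  ⟨⟨V, h.isOpen, hS, fun y hy => (h.smooth y hy).contDiffWithinAt⟩, h.injOn.mono hS,
    fun y hy => h.inj y (hS hy)⟩

/-! ### Disk, circle and cylinder -/

theorem isCompact_stdDisk : IsCompact stdDisk := isCompact_closedBall 0 1

theorem isCompact_stdCircle : IsCompact stdCircle := isCompact_sphere 0 1

theorem isCompact_stdCylinder : IsCompact stdCylinder := isCompact_stdDisk.prod isCompact_Icc

theorem isCompact_stdSide : IsCompact stdSide := isCompact_stdCircle.prod isCompact_Icc

theorem mem_stdCylinder {z : ℂ} {t : ℝ} : (z, t) ∈ stdCylinder ↔ ‖z‖ ≤ 1 ∧ |t| ≤ 1 := by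
  simp [stdCylinder, stdDisk, abs_le]

theorem mem_stdSide {z : ℂ} {t : ℝ} : (z, t) ∈ stdSide ↔ ‖z‖ = 1 ∧ |t| ≤ 1 := by
  simp [stdSide, stdCircle, abs_le]

theorem stdSide_subset : stdSide ⊆ stdCylinder := by
  rintro ⟨z, t⟩ h
  rw [mem_stdSide] at h
  exact mem_stdCylinder.2 ⟨h.1.le, h.2⟩

theorem IsSmoothEmbeddingOn.continuousOn {A : Type} [NormedAddCommGroup A] [NormedSpace ℝ A]
    {f : A → E3} {S : Set A} (h : IsSmoothEmbeddingOn f S) : ContinuousOn f S := by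
  obtain ⟨⟨U, -, hSU, hf⟩, -⟩ := h
  exact hf.continuousOn.mono hSU

theorem IsSmoothEmbeddingOn.contDiffAt {A : Type} [NormedAddCommGroup A] [NormedSpace ℝ A]
    {f : A → E3} {S : Set A} (h : IsSmoothEmbeddingOn f S) {y : A} (hy : y ∈ S) :
    ContDiffAt ℝ ∞ f y := by
  obtain ⟨⟨U, hU, hSU, hf⟩, -⟩ := h
  exact hf.contDiffAt (hU.mem_nhds (hSU hy))

/-! ### Transplanting maps of the solid cylinder -/

open Classical in
/-- The self-map of `E3` that acts as `g` in the coordinates `Φ` of the solid cylinder and is the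
identity elsewhere. -/
def push (Φ : ℂ × ℝ → E3) (g : ℂ × ℝ → ℂ × ℝ) (x : E3) : E3 :=
  if x ∈ Φ '' stdCylinder then Φ (g (Function.invFunOn Φ stdCylinder x)) else x

section push

variable {Φ : ℂ × ℝ → E3} {g g' : ℂ × ℝ → ℂ × ℝ} {x : E3} {y : ℂ × ℝ}

theorem push_of_notMem (h : x ∉ Φ '' stdCylinder) : push Φ g x = x := if_neg h

theorem push_apply (hΦ : Set.InjOn Φ stdCylinder) (hy : y ∈ stdCylinder) :
    push Φ g (Φ y) = Φ (g y) := by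
  rw [push, if_pos (Set.mem_image_of_mem _ hy), hΦ.leftInvOn_invFunOn hy]

theorem push_eq_self (hΦ : Set.InjOn Φ stdCylinder)
    (h : ∀ y ∈ stdCylinder, Φ y = x → g y = y) : push Φ g x = x := by
  by_cases hx : x ∈ Φ '' stdCylinder
  · obtain ⟨y, hy, rfl⟩ := hx
    rw [push_apply hΦ hy, h y hy rfl]
  · exact push_of_notMem hx

theorem push_push (hΦ : Set.InjOn Φ stdCylinder) (hg : Set.MapsTo g stdCylinder stdCylinder) :
    push Φ g' (push Φ g x) = push Φ (g' ∘ g) x := by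
  by_cases hx : x ∈ Φ '' stdCylinder
  · obtain ⟨y, hy, rfl⟩ := hx
    rw [push_apply hΦ hy, push_apply hΦ hy, push_apply hΦ (hg hy)]
    rfl
  · rw [push_of_notMem hx, push_of_notMem hx, push_of_notMem hx]

theorem push_leftInverse (hΦ : Set.InjOn Φ stdCylinder)
    (hg : Set.MapsTo g stdCylinder stdCylinder) (h : ∀ y ∈ stdCylinder, g' (g y) = y) :
    push Φ g' (push Φ g x) = x := by
  rw [push_push hΦ hg]
  exact push_eq_self hΦ fun y hy _ => h y hy

theorem mem_image_of_push_mem (hΦ : Set.InjOn Φ stdCylinder)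
    (hg : Set.MapsTo g stdCylinder stdCylinder)
    (h : ∀ y ∈ stdCylinder, g' (g y) = y)
    {S : Set (ℂ × ℝ)} (hS : S ⊆ stdCylinder) (hSg : Set.MapsTo g' S S) :
    push Φ g x ∈ Φ '' S → x ∈ Φ '' S := by
  rintro ⟨y, hy, e⟩
  have := push_leftInverse (x := x) hΦ hg h
  rw [← e, push_apply hΦ (hS hy)] at this
  exact ⟨g' y, hSg hy, this⟩

/-- A transplanted family of maps is smooth at a point if the family is smooth there in the
coordinates `Φ` and is the identity near this point outside the cylinder. -/
theorem contDiffAt_push {C : Type*} [NormedAddCommGroup C] [NormedSpace ℝ C]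
    (hΦ : IsSmoothEmbeddingOn Φ stdCylinder) {g : C → ℂ × ℝ → ℂ × ℝ} {c : C}
    (h : ∀ y ∈ stdCylinder, Φ y = x → ContDiffAt ℝ ∞ (fun q : C × (ℂ × ℝ) => g q.1 q.2) (c, y) ∧
      g c y ∈ stdCylinder ∧ ∀ᶠ q in 𝓝 (c, y), q.2 ∉ stdCylinder → g q.1 q.2 = q.2) :
    ContDiffAt ℝ ∞ (fun q : C × E3 => push Φ (g q.1) q.2) (c, x) := by
  by_cases hx : x ∈ Φ '' stdCylinder
  · obtain ⟨y, hy, rfl⟩ := hx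
    obtain ⟨h1, h2, h3⟩ := h y hy rfl
    obtain ⟨V, Ψ, hV, hc⟩ := exists_isChart isCompact_stdCylinder hΦ
    have hsm : ContDiffAt ℝ ∞ (fun q : C × E3 => Φ (g q.1 (Ψ q.2))) (c, Φ y) := by
      have e1 : ContDiffAt ℝ ∞ (fun q : C × E3 => (q.1, Ψ q.2)) (c, Φ y) :=
        contDiffAt_fst.prodMk ((hc.smooth_inv y (hV hy)).comp (c, Φ y) contDiffAt_snd)
      have e2 : ContDiffAt ℝ ∞ (fun q : C × E3 => g q.1 (Ψ q.2)) (c, Φ y) := by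
        refine ContDiffAt.comp (g := fun q : C × (ℂ × ℝ) => g q.1 q.2) (c, Φ y) ?_ e1
        simpa only [hc.left_inv y (hV hy)] using h1
      refine ContDiffAt.comp (c, Φ y) ?_ e2
      simpa only [hc.left_inv y (hV hy)] using hc.smooth _ (hV h2)
    refine hsm.congr_of_eventuallyEq ?_
    rw [nhds_prod_eq, ← hc.nhds y (hV hy), ← Filter.map_id (f := 𝓝 c), Filter.prod_map_map_eq,
      ← nhds_prod_eq]
    refine eventually_map.2 ?_
    have hVy : ∀ᶠ q : C × (ℂ × ℝ) in 𝓝 (c, y), q.2 ∈ V :=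
      continuousAt_snd (hc.isOpen.mem_nhds (hV hy))
    filter_upwards [h3, hVy] with q hq hqV
    by_cases hqc : q.2 ∈ stdCylinder
    · simp only [id, hc.left_inv _ hqV, push_apply hΦ.2.1 hqc]
    · have : Φ q.2 ∉ Φ '' stdCylinder := by
        rintro ⟨y', hy', e⟩
        exact hqc (hc.injOn (hV hy') hqV e ▸ hy')
      simp only [id, hc.left_inv _ hqV, push_of_notMem this, hq hqc]
  · have ho : (Φ '' stdCylinder)ᶜ ∈ 𝓝 x :=
      ((isCompact_stdCylinder.image_of_continuousOn hΦ.continuousOn).isClosed.isOpen_compl).mem_nhds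
        hx
    refine contDiffAt_snd.congr_of_eventuallyEq ?_
    have : ∀ᶠ q : C × E3 in 𝓝 (c, x), q.2 ∈ (Φ '' stdCylinder)ᶜ := continuousAt_snd ho
    filter_upwards [this] with q hq
    exact push_of_notMem hq

/-- A transplanted family of maps which is the identity at the heights `|t| ≥ 1` is smooth off the
lateral side of the cylinder. -/
theorem contDiffAt_push_of_notMem_side {C : Type*} [NormedAddCommGroup C] [NormedSpace ℝ C]
    (hΦ : IsSmoothEmbeddingOn Φ stdCylinder) {g : C → ℂ × ℝ → ℂ × ℝ} {c : C}
    (hx : x ∉ Φ '' stdSide)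
    (hg : ∀ y ∈ stdCylinder, Φ y = x → ContDiffAt ℝ ∞ (fun q : C × (ℂ × ℝ) => g q.1 q.2) (c, y))
    (hgm : Set.MapsTo (g c) stdCylinder stdCylinder)
    (hid : ∀ c z t, ‖z‖ ≤ 1 → 1 ≤ |t| → g c (z, t) = (z, t)) :
    ContDiffAt ℝ ∞ (fun q : C × E3 => push Φ (g q.1) q.2) (c, x) := by
  refine contDiffAt_push hΦ fun y hy hyx => ⟨hg y hy hyx, hgm hy, ?_⟩
  obtain ⟨z, t⟩ := y
  have hz := mem_stdCylinder.1 hy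
  have hz1 : ‖z‖ < 1 := lt_of_le_of_ne hz.1 fun e => hx ⟨_, mem_stdSide.2 ⟨e, hz.2⟩, hyx⟩
  have : ∀ᶠ q : C × (ℂ × ℝ) in 𝓝 (c, (z, t)), ‖q.2.1‖ < 1 := by
    have hc : ContinuousAt (fun q : C × (ℂ × ℝ) => ‖q.2.1‖) (c, (z, t)) := by fun_prop
    exact hc.eventually_lt continuousAt_const hz1
  filter_upwards [this]
  rintro ⟨c', z', t'⟩ hq hq'
  rw [mem_stdCylinder] at hq'
  exact hid _ _ _ hq.le (by by_contra! hh; exact hq' ⟨le_of_lt hq, hh.le⟩)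

end push

/-! ### Rotations of the cylinder -/

/-- The rotation of `ℂ` by the angle `θ`. -/
def rot (θ : ℝ) (z : ℂ) : ℂ := Complex.exp ((θ : ℂ) * Complex.I) * z

theorem norm_rot (θ : ℝ) (z : ℂ) : ‖rot θ z‖ = ‖z‖ := by
  rw [rot, norm_mul, Complex.norm_exp_ofReal_mul_I, one_mul]

theorem rot_zero (z : ℂ) : rot 0 z = z := by simp [rot]

theorem rot_rot (θ θ' : ℝ) (z : ℂ) : rot θ (rot θ' z) = rot (θ + θ') z := by
  simp only [rot, ← mul_assoc, ← Complex.exp_add]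
  push_cast
  ring_nf

theorem rot_neg_rot (θ : ℝ) (z : ℂ) : rot (-θ) (rot θ z) = z := by
  rw [rot_rot, neg_add_cancel, rot_zero]

theorem rot_int (n : ℤ) (z : ℂ) : rot (2 * Real.pi * n) z = z := by
  have : ((2 * Real.pi * n : ℝ) : ℂ) * Complex.I = n * (2 * Real.pi * Complex.I) := by
    push_cast; ring
  rw [rot, this, Complex.exp_int_mul_two_pi_mul_I, one_mul]

theorem rot_eq (θ : ℝ) (z : ℂ) :
    rot θ z = ⟨Real.cos θ * z.re - Real.sin θ * z.im, Real.cos θ * z.im + Real.sin θ * z.re⟩ := by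
  apply Complex.ext <;> simp [rot, Complex.exp_ofReal_mul_I_re, Complex.exp_ofReal_mul_I_im]

theorem contDiff_rot : ContDiff ℝ ∞ fun q : ℝ × ℂ => rot q.1 q.2 := by
  unfold rot
  have h : ContDiff ℝ ∞ (fun q : ℝ × ℂ => (q.1 : ℂ) * Complex.I) :=
    (Complex.ofRealCLM.contDiff.comp contDiff_fst).mul contDiff_const
  exact (Complex.contDiff_exp.comp h).mul contDiff_snd

theorem fullTwist_eq (n : ℤ) (z : ℂ) (t : ℝ) :
    fullTwist n (z, t) = (rot (2 * Real.pi * n * Real.smoothTransition ((t + 1) / 2)) z, t) := rfl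

theorem fullTwist_of_one_le {n : ℤ} {z : ℂ} {t : ℝ} (h : 1 ≤ |t|) :
    fullTwist n (z, t) = (z, t) := by
  rw [fullTwist_eq]
  rcases le_abs'.1 h with h | h
  · rw [Real.smoothTransition.zero_of_nonpos (by linarith), mul_zero, rot_zero]
  · rw [Real.smoothTransition.one_of_one_le (by linarith), mul_one, rot_int]

theorem fullTwist_mapsTo (n : ℤ) : Set.MapsTo (fullTwist n) stdCylinder stdCylinder := by
  rintro ⟨z, t⟩ h
  rw [fullTwist_eq, mem_stdCylinder, norm_rot]
  exact mem_stdCylinder.1 h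

theorem fullTwist_mapsTo_side (n : ℤ) : Set.MapsTo (fullTwist n) stdSide stdSide := by
  rintro ⟨z, t⟩ h
  rw [fullTwist_eq, mem_stdSide, norm_rot]
  exact mem_stdSide.1 h

theorem fullTwist_neg_fullTwist (n : ℤ) (y : ℂ × ℝ) : fullTwist (-n) (fullTwist n y) = y := by
  obtain ⟨z, t⟩ := y
  have h := rot_neg_rot (2 * Real.pi * n * Real.smoothTransition ((t + 1) / 2)) z
  rw [fullTwist_eq, fullTwist_eq]
  refine Prod.ext ?_ rfl
  convert h using 2
  push_cast
  ring

theorem contDiff_fullTwist (n : ℤ) : ContDiff ℝ ∞ (fullTwist n) := by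
  have h : ContDiff ℝ ∞ (fun q : ℂ × ℝ =>
      2 * Real.pi * n * Real.smoothTransition ((q.2 + 1) / 2)) := by
    refine contDiff_const.mul (Real.smoothTransition.contDiff.comp ?_)
    fun_prop
  exact (contDiff_rot.comp (h.prodMk contDiff_fst)).prodMk contDiff_snd

/-- The map of `E3` performing `n` full twists along a thick disk. -/
abbrev twistMap (Φ : ℂ × ℝ → E3) (n : ℤ) : E3 → E3 := push Φ (fullTwist n)

section twistMap

variable {Φ : ℂ × ℝ → E3} {x : E3} {n : ℤ}

theorem twistMap_leftInverse (hΦ : Set.InjOn Φ stdCylinder) :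
    twistMap Φ (-n) (twistMap Φ n x) = x :=
  push_leftInverse hΦ (fullTwist_mapsTo n) fun y _ => fullTwist_neg_fullTwist n y

theorem twistMap_injective (hΦ : Set.InjOn Φ stdCylinder) : Function.Injective (twistMap Φ n) :=
  Function.LeftInverse.injective fun _ => twistMap_leftInverse hΦ

theorem twistMap_notMem_side (hΦ : Set.InjOn Φ stdCylinder) (hx : x ∉ Φ '' stdSide) :
    twistMap Φ n x ∉ Φ '' stdSide := fun h => hx <|
  mem_image_of_push_mem hΦ (fullTwist_mapsTo n) (fun y _ => fullTwist_neg_fullTwist n y)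
    stdSide_subset (fullTwist_mapsTo_side _) h

theorem contDiffAt_twistMap (hΦ : IsSmoothEmbeddingOn Φ stdCylinder) (hx : x ∉ Φ '' stdSide) :
    ContDiffAt ℝ ∞ (twistMap Φ n) x := by
  have := contDiffAt_push_of_notMem_side (C := ℝ) (c := 0) (g := fun _ => fullTwist n) hΦ hx
    (fun y _ _ => ((contDiff_fullTwist n).comp contDiff_snd).contDiffAt)
    (fullTwist_mapsTo n) (fun _ _ _ _ h => fullTwist_of_one_le h)
  exact this.comp x (contDiffAt_const.prodMk contDiffAt_id)

theorem isOpen_compl_side (hΦ : IsSmoothEmbeddingOn Φ stdCylinder) : IsOpen (Φ '' stdSide)ᶜ :=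
  (isCompact_stdSide.image_of_continuousOn
    (hΦ.continuousOn.mono stdSide_subset)).isClosed.isOpen_compl

/-- The twist of the cylinder preserves volume. -/
theorem det3_comp_fderiv_fullTwist (B : ℂ × ℝ →L[ℝ] E3) (n : ℤ) (y : ℂ × ℝ) :
    det3 (B (fderiv ℝ (fullTwist n) y (1, 0))) (B (fderiv ℝ (fullTwist n) y (Complex.I, 0)))
      (B (fderiv ℝ (fullTwist n) y (0, 1))) = det3 (B (1, 0)) (B (Complex.I, 0)) (B (0, 1)) := by
  obtain ⟨z, t⟩ := y
  have hd : HasFDerivAt (fullTwist n) (fderiv ℝ (fullTwist n) (z, t)) (z, t) :=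
    ((contDiff_fullTwist n).differentiable (by simp) _).hasFDerivAt
  set D := fderiv ℝ (fullTwist n) (z, t)
  set θ := 2 * Real.pi * n * Real.smoothTransition ((t + 1) / 2) with hθ
  have dir : ∀ w : ℂ, D (w, 0) = (rot θ w, 0) := fun w => by
    have h1 : HasDerivAt (fun s : ℝ => (z, t) + s • ((w, 0) : ℂ × ℝ)) (w, 0) 0 := by
      simpa using ((hasDerivAt_id (0 : ℝ)).smul_const ((w, 0) : ℂ × ℝ)).const_add (z, t)
    have h2 : HasDerivAt (fun s : ℝ => fullTwist n ((z, t) + s • ((w, 0) : ℂ × ℝ))) (D (w, 0)) 0 := by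
      refine HasFDerivAt.comp_hasDerivAt (l := fullTwist n) (0 : ℝ) ?_ h1
      simpa using hd
    have h3 : (fun s : ℝ => fullTwist n ((z, t) + s • ((w, 0) : ℂ × ℝ))) =
        fun s : ℝ => (rot θ z, t) + s • ((rot θ w, 0) : ℂ × ℝ) := by
      ext1 s
      simp only [Prod.smul_mk, Prod.mk_add_mk, smul_zero, add_zero, fullTwist_eq, ← hθ, rot,
        Complex.real_smul]
      congr 1
      ring
    have h4 : HasDerivAt (fun s : ℝ => (rot θ z, t) + s • ((rot θ w, 0) : ℂ × ℝ)) (rot θ w, 0) 0 := by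
      simpa using ((hasDerivAt_id (0 : ℝ)).smul_const ((rot θ w, 0) : ℂ × ℝ)).const_add (rot θ z, t)
    rw [h3] at h2
    exact h2.unique h4
  have hlast : (D (0, 1)).2 = 1 := by
    have h1 : HasFDerivAt (fun y => (fullTwist n y).2)
        ((ContinuousLinearMap.snd ℝ ℂ ℝ).comp D) (z, t) := hd.snd
    have h2 : HasFDerivAt (fun y : ℂ × ℝ => (fullTwist n y).2) (ContinuousLinearMap.snd ℝ ℂ ℝ) (z, t) :=
      hasFDerivAt_snd
    have := congrArg (fun l : ℂ × ℝ →L[ℝ] ℝ => l (0, 1)) (h1.unique h2)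
    simpa using this
  have e3 : D (0, 1) = ((D (0, 1)).1, 1) := Prod.ext rfl hlast
  rw [dir, dir, e3, B.apply_eq_coords, B.apply_eq_coords (rot θ Complex.I),
    B.apply_eq_coords (D (0, 1)).1, rot_eq, rot_eq]
  simp only [det3_eq, PiLp.add_apply, PiLp.smul_apply, smul_eq_mul, Complex.one_re, Complex.one_im,
    Complex.I_re, Complex.I_im]
  linear_combination (det3 (B (1, 0)) (B (Complex.I, 0)) (B (0, 1))) * Real.sin_sq_add_cos_sq θ +
    (1 - (Real.sin θ ^ 2 + Real.cos θ ^ 2)) * det3_eq (B (1, 0)) (B (Complex.I, 0)) (B (0, 1))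

/-- Twisting along a thick disk preserves the orientation of `E3`. -/
theorem det_fderiv_twistMap_pos (hΦ : IsThickDisk Φ) (hx : x ∉ Φ '' stdSide) :
    0 < LinearMap.det (fderiv ℝ (twistMap Φ n) x : E3 →ₗ[ℝ] E3) := by
  by_cases hxc : x ∈ Φ '' stdCylinder
  · obtain ⟨y, hy, rfl⟩ := hxc
    have hT := (contDiffAt_twistMap (n := n) hΦ.1 hx).differentiableAt (by simp)
    have hy' := fullTwist_mapsTo n hy
    have h1 : HasFDerivAt (fun y => twistMap Φ n (Φ y))
        ((fderiv ℝ (twistMap Φ n) (Φ y)).comp (fderiv ℝ Φ y)) y :=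
      hT.hasFDerivAt.comp y ((hΦ.1.contDiffAt hy).differentiableAt (by simp)).hasFDerivAt
    have h2 : HasFDerivAt (fun y => Φ (fullTwist n y))
        ((fderiv ℝ Φ (fullTwist n y)).comp (fderiv ℝ (fullTwist n) y)) y :=
      ((hΦ.1.contDiffAt hy').differentiableAt (by simp)).hasFDerivAt.comp y
        ((contDiff_fullTwist n).differentiable (by simp) y).hasFDerivAt
    have huniq : UniqueDiffWithinAt ℝ stdCylinder y := by
      obtain ⟨z, t⟩ := y
      refine UniqueDiffWithinAt.prod ?_ ?_
      · exact (uniqueDiffOn_convex (convex_closedBall (0 : ℂ) 1) (by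
          rw [interior_closedBall _ (by norm_num)]; exact ⟨0, by simp⟩)) z hy.1
      · exact uniqueDiffOn_Icc (by norm_num) t hy.2
    have h3 := huniq.eq h1.hasFDerivWithinAt (h2.hasFDerivWithinAt.congr
      (fun y hy => push_apply hΦ.1.2.1 hy) (push_apply hΦ.1.2.1 hy))
    have e := det3_map (fderiv ℝ (twistMap Φ n) (Φ y) : E3 →ₗ[ℝ] E3) (fderiv ℝ Φ y (1, 0))
      (fderiv ℝ Φ y (Complex.I, 0)) (fderiv ℝ Φ y (0, 1))
    have e' : ∀ v, (fderiv ℝ (twistMap Φ n) (Φ y)) (fderiv ℝ Φ y v) =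
        fderiv ℝ Φ (fullTwist n y) (fderiv ℝ (fullTwist n) y v) := fun v =>
      congrArg (fun l : ℂ × ℝ →L[ℝ] E3 => l v) h3
    simp only [ContinuousLinearMap.coe_coe, e', det3_comp_fderiv_fullTwist] at e
    have p1 := hΦ.2 y hy
    have p2 := hΦ.2 _ hy'
    rw [e] at p2
    exact (pos_iff_pos_of_mul_pos p2).2 p1
  · have ho : (Φ '' stdCylinder)ᶜ ∈ 𝓝 x := ((isCompact_stdCylinder.image_of_continuousOn
      hΦ.1.continuousOn).isClosed.isOpen_compl).mem_nhds hxc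
    have : twistMap Φ n =ᶠ[𝓝 x] id := by
      filter_upwards [ho] with x' hx'
      exact push_of_notMem hx'
    rw [this.fderiv_eq, fderiv_id]
    simp

end twistMap

/-! ### Composition with orientation-preserving maps -/

theorem injective_of_det_pos {A : E3 →L[ℝ] E3} (h : 0 < LinearMap.det (A : E3 →ₗ[ℝ] E3)) :
    Function.Injective A :=
  (LinearMap.equivOfDetNeZero (A : E3 →ₗ[ℝ] E3) h.ne').injective

/-- `f` is an orientation-preserving smooth embedding of the open set `O`. -/
structure IsOrientedEmbedding (f : E3 → E3) (O : Set E3) : Prop where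
  isOpen : IsOpen O
  smooth : ∀ x ∈ O, ContDiffAt ℝ ∞ f x
  injOn : Set.InjOn f O
  det_pos : ∀ x ∈ O, 0 < LinearMap.det (fderiv ℝ f x : E3 →ₗ[ℝ] E3)

theorem IsOrientedEmbedding.comp_isSmoothEmbeddingOn {f : E3 → E3} {O : Set E3}
    (hf : IsOrientedEmbedding f O) {A : Type} [NormedAddCommGroup A] [NormedSpace ℝ A] {e : A → E3}
    {S : Set A} (he : IsSmoothEmbeddingOn e S) (hO : Set.MapsTo e S O) :
    IsSmoothEmbeddingOn (f ∘ e) S := by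
  refine ⟨?_, hf.injOn.comp he.2.1 hO, fun p hp => ?_⟩
  · obtain ⟨⟨U, hU, hSU, hs⟩, -⟩ := he
    refine ⟨U ∩ e ⁻¹' O, hs.continuousOn.isOpen_inter_preimage hU hf.isOpen,
      fun p hp => ⟨hSU hp, hO hp⟩, fun p hp => ?_⟩
    exact ((hf.smooth _ hp.2).comp p (hs.contDiffAt (hU.mem_nhds hp.1))).contDiffWithinAt
  · rw [fderiv_comp p ((hf.smooth _ (hO hp)).differentiableAt (by simp))
      ((he.contDiffAt hp).differentiableAt (by simp))]
    exact (injective_of_det_pos (hf.det_pos _ (hO hp))).comp (he.2.2 p hp)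

theorem IsOrientedEmbedding.comp_isThickDisk {f : E3 → E3} {O : Set E3}
    (hf : IsOrientedEmbedding f O) {Φ : ℂ × ℝ → E3} (hΦ : IsThickDisk Φ)
    (hO : Set.MapsTo Φ stdCylinder O) : IsThickDisk (f ∘ Φ) := by
  refine ⟨hf.comp_isSmoothEmbeddingOn hΦ.1 hO, fun p hp => ?_⟩
  rw [fderiv_comp p ((hf.smooth _ (hO hp)).differentiableAt (by simp))
      ((hΦ.1.contDiffAt hp).differentiableAt (by simp))]
  have := det3_map (fderiv ℝ f (Φ p) : E3 →ₗ[ℝ] E3) (fderiv ℝ Φ p (1, 0))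
    (fderiv ℝ Φ p (Complex.I, 0)) (fderiv ℝ Φ p (0, 1))
  simp only [ContinuousLinearMap.coe_coe] at this
  simp only [ContinuousLinearMap.comp_apply]
  rw [this]
  exact mul_pos (hf.det_pos _ (hO hp)) (hΦ.2 p hp)

theorem isOrientedEmbedding_twistMap {Φ : ℂ × ℝ → E3} (hΦ : IsThickDisk Φ) (n : ℤ) :
    IsOrientedEmbedding (twistMap Φ n) (Φ '' stdSide)ᶜ :=
  ⟨isOpen_compl_side hΦ.1, fun _ hx => contDiffAt_twistMap hΦ.1 hx,
    (twistMap_injective hΦ.1.2.1).injOn, fun _ hx => det_fderiv_twistMap_pos hΦ hx⟩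

/-- The final map of an ambient isotopy is an orientation-preserving diffeomorphism. -/
theorem isOrientedEmbedding_of_isotopy {H G : ℝ × E3 → E3} (hH : ContDiff ℝ ∞ H)
    (hG : ContDiff ℝ ∞ G) (hGH : ∀ s x, G (s, H (s, x)) = x) (h0 : ∀ x, H (0, x) = x) :
    IsOrientedEmbedding (fun x => H (1, x)) Set.univ := by
  have hs : ∀ s, ContDiff ℝ ∞ fun x => H (s, x) := fun s => hH.comp (contDiff_prodMk_right s)
  have hs' : ∀ s, ContDiff ℝ ∞ fun x => G (s, x) := fun s => hG.comp (contDiff_prodMk_right s)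
  refine ⟨isOpen_univ, fun x _ => (hs 1).contDiffAt,
    fun x _ y _ e => ?_, fun x _ => ?_⟩
  · have := congrArg (fun z => G (1, z)) e
    simpa only [hGH] using this
  · set d : ℝ → ℝ := fun s => LinearMap.det (fderiv ℝ (fun x => H (s, x)) x : E3 →ₗ[ℝ] E3) with hd
    have hne : ∀ s, d s ≠ 0 := fun s => by
      have h1 : HasFDerivAt (fun x => G (s, H (s, x))) ((fderiv ℝ (fun x => G (s, x)) (H (s, x))).comp
          (fderiv ℝ (fun x => H (s, x)) x)) x :=
        ((hs' s).differentiable (by simp) _).hasFDerivAt.comp x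
          ((hs s).differentiable (by simp) _).hasFDerivAt
      simp only [hGH] at h1
      have h2 := h1.unique (hasFDerivAt_id x)
      have h3 : LinearMap.det ((fderiv ℝ (fun x => G (s, x)) (H (s, x)) : E3 →ₗ[ℝ] E3) ∘ₗ
          (fderiv ℝ (fun x => H (s, x)) x : E3 →ₗ[ℝ] E3)) = 1 :=
        (congrArg (fun l : E3 →L[ℝ] E3 => LinearMap.det (l : E3 →ₗ[ℝ] E3)) h2).trans LinearMap.det_id
      rw [LinearMap.det_comp] at h3
      exact right_ne_zero_of_mul_eq_one h3
    have hc : Continuous d := by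
      have e : ∀ s, fderiv ℝ (fun x => H (s, x)) x =
          (fderiv ℝ H (s, x)).comp (ContinuousLinearMap.inr ℝ ℝ E3) := fun s =>
        (((hH.differentiable (by simp) _).hasFDerivAt).comp x (hasFDerivAt_prodMk_right s x)).fderiv
      have c1 : Continuous fun s => fderiv ℝ (fun x => H (s, x)) x := by
        simp only [e]
        exact ((hH.continuous_fderiv (by simp)).comp (by fun_prop)).clm_comp continuous_const
      exact ContinuousLinearMap.continuous_det.comp c1
    have hd0 : d 0 = 1 := by
      simp only [hd, h0]
      simp
    by_contra hneg
    have := isPreconnected_univ.intermediate_value (Set.mem_univ (1 : ℝ)) (Set.mem_univ 0)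
      hc.continuousOn
    obtain ⟨s, -, hs0⟩ := this ⟨not_lt.1 hneg, by rw [hd0]; norm_num⟩
    exact hne s hs0

/-! ### Links and their images -/

namespace SmoothLink

variable {m : ℕ}

theorem isCompact_range (L : SmoothLink m) (i : Fin m) : IsCompact (Set.range (L.toFun i)) :=
  (L.periodic i).compact_of_continuous one_ne_zero (L.smooth i).continuous

theorem disjoint_range (L : SmoothLink m) {i j : Fin m} (h : i ≠ j) :
    Disjoint (Set.range (L.toFun i)) (Set.range (L.toFun j)) := by
  rw [Set.disjoint_left]
  rintro _ ⟨s, rfl⟩ ⟨t, ht⟩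
  exact h (L.injective j i t s ht).1.symm

/-- The image of a link under a map which near the link is a diffeomorphism onto its image, with
inverse `f'`. -/
def map (L : SmoothLink m) (f f' : E3 → E3) (hf : ∀ i s, ContDiffAt ℝ ∞ f (L.toFun i s))
    (hf' : ∀ i s, DifferentiableAt ℝ f' (f (L.toFun i s)))
    (hl : ∀ i s, f' (f (L.toFun i s)) = L.toFun i s) : SmoothLink m where
  toFun i s := f (L.toFun i s)
  smooth i := contDiff_iff_contDiffAt.2 fun s => (hf i s).comp s (L.smooth i).contDiffAt
  periodic i s := congrArg f (L.periodic i s)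
  regular i s h := by
    have h1 : HasDerivAt (fun s => f (L.toFun i s)) 0 s := by
      rw [← h]
      exact (((hf i s).comp s (L.smooth i).contDiffAt).differentiableAt (by simp)).hasDerivAt
    have h2 := (hf' i s).hasFDerivAt.comp_hasDerivAt s h1
    rw [map_zero] at h2
    have h3 : f' ∘ (fun s => f (L.toFun i s)) = L.toFun i := funext fun s => hl i s
    rw [h3] at h2
    exact L.regular i s h2.deriv
  injective i j s t h := by
    have := congrArg f' h
    rw [hl, hl] at this
    exact L.injective i j s t this

theorem Isotopic.symm {L L' : SmoothLink m} (h : L.Isotopic L') : L'.Isotopic L := by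
  obtain ⟨H, G, hH, hG, hGH, hHG, h0, h1⟩ := h
  refine ⟨G, H, hG, hH, hHG, hGH, fun x => ?_, fun i s => ?_⟩
  · rw [← h0 (G (0, x)), hHG]
  · rw [← h1, hGH]

theorem Isotopic.trans {L L' L'' : SmoothLink m} (h : L.Isotopic L') (h' : L'.Isotopic L'') :
    L.Isotopic L'' := by
  obtain ⟨H, G, hH, hG, hGH, hHG, h0, h1⟩ := h
  obtain ⟨H', G', hH', hG', hGH', hHG', h0', h1'⟩ := h'
  refine ⟨fun q => H' (q.1, H q), fun q => G (q.1, G' q), hH'.comp (contDiff_fst.prodMk hH),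
    hG.comp (contDiff_fst.prodMk hG'), fun s x => ?_, fun s x => ?_, fun x => ?_, fun i s => ?_⟩
  · simp only [hGH', hGH]
  · simp only [hHG, hHG']
  · simp only [h0, h0']
  · simp only [h1, h1']

theorem Isotopic.component {L L' : SmoothLink m} (h : L.Isotopic L') (i : Fin m) :
    (L.component i).Isotopic (L'.component i) := by
  obtain ⟨H, G, hH, hG, hGH, hHG, h0, h1⟩ := h
  exact ⟨H, G, hH, hG, hGH, hHG, h0, fun _ s => h1 i s⟩

theorem IsTrivial.component {L : SmoothLink m} (h : L.IsTrivial) (i : Fin m) :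
    (L.component i).IsTrivial := by
  obtain ⟨e, h1, h2, -⟩ := h
  exact ⟨fun _ => e i, fun _ => h1 i, fun _ => h2 i,
    fun j k hjk => (hjk (Subsingleton.elim _ _)).elim⟩

theorem IsTrivial.isotopic {L L' : SmoothLink m} (h : L.IsTrivial) (hL : L.Isotopic L') :
    L'.IsTrivial := by
  obtain ⟨H, G, hH, hG, hGH, hHG, h0, h1⟩ := hL
  obtain ⟨e, he, hb, hd⟩ := h
  have hf := isOrientedEmbedding_of_isotopy hH hG hGH h0
  refine ⟨fun i => (fun x => H (1, x)) ∘ e i,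
    fun i => hf.comp_isSmoothEmbeddingOn (he i) (Set.mapsTo_univ _ _), fun i => ?_, fun i j hij => ?_⟩
  · rw [Set.image_comp, hb, ← Set.range_comp]
    exact congrArg Set.range (funext fun s => h1 i s)
  · rw [Set.image_comp, Set.image_comp]
    exact (Set.disjoint_image_iff fun x y e => hf.injOn (Set.mem_univ x) (Set.mem_univ y) e).2
      (hd i j hij)

theorem twistAlong_iff {Φ : ℂ × ℝ → E3} (hΦ : Set.InjOn Φ stdCylinder) {n : ℤ}
    {L L' : SmoothLink m} : TwistAlong Φ n L L' ↔ (∀ i s, L.toFun i s ∉ Φ '' stdSide) ∧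
      ∀ i s, L'.toFun i s = twistMap Φ n (L.toFun i s) := by
  refine and_congr_right fun _ => forall₂_congr fun i s => ⟨fun h => ?_, fun h => ⟨?_, ?_⟩⟩
  · by_cases hx : L.toFun i s ∈ Φ '' stdCylinder
    · obtain ⟨p, hp, e⟩ := hx
      rw [h.1 p hp e.symm, ← e, twistMap, push_apply hΦ hp]
    · rw [h.2 hx, twistMap, push_of_notMem hx]
  · rintro p hp e
    rw [h, e, twistMap, push_apply hΦ hp]
  · intro hx
    rw [h, twistMap, push_of_notMem hx]

/-- The link obtained by `n` full twists along a thick disk. -/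
def twist (L : SmoothLink m) (Φ : ℂ × ℝ → E3) (hΦ : IsThickDisk Φ) (n : ℤ)
    (h : ∀ i s, L.toFun i s ∉ Φ '' stdSide) : SmoothLink m :=
  L.map (twistMap Φ n) (twistMap Φ (-n)) (fun i s => contDiffAt_twistMap hΦ.1 (h i s))
    (fun i s => (contDiffAt_twistMap hΦ.1 (twistMap_notMem_side hΦ.1.2.1 (h i s))).differentiableAt
      (by simp)) (fun _ _ => twistMap_leftInverse hΦ.1.2.1)

theorem twistAlong_twist (L : SmoothLink m) {Φ : ℂ × ℝ → E3} (hΦ : IsThickDisk Φ) (n : ℤ)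
    (h : ∀ i s, L.toFun i s ∉ Φ '' stdSide) : TwistAlong Φ n L (L.twist Φ hΦ n h) :=
  (twistAlong_iff hΦ.1.2.1).2 ⟨h, fun _ _ => rfl⟩

/-- The fibre of a crossing disk through a point of the `i`-th component lies on this component,
because it is connected. -/
theorem fibre_subset_range (L : SmoothLink m) {Φ : ℂ × ℝ → E3} (hΦ : ContinuousOn Φ stdCylinder)
    {i : Fin m} {p : ℂ} (hp : ‖p‖ < 1) (hL : ∀ t ∈ Set.Icc (-1 : ℝ) 1,
      Φ (p, t) ∈ ⋃ k, Set.range (L.toFun k)) (hi : Φ (p, 0) ∈ Set.range (L.toFun i)) :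
    ∀ t ∈ Set.Icc (-1 : ℝ) 1, Φ (p, t) ∈ Set.range (L.toFun i) := by
  have hc : ContinuousOn (fun t : ℝ => Φ (p, t)) (Set.Icc (-1) 1) :=
    hΦ.comp (by fun_prop) fun t ht => mem_stdCylinder.2 ⟨hp.le, abs_le.2 ht⟩
  have hpre : IsPreconnected ((fun t : ℝ => Φ (p, t)) '' Set.Icc (-1) 1) :=
    isPreconnected_Icc.image _ hc
  have hcl : IsClosed (⋃ k ∈ {k | k ≠ i}, Set.range (L.toFun k)) :=
    (Set.toFinite _).isClosed_biUnion fun k _ => (L.isCompact_range k).isClosed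
  have := isPreconnected_iff_subset_of_disjoint_closed.1 hpre (Set.range (L.toFun i)) _
    (L.isCompact_range i).isClosed hcl ?_ ?_
  · intro t ht
    rcases this with h | h
    · exact h ⟨t, ht, rfl⟩
    · exfalso
      have h0 := h ⟨0, by norm_num, rfl⟩
      simp only [Set.mem_iUnion] at h0
      obtain ⟨k, hk, h0⟩ := h0
      exact Set.disjoint_left.1 (L.disjoint_range (Ne.symm hk)) hi h0
  · rintro _ ⟨t, ht, rfl⟩
    obtain ⟨k, hk⟩ := Set.mem_iUnion.1 (hL t ht)
    by_cases hki : k = i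
    · exact Or.inl (hki ▸ hk)
    · exact Or.inr (Set.mem_biUnion (show k ∈ {k | k ≠ i} from hki) hk)
  · rw [Set.eq_empty_iff_forall_notMem]
    rintro x ⟨-, h1, h2⟩
    simp only [Set.mem_iUnion] at h2
    obtain ⟨k, hk, h2⟩ := h2
    exact Set.disjoint_left.1 (L.disjoint_range (Ne.symm hk)) h1 h2

/-- A crossing disk for two strands of one component misses all other components. -/
theorem disjoint_crossingDisk (L : SmoothLink m) {Φ : ℂ × ℝ → E3} {i c : Fin m}
    (h : L.IsCrossingDisk Φ i i) (hc : c ≠ i) :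
    Disjoint (Set.range (L.toFun c)) (Φ '' stdCylinder) := by
  obtain ⟨hΦ, p, q, hp, hq, -, hcyl, a, b, r, r', ha, -, hb, -⟩ := h
  rw [Set.disjoint_left]
  intro x hx hx'
  have hmem : x ∈ Φ '' (({p, q} : Set ℂ) ×ˢ Set.Icc (-1) 1) := by
    rw [← hcyl]
    exact ⟨Set.mem_iUnion.2 ⟨c, hx⟩, hx'⟩
  have hsub : ∀ z ∈ ({p, q} : Set ℂ), ∀ t ∈ Set.Icc (-1 : ℝ) 1,
      Φ (z, t) ∈ ⋃ k, Set.range (L.toFun k) := fun z hz t ht => by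
    have : Φ (z, t) ∈ Φ '' (({p, q} : Set ℂ) ×ˢ Set.Icc (-1) 1) := ⟨_, ⟨hz, ht⟩, rfl⟩
    rw [← hcyl] at this
    exact this.1
  obtain ⟨⟨z, t⟩, ⟨hz, ht⟩, rfl⟩ := hmem
  refine Set.disjoint_left.1 (L.disjoint_range hc) hx ?_
  rcases hz with rfl | hz
  · exact L.fibre_subset_range hΦ.1.continuousOn hp (hsub z (by simp)) ⟨a, ha⟩ t ht
  · obtain rfl : z = q := hz
    exact L.fibre_subset_range hΦ.1.continuousOn hq (hsub z (by simp)) ⟨b, hb⟩ t ht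

end SmoothLink

/-! ### Collars of embedded disks -/

theorem exists_tube {S : Set ℂ} (hS : IsCompact S) {P : Set (ℂ × ℝ)}
    (h : ∀ z ∈ S, P ∈ 𝓝 (z, (0 : ℝ))) : ∃ ε > 0, ε ≤ 1 ∧ S ×ˢ Set.Icc (-ε) ε ⊆ P := by
  obtain ⟨u, v, -, hv, hSu, h0, huv⟩ := generalized_tube_lemma hS (isCompact_singleton (x := (0 : ℝ)))
    (isOpen_interior (s := P)) (by
      rintro ⟨z, t⟩ ⟨hz, ht⟩
      obtain rfl : t = 0 := ht
      exact mem_interior_iff_mem_nhds.2 (h z hz))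
  obtain ⟨δ, hδ, hδv⟩ := Metric.isOpen_iff.1 hv 0 (h0 rfl)
  refine ⟨min (δ / 2) 1, by positivity, min_le_right _ _, ?_⟩
  rintro ⟨z, t⟩ ⟨hz, ht⟩
  refine interior_subset (huv ⟨hSu hz, hδv ?_⟩)
  rw [Metric.mem_ball, Real.dist_eq, sub_zero]
  have := (abs_le.2 ht).trans (min_le_left _ _)
  linarith

/-- Rescaling of the height of a collar. -/
def thin (ε : ℝ) (Φ : ℂ × ℝ → E3) (y : ℂ × ℝ) : E3 := Φ (y.1, ε * y.2)

theorem isThickDisk_thin {Φ : ℂ × ℝ → E3} {ε : ℝ} (hε : 0 < ε)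
    (h : IsSmoothEmbeddingOn Φ (stdDisk ×ˢ Set.Icc (-ε) ε))
    (hd : ∀ p ∈ stdDisk ×ˢ Set.Icc (-ε) ε,
      0 < det3 (fderiv ℝ Φ p (1, 0)) (fderiv ℝ Φ p (Complex.I, 0)) (fderiv ℝ Φ p (0, 1))) :
    IsThickDisk (thin ε Φ) := by
  set σ : ℂ × ℝ →L[ℝ] ℂ × ℝ :=
    (ContinuousLinearMap.fst ℝ ℂ ℝ).prod (ε • ContinuousLinearMap.snd ℝ ℂ ℝ) with hσ
  have hcomp : thin ε Φ = Φ ∘ σ := by ext1 y; simp [thin, hσ]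
  have hσm : Set.MapsTo σ stdCylinder (stdDisk ×ˢ Set.Icc (-ε) ε) := by
    rintro ⟨z, t⟩ ⟨hz, ht⟩
    refine ⟨hz, ?_⟩
    have ht' := abs_le.2 ht
    change |t| ≤ 1 at ht'
    refine abs_le.1 ?_
    change |ε * t| ≤ ε
    rw [abs_mul, abs_of_pos hε]
    nlinarith
  have hσi : Function.Injective σ := by
    rintro ⟨z, t⟩ ⟨z', t'⟩ e
    simp only [hσ, ContinuousLinearMap.prod_apply, ContinuousLinearMap.coe_fst',
      _root_.smul_apply, ContinuousLinearMap.coe_snd', smul_eq_mul, Prod.mk.injEq,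
      mul_eq_mul_left_iff, hε.ne', or_false] at e
    exact Prod.ext e.1 e.2
  have hf : ∀ p ∈ stdCylinder, fderiv ℝ (thin ε Φ) p = (fderiv ℝ Φ (σ p)).comp σ := fun p hp => by
    rw [hcomp, fderiv_comp p ((h.contDiffAt (hσm hp)).differentiableAt (by simp))
      σ.differentiableAt, σ.fderiv]
  refine ⟨⟨?_, ?_, fun p hp => ?_⟩, fun p hp => ?_⟩
  · obtain ⟨⟨U, hU, hSU, hs⟩, -⟩ := h
    refine ⟨σ ⁻¹' U, hU.preimage σ.continuous, fun p hp => hSU (hσm hp), ?_⟩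
    rw [hcomp]
    exact hs.comp σ.contDiff.contDiffOn (Set.mapsTo_preimage _ _)
  · rw [hcomp]
    exact h.2.1.comp hσi.injOn hσm
  · rw [hf p hp]
    exact (h.2.2 _ (hσm hp)).comp hσi
  · rw [hf p hp]
    have e1 : σ (1, 0) = (1, 0) := by simp [hσ]
    have e2 : σ (Complex.I, 0) = (Complex.I, 0) := by simp [hσ]
    have e3 : σ (0, 1) = ε • (0, 1) := by simp [hσ]
    simp only [ContinuousLinearMap.comp_apply, e1, e2, e3, map_smul]
    have := hd _ (hσm hp)
    rw [det3_eq] at this ⊢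
    simp only [PiLp.smul_apply, smul_eq_mul]
    have := mul_pos hε this
    linarith

/-- The cross product on `E3`. -/
def cross3 (u v : E3) : E3 :=
  (u 1 * v 2 - u 2 * v 1) • EuclideanSpace.single 0 1 +
    (u 2 * v 0 - u 0 * v 2) • EuclideanSpace.single 1 1 +
    (u 0 * v 1 - u 1 * v 0) • EuclideanSpace.single 2 1

theorem ContDiffOn.cross3 {f g : ℂ → E3} {U : Set ℂ} (hf : ContDiffOn ℝ ∞ f U)
    (hg : ContDiffOn ℝ ∞ g U) : ContDiffOn ℝ ∞ (fun z => cross3 (f z) (g z)) U := by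
  unfold _root_.cross3
  fun_prop

theorem det3_cross3_pos {u v : E3} (h : LinearIndependent ℝ ![u, v]) :
    0 < det3 u v (cross3 u v) := by
  have e : det3 u v (cross3 u v) = (u 1 * v 2 - u 2 * v 1) ^ 2 + (u 2 * v 0 - u 0 * v 2) ^ 2 +
      (u 0 * v 1 - u 1 * v 0) ^ 2 := by
    simp [det3_eq, cross3]
    ring
  rw [e]
  by_contra hneg
  obtain ⟨h0, h1, h2⟩ : u 1 * v 2 - u 2 * v 1 = 0 ∧ u 2 * v 0 - u 0 * v 2 = 0 ∧
      u 0 * v 1 - u 1 * v 0 = 0 := by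
    have p0 := sq_nonneg (u 1 * v 2 - u 2 * v 1)
    have p1 := sq_nonneg (u 2 * v 0 - u 0 * v 2)
    have p2 := sq_nonneg (u 0 * v 1 - u 1 * v 0)
    exact ⟨pow_eq_zero_iff two_ne_zero |>.1 (by linarith), pow_eq_zero_iff two_ne_zero |>.1 (by linarith),
      pow_eq_zero_iff two_ne_zero |>.1 (by linarith)⟩
  rw [LinearIndependent.pair_iff] at h
  -- all the relations `v k • u - u k • v = 0` hold, so `u = 0`
  have key : ∀ k, v k • u + (-u k) • v = 0 := by
    intro k
    ext l
    fin_cases k <;> fin_cases l <;> simp <;> linarith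
  have hu : u = 0 := by
    ext k
    simpa using (h _ _ (key k)).2
  have := (h 1 0 (by simp [hu])).1
  exact one_ne_zero this

/-- The normal field of an immersed surface, of non-unit length. -/
def normalField (e : ℂ → E3) (z : ℂ) : E3 := cross3 (fderiv ℝ e z 1) (fderiv ℝ e z Complex.I)

/-- The flow-out of a surface along its normal field. -/
def normalCollar (e : ℂ → E3) (y : ℂ × ℝ) : E3 := e y.1 + y.2 • normalField e y.1

section normalCollar

variable {e : ℂ → E3}

theorem normalCollar_zero (z : ℂ) : normalCollar e (z, 0) = e z := by simp [normalCollar]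

theorem contDiffOn_normalCollar {U : Set ℂ} (hU : IsOpen U) (hs : ContDiffOn ℝ ∞ e U) :
    ContDiffOn ℝ ∞ (normalCollar e) (Prod.fst ⁻¹' U) := by
  have hsd : ContDiffOn ℝ ∞ (fderiv ℝ e) U := hs.fderiv_of_isOpen hU (by simp)
  have h1 : ∀ w : ℂ, ContDiffOn ℝ ∞ (fun z => fderiv ℝ e z w) U := fun w =>
    hsd.clm_apply contDiffOn_const
  have hsN : ContDiffOn ℝ ∞ (normalField e) U := (h1 1).cross3 (h1 Complex.I)
  have hm : Set.MapsTo (Prod.fst : ℂ × ℝ → ℂ) (Prod.fst ⁻¹' U) U := Set.mapsTo_preimage _ _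
  have h3 : ContDiffOn ℝ ∞ (fun y : ℂ × ℝ => e y.1) (Prod.fst ⁻¹' U) :=
    hs.comp contDiff_fst.contDiffOn hm
  have h4 : ContDiffOn ℝ ∞ (fun y : ℂ × ℝ => normalField e y.1) (Prod.fst ⁻¹' U) :=
    hsN.comp contDiff_fst.contDiffOn hm
  exact h3.add (contDiff_snd.contDiffOn.smul h4)

theorem fderiv_normalCollar_left {z : ℂ} (h : DifferentiableAt ℝ (normalCollar e) (z, 0)) (w : ℂ) :
    fderiv ℝ (normalCollar e) (z, 0) (w, 0) = fderiv ℝ e z w := by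
  have h1 : HasFDerivAt (fun z => normalCollar e (z, 0)) ((fderiv ℝ (normalCollar e) (z, 0)).comp
      (ContinuousLinearMap.inl ℝ ℂ ℝ)) z := 
    HasFDerivAt.comp (g := normalCollar e) z h.hasFDerivAt (hasFDerivAt_prodMk_left z (0 : ℝ))
  simp only [normalCollar_zero] at h1
  rw [h1.fderiv]
  simp

theorem fderiv_normalCollar_right {z : ℂ} (h : DifferentiableAt ℝ (normalCollar e) (z, 0)) :
    fderiv ℝ (normalCollar e) (z, 0) (0, 1) = normalField e z := by
  have h1 : HasFDerivAt (fun t => normalCollar e (z, t)) ((fderiv ℝ (normalCollar e) (z, 0)).comp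
      (ContinuousLinearMap.inr ℝ ℂ ℝ)) 0 := 
    HasFDerivAt.comp (g := normalCollar e) (0 : ℝ) h.hasFDerivAt (hasFDerivAt_prodMk_right z (0 : ℝ))
  have h2 : HasFDerivAt (fun t : ℝ => normalCollar e (z, t))
      ((ContinuousLinearMap.id ℝ ℝ).smulRight (normalField e z)) 0 :=
    ((hasFDerivAt_id (0 : ℝ)).smul_const (normalField e z)).const_add (e z)
  have := congrArg (fun l : ℝ →L[ℝ] E3 => l 1) (h1.unique h2)
  simpa using this

theorem det3_fderiv_normalCollar_pos {z : ℂ} (h : DifferentiableAt ℝ (normalCollar e) (z, 0))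
    (hi : Function.Injective (fderiv ℝ e z)) :
    0 < det3 (fderiv ℝ (normalCollar e) (z, 0) (1, 0))
      (fderiv ℝ (normalCollar e) (z, 0) (Complex.I, 0))
      (fderiv ℝ (normalCollar e) (z, 0) (0, 1)) := by
  rw [fderiv_normalCollar_left h, fderiv_normalCollar_left h, fderiv_normalCollar_right h]
  refine det3_cross3_pos ?_
  rw [LinearIndependent.pair_iff]
  intro a b hab
  rw [← map_smul, ← map_smul, ← map_add, map_eq_zero_iff _ hi] at hab
  have h1 := congrArg Complex.re hab
  have h2 := congrArg Complex.im hab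
  simp at h1 h2
  exact ⟨h1, h2⟩

end normalCollar

theorem continuousAt_det3_fderiv {Φ : ℂ × ℝ → E3} {y : ℂ × ℝ} (h : ContDiffAt ℝ ∞ Φ y) :
    ContinuousAt (fun y => det3 (fderiv ℝ Φ y (1, 0)) (fderiv ℝ Φ y (Complex.I, 0))
      (fderiv ℝ Φ y (0, 1))) y := by
  have hcont : ContinuousAt (fderiv ℝ Φ) y := (h.fderiv_right (m := 0) (by simp)).continuousAt
  exact continuous_det3.continuousAt.comp (f := fun y => (fderiv ℝ Φ y (1, 0),
    fderiv ℝ Φ y (Complex.I, 0), fderiv ℝ Φ y (0, 1))) ((hcont.clm_apply continuousAt_const).prodMk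
      ((hcont.clm_apply continuousAt_const).prodMk (hcont.clm_apply continuousAt_const)))

/-- A smoothly embedded disk has arbitrarily thin bicollars: the ones given by a normal field, with
the sides avoiding a closed set that misses the boundary of the disk. -/
theorem exists_isThickDisk {e : ℂ → E3} (he : IsSmoothEmbeddingOn e stdDisk) {F : Set E3}
    (hF : IsClosed F) (hd : Disjoint (e '' stdCircle) F) :
    ∃ Φ, IsThickDisk Φ ∧ (∀ z, Φ (z, 0) = e z) ∧ Disjoint (Φ '' stdSide) F := by
  obtain ⟨⟨U, hU, hDU, hs⟩, hinj, him⟩ := he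
  have hsm : ∀ z ∈ stdDisk, ContDiffAt ℝ ∞ (normalCollar e) (z, 0) := fun z hz =>
    (contDiffOn_normalCollar hU hs).contDiffAt ((hU.preimage continuous_fst).mem_nhds (hDU hz))
  have hpos := fun z hz => det3_fderiv_normalCollar_pos ((hsm z hz).differentiableAt (by simp))
    (him z hz)
  have hemb : IsSmoothEmbeddingOn (normalCollar e) (stdDisk ×ˢ {0}) := by
    refine ⟨⟨_, hU.preimage continuous_fst, fun p hp => hDU hp.1, contDiffOn_normalCollar hU hs⟩,
      ?_, ?_⟩
    · rintro ⟨z, t⟩ ⟨hz, ht⟩ ⟨z', t'⟩ ⟨hz', ht'⟩ h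
      obtain rfl : t = 0 := ht
      obtain rfl : t' = 0 := ht'
      rw [normalCollar_zero, normalCollar_zero] at h
      exact Prod.ext (hinj hz hz' h) rfl
    · rintro ⟨z, t⟩ ⟨hz, ht⟩
      obtain rfl : t = 0 := ht
      exact injective_of_det3_ne_zero _ (hpos z hz).ne'
  generalize hΦ : normalCollar e = Φ at *
  have hz0 : ∀ z, Φ (z, 0) = e z := fun z => by rw [← hΦ, normalCollar_zero]
  obtain ⟨V, Ψ, hV, hc⟩ := exists_isChart (isCompact_stdDisk.prod isCompact_singleton) hemb
  obtain ⟨ε₁, h1, -, h1'⟩ := exists_tube isCompact_stdDisk (P := V ∩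
      {y | 0 < det3 (fderiv ℝ Φ y (1, 0)) (fderiv ℝ Φ y (Complex.I, 0)) (fderiv ℝ Φ y (0, 1))})
    fun z hz => Filter.inter_mem (hc.isOpen.mem_nhds (hV ⟨hz, rfl⟩))
      (continuousAt_const.eventually_lt (continuousAt_det3_fderiv (hsm z hz)) (hpos z hz))
  obtain ⟨ε₂, h2, -, h2'⟩ := exists_tube isCompact_stdCircle (P := Φ ⁻¹' Fᶜ) fun z hz => by
    refine (hsm z (Metric.sphere_subset_closedBall hz)).continuousAt.preimage_mem_nhds
      (hF.isOpen_compl.mem_nhds ?_)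
    rw [hz0]
    exact Set.disjoint_left.1 hd ⟨z, hz, rfl⟩
  obtain ⟨ε, hεpos, hε1, hε2⟩ : ∃ ε > 0, ε ≤ ε₁ ∧ ε ≤ ε₂ :=
    ⟨min ε₁ ε₂, lt_min h1 h2, min_le_left _ _, min_le_right _ _⟩
  have hsub : stdDisk ×ˢ Set.Icc (-ε) ε ⊆ stdDisk ×ˢ Set.Icc (-ε₁) ε₁ :=
    Set.prod_mono_right (Set.Icc_subset_Icc (neg_le_neg hε1) hε1)
  refine ⟨thin ε Φ, isThickDisk_thin hεpos (hc.isSmoothEmbeddingOn fun y hy => (h1' (hsub hy)).1)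
    fun y hy => (h1' (hsub hy)).2, fun z => by simp [thin, hz0], ?_⟩
  rw [Set.disjoint_left]
  rintro _ ⟨⟨z, t⟩, ht, rfl⟩
  rw [mem_stdSide] at ht
  have hz : z ∈ stdCircle := by simpa [stdCircle] using ht.1
  refine h2' (a := (z, ε * t)) ⟨hz, abs_le.1 ?_⟩
  rw [abs_mul, abs_of_pos hεpos]
  nlinarith

theorem IsThickDisk.thin {Φ : ℂ × ℝ → E3} (hΦ : IsThickDisk Φ) {ε : ℝ} (hε : 0 < ε) (h1 : ε ≤ 1) :
    IsThickDisk (thin ε Φ) := by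
  have hsub : stdDisk ×ˢ Set.Icc (-ε) ε ⊆ stdCylinder := fun y hy =>
    ⟨hy.1, by linarith [hy.2.1], by linarith [hy.2.2]⟩
  refine isThickDisk_thin hε ⟨?_, hΦ.1.2.1.mono hsub, fun p hp => hΦ.1.2.2 p (hsub hp)⟩
    fun p hp => hΦ.2 p (hsub hp)
  obtain ⟨⟨U, hU, hSU, hs⟩, -⟩ := hΦ.1
  exact ⟨U, hU, hsub.trans hSU, hs⟩

/-! ### Thinning the collar of a twist -/

section thin

variable {Φ : ℂ × ℝ → E3} {ε : ℝ} {n : ℤ}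

theorem thin_image_subset (hε : 0 < ε) {S : Set ℂ} :
    thin ε Φ '' (S ×ˢ Set.Icc (-1) 1) ⊆ Φ '' (S ×ˢ Set.Icc (-ε) ε) := by
  rintro _ ⟨⟨z, t⟩, ⟨hz, ht⟩, rfl⟩
  refine ⟨(z, ε * t), ⟨hz, abs_le.1 ?_⟩, rfl⟩
  have ht' : |t| ≤ 1 := abs_le.2 ht
  rw [abs_mul, abs_of_pos hε]
  nlinarith

theorem Icc_thin_subset (h1 : ε ≤ 1) : Set.Icc (-ε) ε ⊆ Set.Icc (-1) 1 :=
  Set.Icc_subset_Icc (neg_le_neg h1) h1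

theorem twistMap_thin (hΦ : Set.InjOn Φ stdCylinder) (hε : 0 < ε) (h1 : ε ≤ 1)
    {z : ℂ} {t : ℝ} (hy : (z, t) ∈ stdCylinder) : twistMap (thin ε Φ) n (Φ (z, t)) =
      Φ (rot (2 * Real.pi * n * Real.smoothTransition ((t / ε + 1) / 2)) z, t) := by
  have hinj : Set.InjOn (thin ε Φ) stdCylinder := by
    rintro ⟨z, t⟩ h ⟨z', t'⟩ h' e
    have hm : ∀ {w : ℂ} {r : ℝ}, (w, r) ∈ stdCylinder → (w, ε * r) ∈ stdCylinder := fun {w r} h => by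
      rw [mem_stdCylinder] at h ⊢
      refine ⟨h.1, ?_⟩
      rw [abs_mul, abs_of_pos hε]
      nlinarith [h.2, abs_nonneg r]
    have := Prod.mk.inj (hΦ (hm h) (hm h') e)
    exact Prod.ext this.1 (mul_left_cancel₀ hε.ne' this.2)
  have hz := mem_stdCylinder.1 hy
  by_cases ht : |t| ≤ ε
  · have hm : (z, t / ε) ∈ stdCylinder := mem_stdCylinder.2 ⟨hz.1, by
      rw [abs_div, abs_of_pos hε]; exact (div_le_one hε).2 ht⟩
    have e : Φ (z, t) = thin ε Φ (z, t / ε) := by simp only [thin, mul_div_cancel₀ t hε.ne']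
    rw [e, twistMap, push_apply hinj hm, fullTwist_eq]
    simp only [thin, mul_div_cancel₀ t hε.ne']
  · have hnot : Φ (z, t) ∉ thin ε Φ '' stdCylinder := fun h => by
      obtain ⟨⟨z', t'⟩, ⟨hz', ht'⟩, e⟩ := thin_image_subset hε h
      have := hΦ ⟨hz', Icc_thin_subset h1 ht'⟩ hy e
      exact ht ((Prod.mk.inj this).2 ▸ abs_le.2 ht')
    rw [twistMap, push_of_notMem hnot]
    have : 1 ≤ |t / ε| := by
      rw [abs_div, abs_of_pos hε]; exact (one_le_div hε).2 (not_le.1 ht).le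
    have := fullTwist_of_one_le (n := n) (z := z) this
    rw [fullTwist_eq] at this
    rw [(Prod.mk.inj this).1]

/-- The angle, at height `t`, by which `n` twists in a collar of height `ε` differ from `n` twists
in the standard collar. -/
def angleDiff (n : ℤ) (ε t : ℝ) : ℝ :=
  2 * Real.pi * n * Real.smoothTransition ((t / ε + 1) / 2) -
    2 * Real.pi * n * Real.smoothTransition ((t + 1) / 2)

theorem angleDiff_of_one_le (hε : 0 < ε) (h1 : ε ≤ 1) {t : ℝ} (ht : 1 ≤ |t|) :
    angleDiff n ε t = 0 := by
  have key : 1 ≤ |t| / ε := (one_le_div hε).2 (h1.trans ht)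
  rcases le_abs'.1 ht with h | h
  · rw [abs_of_neg (by linarith), neg_div] at key
    rw [angleDiff, Real.smoothTransition.zero_of_nonpos (by linarith),
      Real.smoothTransition.zero_of_nonpos (by linarith), sub_self]
  · rw [abs_of_pos (by linarith)] at key
    rw [angleDiff, Real.smoothTransition.one_of_one_le (by linarith),
      Real.smoothTransition.one_of_one_le (by linarith), sub_self]

theorem contDiff_angleDiff : ContDiff ℝ ∞ (angleDiff n ε) := by
  have h : ∀ f : ℝ → ℝ, ContDiff ℝ ∞ f → ContDiff ℝ ∞ fun t =>
      2 * Real.pi * n * Real.smoothTransition (f t) := fun f hf =>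
    contDiff_const.mul (Real.smoothTransition.contDiff.comp hf)
  exact (h _ (by fun_prop)).sub (h _ (by fun_prop))

/-- The isotopy of the cylinder that moves the twist into the part `|t| ≤ ε`; it is damped to the
identity near the lateral side, where `‖z‖ ^ 2 ≥ b`. -/
def thinning (n : ℤ) (ε a b : ℝ) (u : ℝ) (y : ℂ × ℝ) : ℂ × ℝ :=
  (rot (u * angleDiff n ε y.2 * Real.smoothTransition ((b - ‖y.1‖ ^ 2) / (b - a))) y.1, y.2)

variable {a b : ℝ}

theorem contDiff_thinning :
    ContDiff ℝ ∞ fun q : ℝ × (ℂ × ℝ) => thinning n ε a b q.1 q.2 := by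
  have h1 : ContDiff ℝ ∞ fun q : ℝ × (ℂ × ℝ) => angleDiff n ε q.2.2 :=
    contDiff_angleDiff.comp (contDiff_snd.comp contDiff_snd)
  have h2 : ContDiff ℝ ∞ fun q : ℝ × (ℂ × ℝ) => (b - ‖q.2.1‖ ^ 2) / (b - a) :=
    (contDiff_const.sub ((contDiff_fst.comp contDiff_snd).norm_sq ℝ)).div_const _
  have h3 : ContDiff ℝ ∞ fun q : ℝ × (ℂ × ℝ) =>
      Real.smoothTransition ((b - ‖q.2.1‖ ^ 2) / (b - a)) := Real.smoothTransition.contDiff.comp h2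
  have h4 : ContDiff ℝ ∞ fun q : ℝ × (ℂ × ℝ) => (q.1 * angleDiff n ε q.2.2 *
    Real.smoothTransition ((b - ‖q.2.1‖ ^ 2) / (b - a)), q.2.1) :=
    ((contDiff_fst.mul h1).mul h3).prodMk (contDiff_fst.comp contDiff_snd)
  exact (contDiff_rot.comp h4).prodMk (contDiff_snd.comp contDiff_snd)

theorem thinning_mapsTo (u : ℝ) : Set.MapsTo (thinning n ε a b u) stdCylinder stdCylinder := by
  rintro ⟨z, t⟩ h
  rw [thinning, mem_stdCylinder, norm_rot]
  exact mem_stdCylinder.1 h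

theorem thinning_neg_thinning (u : ℝ) (y : ℂ × ℝ) :
    thinning n ε a b (-u) (thinning n ε a b u y) = y := by
  refine Prod.ext ?_ rfl
  simp only [thinning, norm_rot]
  rw [neg_mul, neg_mul, rot_neg_rot]

theorem thinning_zero (y : ℂ × ℝ) : thinning n ε a b 0 y = y := by
  refine Prod.ext ?_ rfl
  simp only [thinning, zero_mul, rot_zero]

theorem contDiff_push_thinning (hΦ : IsSmoothEmbeddingOn Φ stdCylinder) (hε : 0 < ε) (h1 : ε ≤ 1)
    (hab : a < b) (hb : b < 1) :
    ContDiff ℝ ∞ fun q : ℝ × E3 => push Φ (thinning n ε a b q.1) q.2 := by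
  rw [contDiff_iff_contDiffAt]
  rintro ⟨u, x⟩
  refine contDiffAt_push hΦ fun y hy _ =>
    ⟨contDiff_thinning.contDiffAt, thinning_mapsTo _ hy, ?_⟩
  have hc : ContinuousAt (fun q : ℝ × (ℂ × ℝ) => ‖q.2.1‖) (u, y) := by fun_prop
  rcases lt_or_eq_of_le (mem_closedBall_zero_iff.1 hy.1) with h | h
  · filter_upwards [hc.eventually_lt continuousAt_const h]
    rintro ⟨u', z', t'⟩ hq hq'
    rw [mem_stdCylinder] at hq'
    have : 1 ≤ |t'| := by
      by_contra! hh
      exact hq' ⟨le_of_lt hq, hh.le⟩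
    simp only [thinning, angleDiff_of_one_le hε h1 this, mul_zero, zero_mul, rot_zero]
  · filter_upwards [(continuousAt_const (y := b)).eventually_lt (hc.pow 2) (by simpa [h] using hb)]
    rintro ⟨u', z', t'⟩ hq _
    have : (b - ‖z'‖ ^ 2) / (b - a) ≤ 0 :=
      div_nonpos_of_nonpos_of_nonneg (by simpa using le_of_lt hq) (by linarith)
    simp only [thinning, Real.smoothTransition.zero_of_nonpos this, mul_zero, rot_zero]

end thin

namespace SmoothLink

variable {m : ℕ}

/-- The result of twisting does not depend, up to ambient isotopy, on the height of the collar. -/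
theorem isotopic_of_twistAlong_thin {K J J' : SmoothLink 1} {Φ : ℂ × ℝ → E3} (hΦ : IsThickDisk Φ)
    {ε : ℝ} (hε : 0 < ε) (h1 : ε ≤ 1) {n : ℤ} (hJ : TwistAlong Φ n K J)
    (hJ' : TwistAlong (thin ε Φ) n K J') : J.Isotopic J' := by
  have hinj := hΦ.1.2.1
  rw [twistAlong_iff hinj] at hJ
  rw [twistAlong_iff (hΦ.thin hε h1).1.2.1] at hJ'
  -- a radius `r < 1` bounding the part of the knot in the cylinder
  obtain ⟨a, ha1, ha⟩ : ∃ a < 1, ∀ y ∈ stdCylinder, Φ y ∈ Set.range (K.toFun 0) → ‖y.1‖ ^ 2 ≤ a := by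
    have hcl : IsCompact (stdCylinder ∩ Φ ⁻¹' Set.range (K.toFun 0)) :=
      isCompact_stdCylinder.of_isClosed_subset (hΦ.1.continuousOn.preimage_isClosed_of_isClosed
        isCompact_stdCylinder.isClosed (K.isCompact_range 0).isClosed) Set.inter_subset_left
    obtain ⟨r, hr, hr'⟩ := hcl.exists_forall_le' (f := fun y => 1 - ‖y.1‖ ^ 2) (a := 0)
      (by fun_prop) (by
        rintro ⟨z, t⟩ ⟨hy, s, hs⟩
        have hz := mem_stdCylinder.1 hy
        have hlt : ‖z‖ < 1 := lt_of_le_of_ne hz.1 fun e =>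
          hJ.1 0 s ⟨(z, t), mem_stdSide.2 ⟨e, hz.2⟩, hs.symm⟩
        change 0 < 1 - ‖z‖ ^ 2
        nlinarith [norm_nonneg z])
    exact ⟨1 - r, by linarith, fun y hy hy' => by linarith [hr' y ⟨hy, hy'⟩]⟩
  obtain ⟨b, hab, hb⟩ := exists_between ha1
  have hsm := contDiff_push_thinning (n := n) hΦ.1 hε h1 hab hb
  refine ⟨fun q => push Φ (thinning n ε a b q.1) q.2, fun q => push Φ (thinning n ε a b (-q.1)) q.2,
    hsm, hsm.comp (contDiff_fst.neg.prodMk contDiff_snd), fun u x => ?_, fun u x => ?_, fun x => ?_,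
    fun i s => ?_⟩
  · exact push_leftInverse hinj (thinning_mapsTo _) fun y _ => thinning_neg_thinning u y
  · refine push_leftInverse hinj (thinning_mapsTo _) fun y _ => ?_
    have := thinning_neg_thinning (n := n) (ε := ε) (a := a) (b := b) (-u) y
    rwa [neg_neg] at this
  · exact push_eq_self hinj fun y _ _ => thinning_zero y
  · rw [hJ.2, hJ'.2, twistMap]
    change push Φ (thinning n ε a b 1) (push Φ (fullTwist n) (K.toFun i s)) = _
    rw [push_push hinj (fullTwist_mapsTo n)]
    by_cases hx : K.toFun i s ∈ Φ '' stdCylinder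
    · obtain ⟨⟨z, t⟩, hy, e⟩ := hx
      obtain rfl : i = 0 := Subsingleton.elim _ _
      have hz := ha _ hy ⟨s, e.symm⟩
      rw [← e, push_apply hinj hy, twistMap_thin hinj hε h1 hy, Function.comp_apply, fullTwist_eq,
        thinning]
      have : 1 ≤ (b - ‖z‖ ^ 2) / (b - a) := by
        rw [one_le_div (by linarith)]
        linarith
      simp only [norm_rot, Real.smoothTransition.one_of_one_le this, rot_rot, angleDiff]
      congr 3
      ring
    · have hx' : K.toFun i s ∉ thin ε Φ '' stdCylinder := fun h => by
        obtain ⟨y, hy, e⟩ := thin_image_subset hε h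
        exact hx ⟨y, ⟨hy.1, Icc_thin_subset h1 hy.2⟩, e⟩
      rw [push_of_notMem hx, twistMap, push_of_notMem hx']

/-- A knot can be twisted about any unknot disjoint from it. -/
theorem exists_isTwistAbout {K c : SmoothLink 1} (hc : c.IsTrivial)
    (hd : Disjoint (Set.range (c.toFun 0)) (Set.range (K.toFun 0))) (n : ℤ) :
    ∃ J, IsTwistAbout K c n J := by
  obtain ⟨e, he, hb, -⟩ := hc
  obtain ⟨Φ, hΦ, h0, hside⟩ := exists_isThickDisk (he 0) (K.isCompact_range 0).isClosed
    (by rwa [hb])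
  refine ⟨K.twist Φ hΦ n fun i s h => ?_, Φ, hΦ, ?_, K.twistAlong_twist hΦ n _⟩
  · obtain rfl : i = 0 := Subsingleton.elim _ _
    exact Set.disjoint_left.1 hside h ⟨s, rfl⟩
  · rw [← hb]
    ext x
    simp [h0]

/-- A thick disk whose boundary misses a compact set has a thin version whose lateral side misses
this set. -/
theorem exists_thin_disjoint {Φ : ℂ × ℝ → E3} (hΦ : IsThickDisk Φ) {F : Set E3} (hF : IsClosed F)
    (hd : Disjoint (Φ '' (stdCircle ×ˢ {0})) F) :
    ∃ ε > 0, ε ≤ 1 ∧ Disjoint (thin ε Φ '' stdSide) F := by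
  obtain ⟨ε, hε, h1, h⟩ := exists_tube isCompact_stdCircle (P := Φ ⁻¹' Fᶜ) fun z hz => by
    have hy : (z, (0 : ℝ)) ∈ stdCylinder :=
      ⟨Metric.sphere_subset_closedBall hz, by norm_num⟩
    exact (hΦ.1.contDiffAt hy).continuousAt.preimage_mem_nhds (hF.isOpen_compl.mem_nhds
      (Set.disjoint_left.1 hd ⟨(z, 0), ⟨hz, rfl⟩, rfl⟩))
  refine ⟨ε, hε, h1, Set.disjoint_left.2 fun x hx => ?_⟩
  obtain ⟨y, hy, rfl⟩ := thin_image_subset hε hx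
  exact h hy

/-- If a crossing change of the component `i` makes `L₁` trivial, then each knot obtained from this
component by twisting about another component `c` can be unknotted by one crossing change: the
twist along a thin collar of the disk bounded by `c` carries along the crossing disk, which
misses `c`, and the disk that the unknotted component bounds in the complement of `c`. -/
theorem exists_unknotting_of_twist {L₁ L₂ : SmoothLink m} {i c : Fin m} (hci : c ≠ i)
    (hL : CrossingChange i i L₁ L₂) (ht : L₂.IsTrivial) {Φ : ℂ × ℝ → E3} (hΦ : IsThickDisk Φ)
    (hb : Φ '' (stdCircle ×ˢ {0}) = Set.range (L₁.toFun c)) {n : ℤ} {J : SmoothLink 1}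
    (hJ : TwistAlong Φ n (L₁.component i) J) :
    ∃ J' J'' : SmoothLink 1, J.Isotopic J' ∧ CrossingChange 0 0 J' J'' ∧ J''.IsTrivial := by
  obtain ⟨Ψ, hcr, htw⟩ := hL
  have hcΨ := L₁.disjoint_crossingDisk hcr hci
  have hΨ := hcr.1
  obtain ⟨k, hk, htw⟩ : ∃ k : ℤ, (∀ A A' : SmoothLink 1, ∀ Φ', TwistAlong Φ' k A A' →
      (TwistAlong Φ' 1 A A' ∨ TwistAlong Φ' (-1) A A')) ∧ TwistAlong Ψ k L₁ L₂ := by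
    rcases htw with h | h
    · exact ⟨1, fun _ _ _ => Or.inl, h⟩
    · exact ⟨-1, fun _ _ _ => Or.inr, h⟩
  rw [twistAlong_iff hΨ.1.2.1] at htw
  obtain ⟨e, he, heb, hed⟩ := ht
  -- the component `c` is not changed by the crossing change
  have hc12 : Set.range (L₂.toFun c) = Set.range (L₁.toFun c) := congrArg Set.range <| funext fun s => by
    rw [htw.2, twistMap, push_of_notMem (Set.disjoint_left.1 hcΨ ⟨s, rfl⟩)]
  have hce : Disjoint (Set.range (L₁.toFun c)) (e i '' stdDisk) := by
    rw [← hc12, ← heb]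
    exact (hed c i hci).mono_left (Set.image_mono Metric.sphere_subset_closedBall)
  have hclΨ : IsClosed (Ψ '' stdCylinder) :=
    (isCompact_stdCylinder.image_of_continuousOn hΨ.1.continuousOn).isClosed
  have hcle : IsClosed (e i '' stdDisk) :=
    (isCompact_stdDisk.image_of_continuousOn (he i).continuousOn).isClosed
  obtain ⟨ε, hε, hε1, hdis⟩ := exists_thin_disjoint hΦ (hclΨ.union hcle)
    (by rw [hb]; exact Set.disjoint_union_right.2 ⟨hcΨ, hce⟩)
  have hΦε := hΦ.thin hε hε1
  have hT := isOrientedEmbedding_twistMap hΦε n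
  set T := twistMap (thin ε Φ) n with hTdef
  have hinjT : Function.Injective T := twistMap_injective hΦε.1.2.1
  have hΨO : Set.MapsTo Ψ stdCylinder (thin ε Φ '' stdSide)ᶜ := fun y hy h =>
    Set.disjoint_left.1 hdis h (Or.inl ⟨y, hy, rfl⟩)
  have heO : Set.MapsTo (e i) stdDisk (thin ε Φ '' stdSide)ᶜ := fun y hy h =>
    Set.disjoint_left.1 hdis h (Or.inr ⟨y, hy, rfl⟩)
  have hK1 : ∀ s, L₁.toFun i s ∉ thin ε Φ '' stdSide := fun s h => by
    obtain ⟨y, hy, e⟩ := thin_image_subset hε h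
    exact ((twistAlong_iff hΦ.1.2.1).1 hJ).1 0 s ⟨y, ⟨hy.1, Icc_thin_subset hε1 hy.2⟩, e⟩
  have hK2 : ∀ s, L₂.toFun i s ∉ thin ε Φ '' stdSide := fun s => by
    have : L₂.toFun i s ∈ e i '' stdCircle := by rw [heb]; exact ⟨s, rfl⟩
    obtain ⟨y, hy, e⟩ := this
    rw [← e]
    exact heO (Metric.sphere_subset_closedBall hy)
  have hthick : IsThickDisk (T ∘ Ψ) := hT.comp_isThickDisk hΨ hΨO
  -- twisting commutes with the crossing change if its disk is replaced by the image under `T`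
  refine ⟨(L₁.component i).twist _ hΦε n fun _ => hK1, (L₂.component i).twist _ hΦε n fun _ => hK2,
    isotopic_of_twistAlong_thin hΦ hε hε1 hJ (twistAlong_twist _ _ _ _),
    ⟨T ∘ Ψ, ⟨hthick, ?_⟩, hk _ _ _ ((twistAlong_iff hthick.1.2.1).2 ⟨fun _ s => ?_, fun _ s => ?_⟩)⟩, ?_⟩
  · obtain ⟨-, p, q, hp, hq, hpq, hcyl, a, b, r, r', ha, ha', hb, hb', hr⟩ := hcr
    have hp0 : (p, (0 : ℝ)) ∈ stdCylinder := mem_stdCylinder.2 ⟨hp.le, by norm_num⟩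
    have hq0 : (q, (0 : ℝ)) ∈ stdCylinder := mem_stdCylinder.2 ⟨hq.le, by norm_num⟩
    have hder : ∀ (z : ℂ) (s ρ : ℝ), (z, (0 : ℝ)) ∈ stdCylinder → L₁.toFun i s = Ψ (z, 0) →
        deriv (L₁.toFun i) s = ρ • fderiv ℝ Ψ (z, 0) (0, 1) →
        deriv (fun s => T (L₁.toFun i s)) s = ρ • fderiv ℝ (T ∘ Ψ) (z, 0) (0, 1) := by
      intro z s ρ hz hs hd
      have hTd : DifferentiableAt ℝ T (Ψ (z, 0)) := (hT.smooth _ (hΨO hz)).differentiableAt (by simp)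
      have h1 : HasDerivAt (fun s => T (L₁.toFun i s)) (fderiv ℝ T (L₁.toFun i s)
          (deriv (L₁.toFun i) s)) s :=
        HasFDerivAt.comp_hasDerivAt (l := T) s (hs ▸ hTd).hasFDerivAt
          ((L₁.smooth i).differentiable (by simp) s).hasDerivAt
      rw [h1.deriv, hd, hs, map_smul, fderiv_comp _ hTd
        ((hΨ.1.contDiffAt hz).differentiableAt (by simp))]
      rfl
    refine ⟨p, q, hp, hq, hpq, ?_, a, b, r, r', ?_, hder p a r hp0 ha ha', ?_, hder q b r' hq0 hb hb',
      fun _ => hr rfl⟩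
    · have hrange : (⋃ k : Fin 1, Set.range (((L₁.component i).twist _ hΦε n
          fun _ => hK1).toFun k)) = T '' Set.range (L₁.toFun i) := by
        rw [← Set.range_comp]
        exact Set.Subset.antisymm (Set.iUnion_subset fun _ => subset_rfl)
          (Set.subset_iUnion (fun k : Fin 1 => Set.range (((L₁.component i).twist _ hΦε n
            fun _ => hK1).toFun k)) 0)
      have hcyl' : Set.range (L₁.toFun i) ∩ Ψ '' stdCylinder =
          Ψ '' (({p, q} : Set ℂ) ×ˢ Set.Icc (-1) 1) := by
        rw [← hcyl]
        refine Set.Subset.antisymm (Set.inter_subset_inter_left _ fun x hx =>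
          Set.mem_iUnion.2 ⟨i, hx⟩) ?_
        rintro x ⟨hx, hx'⟩
        refine ⟨?_, hx'⟩
        obtain ⟨k, hk⟩ := Set.mem_iUnion.1 hx
        by_cases hki : k = i
        · exact hki ▸ hk
        · exact (Set.disjoint_left.1 (L₁.disjoint_crossingDisk
            ⟨hΨ, p, q, hp, hq, hpq, hcyl, a, b, r, r', ha, ha', hb, hb', hr⟩ hki) hk hx').elim
      rw [hrange, Set.image_comp, Set.image_comp, ← Set.image_inter hinjT, hcyl']
    · exact congrArg T ha
    · exact congrArg T hb
  · rintro ⟨y, hy, h⟩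
    exact htw.1 i s ⟨y, hy, hinjT h⟩
  · change T (L₂.toFun i s) = twistMap (T ∘ Ψ) k (T (L₁.toFun i s))
    rw [htw.2]
    by_cases hx : L₁.toFun i s ∈ Ψ '' stdCylinder
    · obtain ⟨y, hy, h⟩ := hx
      have e2 : twistMap (T ∘ Ψ) k (T (Ψ y)) = (T ∘ Ψ) (fullTwist k y) :=
        push_apply hthick.1.2.1 hy
      rw [← h, e2, twistMap, push_apply hΨ.1.2.1 hy]
      rfl
    · have hx' : T (L₁.toFun i s) ∉ T ∘ Ψ '' stdCylinder := by
        rintro ⟨y, hy, h⟩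
        exact hx ⟨y, hy, hinjT h⟩
      rw [twistMap, push_of_notMem hx, twistMap, push_of_notMem hx']
  · refine ⟨fun _ => T ∘ e i, fun _ => hT.comp_isSmoothEmbeddingOn (he i) heO, fun _ => ?_,
      fun j k hjk => (hjk (Subsingleton.elim _ _)).elim⟩
    rw [Set.image_comp, heb, ← Set.range_comp]
    rfl

/-- Twisting along a thick disk is compatible with ambient isotopies. -/
theorem twistAlong_comp {f : E3 → E3} (hf : IsOrientedEmbedding f Set.univ) {K K' J J' : SmoothLink m}
    {Φ : ℂ × ℝ → E3} {n : ℤ} (hK : ∀ i s, f (K.toFun i s) = K'.toFun i s)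
    (hJ : ∀ i s, f (J.toFun i s) = J'.toFun i s) (h : TwistAlong Φ n K J) :
    TwistAlong (f ∘ Φ) n K' J' := by
  have hinj : Function.Injective f := fun x y e => hf.injOn (Set.mem_univ x) (Set.mem_univ y) e
  refine ⟨fun i s => ?_, fun i s => ⟨fun p hp e => ?_, fun hs => ?_⟩⟩
  · rintro ⟨y, hy, e⟩
    rw [← hK] at e
    exact h.1 i s ⟨y, hy, hinj e⟩
  · rw [← hK] at e
    rw [← hJ, (h.2 i s).1 p hp (hinj e)]
    rfl
  · rw [← hJ, ← hK, (h.2 i s).2 fun ⟨y, hy, e⟩ => hs ⟨y, hy, by rw [← hK, ← e]; rfl⟩]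

theorem unlinkingNumber_le_one {J J' J'' : SmoothLink m} {i j : Fin m} (h : J.Isotopic J')
    (h' : CrossingChange i j J' J'') (ht : J''.IsTrivial) : J.unlinkingNumber ≤ 1 := by
  have : UnlinkableIn 1 J := ⟨J', J'', h, ⟨i, j, h'⟩, ht⟩
  exact (iInf₂_le (f := fun (n : ℕ) (_ : UnlinkableIn n J) => (n : ℕ∞)) 1 this).trans (by simp)

/-- If a crossing change within the component `i` trivializes `L`, then every other component `c` is
an unknot, and twisting the component `i` about `c` gives knots of unknotting number at most one. -/
theorem unlinkingNumber_twist_le_one {L : SmoothLink m} {i c : Fin m} (hci : c ≠ i)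
    (hL : L.IsUnlinkingCrossing i i) : (L.component c).IsTrivial ∧ ∀ (n : ℤ) (J : SmoothLink 1),
      IsTwistAbout (L.component i) (L.component c) n J → J.unlinkingNumber ≤ 1 := by
  obtain ⟨L₁, L₂, hiso, hcc, ht⟩ := hL
  refine ⟨?_, fun n J hJ => ?_⟩
  · refine IsTrivial.isotopic ?_ (hiso.component c).symm
    obtain ⟨Ψ, hcr, htw⟩ := hcc
    have hcΨ := L₁.disjoint_crossingDisk hcr hci
    have e : L₂.component c = L₁.component c := by
      have : ∀ s, L₂.toFun c s = L₁.toFun c s := fun s => by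
        have hs := Set.disjoint_left.1 hcΨ ⟨s, rfl⟩
        rcases htw with h | h
        · exact (h.2 c s).2 hs
        · exact (h.2 c s).2 hs
      simp only [component, funext this]
    exact e ▸ ht.component c
  · obtain ⟨Φ, hΦ, hb, htw⟩ := hJ
    obtain ⟨H, G, hH, hG, hGH, hHG, h0, h1⟩ := hiso
    have hf := isOrientedEmbedding_of_isotopy hH hG hGH h0
    let J₁ : SmoothLink 1 := J.map (fun x => H (1, x)) (fun x => G (1, x))
      (fun _ _ => (hH.comp (contDiff_prodMk_right 1)).contDiffAt)
      (fun _ _ => (hG.comp (contDiff_prodMk_right 1)).contDiffAt.differentiableAt (by simp))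
      (fun _ _ => hGH _ _)
    have hJ₁ : J.Isotopic J₁ := ⟨H, G, hH, hG, hGH, hHG, h0, fun _ _ => rfl⟩
    obtain ⟨J', J'', i1, i2, i3⟩ := exists_unknotting_of_twist hci hcc ht
      (hf.comp_isThickDisk hΦ (Set.mapsTo_univ _ _)) (by
        rw [Set.image_comp, hb, ← Set.range_comp]
        exact congrArg Set.range (funext fun s => h1 c s))
      (twistAlong_comp (K' := L₁.component i) (J' := J₁) hf (fun _ s => h1 i s)
        (fun _ _ => rfl) htw)
    exact unlinkingNumber_le_one (hJ₁.trans i1) i2 i3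

end SmoothLink

/-! ### The Gauss integral and its homotopy formula -/

/-- The integrand of Gauss's integral: the solid angle form at the point `z`. -/
def gaussForm (v w z : E3) : ℝ := det3 v w z / ‖z‖ ^ 3

/-- Gauss's integral of two curves with parameters in `[0, 1]`, without the factor `1 / (4π)`. -/
def gauss (x y : ℝ → E3) : ℝ :=
  ∫ s in (0 : ℝ)..1, ∫ t in (0 : ℝ)..1, gaussForm (deriv x s) (deriv y t) (x s - y t)

theorem SmoothLink.linkingNumber_eq {m : ℕ} (L : SmoothLink m) (i j : Fin m) :
    L.linkingNumber i j = 1 / (4 * Real.pi) * gauss (L.toFun i) (L.toFun j) := rfl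

/-- The derivative of `gaussForm` along a curve. -/
def gaussFormDeriv (v w z v' w' z' : E3) : ℝ :=
  (det3 v' w z + det3 v w' z + det3 v w z') / ‖z‖ ^ 3 - 3 * inner ℝ z z' * det3 v w z / ‖z‖ ^ 5

theorem HasDerivAt.gaussForm {v w z : ℝ → E3} {v' w' z' : E3} {u : ℝ} (hv : HasDerivAt v v' u)
    (hw : HasDerivAt w w' u) (hz : HasDerivAt z z' u) (h0 : z u ≠ 0) :
    HasDerivAt (fun u => gaussForm (v u) (w u) (z u))
      (gaussFormDeriv (v u) (w u) (z u) v' w' z') u := by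
  have hc : ∀ {f : ℝ → E3} {f' : E3} (k : Fin 3), HasDerivAt f f' u →
      HasDerivAt (fun u => f u k) (f' k) u := fun {f f'} k hf =>
    (EuclideanSpace.proj (𝕜 := ℝ) k : E3 →L[ℝ] ℝ).hasFDerivAt.comp_hasDerivAt u hf
  have hdet : HasDerivAt (fun u => det3 (v u) (w u) (z u))
      (det3 v' (w u) (z u) + det3 (v u) w' (z u) + det3 (v u) (w u) z') u := by
    simp only [det3_eq]
    have e := (((hc 0 hv).mul (((hc 1 hw).mul (hc 2 hz)).sub ((hc 2 hw).mul (hc 1 hz)))).sub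
      ((hc 1 hv).mul (((hc 0 hw).mul (hc 2 hz)).sub ((hc 2 hw).mul (hc 0 hz))))).add
      ((hc 2 hv).mul (((hc 0 hw).mul (hc 1 hz)).sub ((hc 1 hw).mul (hc 0 hz))))
    refine e.congr_deriv ?_
    simp only [Pi.mul_apply, Pi.sub_apply]
    ring
  have hn0 : ‖z u‖ ≠ 0 := norm_ne_zero_iff.2 h0
  have hnorm : HasDerivAt (fun u => ‖z u‖) (Inner.inner ℝ (z u) z' / ‖z u‖) u := by
    have e := hz.norm_sq.sqrt (pow_ne_zero 2 hn0)
    simp only [Real.sqrt_sq (norm_nonneg _)] at e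
    refine e.congr_deriv ?_
    field_simp
  have hfin := hdet.div (hnorm.pow 3) (pow_ne_zero 3 hn0)
  refine hfin.congr_deriv ?_
  simp only [gaussFormDeriv, Pi.pow_apply]
  field_simp
  push_cast
  ring

/-- The solid angle form is closed. -/
theorem gaussFormDeriv_closed (xs yt xu yu xus yut z : E3) (hz : z ≠ 0) :
    gaussFormDeriv xs yt z xus yut (xu - yu) =
      gaussFormDeriv (xu - yu) yt z xus 0 xs - gaussFormDeriv xs (xu - yu) z 0 (-yut) (-yt) := by
  have hn0 : ‖z‖ ≠ 0 := norm_ne_zero_iff.2 hz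
  have hsq : ‖z‖ ^ 2 = z 0 ^ 2 + z 1 ^ 2 + z 2 ^ 2 := by
    rw [EuclideanSpace.real_norm_sq_eq, Fin.sum_univ_three]
  generalize xu - yu = f
  have hdet : (det3 xus yt z + det3 xs yut z + det3 xs yt f) - (det3 xus yt z + det3 f 0 z +
      det3 f yt xs) + (det3 0 f z + det3 xs (-yut) z + det3 xs f (-yt)) = 3 * det3 xs yt f := by
    simp only [det3_eq, PiLp.zero_apply, PiLp.neg_apply]
    ring
  have hin : inner ℝ z f * det3 xs yt z - inner ℝ z xs * det3 f yt z +
      inner ℝ z (-yt) * det3 xs f z = ‖z‖ ^ 2 * det3 xs yt f := by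
    rw [hsq]
    simp only [det3_eq, PiLp.inner_apply, Fin.sum_univ_three, PiLp.neg_apply, RCLike.inner_apply,
      conj_trivial]
    ring
  have e5 : ∀ a b : ℝ, a / ‖z‖ ^ 3 - b / ‖z‖ ^ 5 = (a * ‖z‖ ^ 2 - b) / ‖z‖ ^ 5 := fun a b => by
    field_simp
  simp only [gaussFormDeriv, e5]
  rw [← sub_div]
  congr 1
  linear_combination ‖z‖ ^ 2 * hdet - 3 * hin

section swap

open MeasureTheory

theorem integral_swap_of_continuous {f : ℝ → ℝ → ℝ} (hf : Continuous fun q : ℝ × ℝ => f q.1 q.2)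
    (a b c d : ℝ) : ∫ s in a..b, ∫ t in c..d, f s t = ∫ t in c..d, ∫ s in a..b, f s t := by
  refine intervalIntegral_intervalIntegral_swap ?_
  exact (hf.continuousOn.integrableOn_compact (isCompact_uIcc.prod isCompact_uIcc)).mono_set
    (Set.prod_mono Set.uIoc_subset_uIcc Set.uIoc_subset_uIcc)

end swap

theorem continuous_gaussForm {X : Type*} [TopologicalSpace X] {v w z : X → E3} (hv : Continuous v)
    (hw : Continuous w) (hz : Continuous z) (h0 : ∀ q, z q ≠ 0) :
    Continuous fun q => gaussForm (v q) (w q) (z q) :=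
  (continuous_det3.comp (hv.prodMk (hw.prodMk hz))).div (hz.norm.pow 3)
    fun q => pow_ne_zero 3 (norm_ne_zero_iff.2 (h0 q))

theorem continuous_gaussFormDeriv {X : Type*} [TopologicalSpace X] {v w z v' w' z' : X → E3}
    (hv : Continuous v) (hw : Continuous w) (hz : Continuous z) (hv' : Continuous v')
    (hw' : Continuous w') (hz' : Continuous z') (h0 : ∀ q, z q ≠ 0) :
    Continuous fun q => gaussFormDeriv (v q) (w q) (z q) (v' q) (w' q) (z' q) := by
  have hd : ∀ {a b c : X → E3}, Continuous a → Continuous b → Continuous c →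
      Continuous fun q => det3 (a q) (b q) (c q) := fun {a b c} ha hb hc =>
    continuous_det3.comp (f := fun q => (a q, b q, c q)) (ha.prodMk (hb.prodMk hc))
  have h3 := fun q => pow_ne_zero 3 (norm_ne_zero_iff.2 (h0 q))
  have h5 := fun q => pow_ne_zero 5 (norm_ne_zero_iff.2 (h0 q))
  have e1 : Continuous fun q => (det3 (v' q) (w q) (z q) + det3 (v q) (w' q) (z q) +
      det3 (v q) (w q) (z' q)) / ‖z q‖ ^ 3 :=
    (((hd hv' hw hz).add (hd hv hw' hz)).add (hd hv hw hz')).div (hz.norm.pow 3) h3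
  have e2 : Continuous fun q => 3 * inner ℝ (z q) (z' q) * det3 (v q) (w q) (z q) / ‖z q‖ ^ 5 :=
    ((continuous_const.mul (hz.inner hz')).mul (hd hv hw hz)).div (hz.norm.pow 5) h5
  exact e1.sub e2

section partial_derivatives

variable {x : ℝ × ℝ → E3}

theorem hasDerivAt_left {F : Type*} [NormedAddCommGroup F] [NormedSpace ℝ F] {x : ℝ × ℝ → F}
    (hx : Differentiable ℝ x) (u s : ℝ) :
    HasDerivAt (fun u => x (u, s)) (fderiv ℝ x (u, s) (1, 0)) u :=
  HasFDerivAt.comp_hasDerivAt (l := x) u (hx _).hasFDerivAt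
    ((hasDerivAt_id u).prodMk (hasDerivAt_const u s))

theorem hasDerivAt_right {F : Type*} [NormedAddCommGroup F] [NormedSpace ℝ F] {x : ℝ × ℝ → F}
    (hx : Differentiable ℝ x) (u s : ℝ) :
    HasDerivAt (fun s => x (u, s)) (fderiv ℝ x (u, s) (0, 1)) s :=
  HasFDerivAt.comp_hasDerivAt (l := x) s (hx _).hasFDerivAt
    ((hasDerivAt_const s u).prodMk (hasDerivAt_id s))

theorem hasDerivAt_fderiv_left (hx : ContDiff ℝ ∞ x) (u s : ℝ) (v : ℝ × ℝ) :
    HasDerivAt (fun u => fderiv ℝ x (u, s) v) (fderiv ℝ (fderiv ℝ x) (u, s) (1, 0) v) u := by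
  have h := hasDerivAt_left (x := fderiv ℝ x)
    ((contDiff_infty_iff_fderiv.1 hx).2.differentiable (by simp)) u s
  exact h.clm_apply (hasDerivAt_const u v) |>.congr_deriv (by simp)

theorem hasDerivAt_fderiv_right (hx : ContDiff ℝ ∞ x) (u s : ℝ) (v : ℝ × ℝ) :
    HasDerivAt (fun s => fderiv ℝ x (u, s) v) (fderiv ℝ (fderiv ℝ x) (u, s) (0, 1) v) s := by
  have h := hasDerivAt_right (x := fderiv ℝ x)
    ((contDiff_infty_iff_fderiv.1 hx).2.differentiable (by simp)) u s
  exact h.clm_apply (hasDerivAt_const s v) |>.congr_deriv (by simp)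

theorem fderiv_fderiv_symm (hx : ContDiff ℝ ∞ x) (q v w : ℝ × ℝ) :
    fderiv ℝ (fderiv ℝ x) q v w = fderiv ℝ (fderiv ℝ x) q w v :=
  (hx.contDiffAt.isSymmSndFDerivAt (by
    rw [minSmoothness_of_isRCLikeNormedField]
    exact WithTop.coe_le_coe.2 (le_top (a := (2 : ℕ∞))))).eq v w

theorem fderiv_add_one (h : ∀ u s, x (u, s + 1) = x (u, s)) (u s : ℝ) :
    fderiv ℝ x (u, s + 1) = fderiv ℝ x (u, s) := by
  have : x = fun q => x (q + (0, 1)) := by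
    ext1 ⟨u, s⟩
    simp [h]
  conv_rhs => rw [this, fderiv_comp_add_right]
  simp

end partial_derivatives

/-- The Gauss integrand of two curves which depend on a parameter `u`. -/
def gaussA (x y : ℝ × ℝ → E3) (u s t : ℝ) : ℝ :=
  gaussForm (fderiv ℝ x (u, s) (0, 1)) (fderiv ℝ y (u, t) (0, 1)) (x (u, s) - y (u, t))

/-- The contraction of the solid angle form with the velocity of the homotopy and the tangent of the
first curve: the flux through an end of the second curve. -/
def gaussC (x y : ℝ × ℝ → E3) (u s t : ℝ) : ℝ :=
  gaussForm (fderiv ℝ x (u, s) (0, 1)) (fderiv ℝ x (u, s) (1, 0) - fderiv ℝ y (u, t) (1, 0))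
    (x (u, s) - y (u, t))

/-- **Homotopy formula** for Gauss's integral of a closed curve and an arc: by Stokes' theorem it
changes by the flux through the ends of the arc. -/
theorem gauss_homotopy {x y : ℝ × ℝ → E3} (hx : ContDiff ℝ ∞ x) (hy : ContDiff ℝ ∞ y)
    (hper : ∀ u s, x (u, s + 1) = x (u, s)) (hne : ∀ u s t, x (u, s) ≠ y (u, t)) (a b : ℝ) :
    (∫ s in (0 : ℝ)..1, ∫ t in a..b, gaussA x y 1 s t) -
      (∫ s in (0 : ℝ)..1, ∫ t in a..b, gaussA x y 0 s t) =
    -∫ s in (0 : ℝ)..1, ∫ u in (0 : ℝ)..1, (gaussC x y u s b - gaussC x y u s a) := by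
  have hz : ∀ u s t, x (u, s) - y (u, t) ≠ 0 := fun u s t => sub_ne_zero.2 (hne u s t)
  have dx := hx.differentiable (by simp)
  have dy := hy.differentiable (by simp)
  -- the three derivatives
  set F : ℝ → ℝ → ℝ → ℝ := fun u s t => gaussFormDeriv (fderiv ℝ x (u, s) (0, 1))
    (fderiv ℝ y (u, t) (0, 1)) (x (u, s) - y (u, t)) (fderiv ℝ (fderiv ℝ x) (u, s) (1, 0) (0, 1))
    (fderiv ℝ (fderiv ℝ y) (u, t) (1, 0) (0, 1))
    (fderiv ℝ x (u, s) (1, 0) - fderiv ℝ y (u, t) (1, 0)) with hF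
  set B : ℝ → ℝ → ℝ → ℝ := fun u s t => gaussForm (fderiv ℝ x (u, s) (1, 0) -
    fderiv ℝ y (u, t) (1, 0)) (fderiv ℝ y (u, t) (0, 1)) (x (u, s) - y (u, t)) with hB
  set B' : ℝ → ℝ → ℝ → ℝ := fun u s t => gaussFormDeriv (fderiv ℝ x (u, s) (1, 0) -
    fderiv ℝ y (u, t) (1, 0)) (fderiv ℝ y (u, t) (0, 1)) (x (u, s) - y (u, t))
    (fderiv ℝ (fderiv ℝ x) (u, s) (1, 0) (0, 1)) 0 (fderiv ℝ x (u, s) (0, 1)) with hB'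
  set C' : ℝ → ℝ → ℝ → ℝ := fun u s t => gaussFormDeriv (fderiv ℝ x (u, s) (0, 1))
    (fderiv ℝ x (u, s) (1, 0) - fderiv ℝ y (u, t) (1, 0)) (x (u, s) - y (u, t)) 0
    (-fderiv ℝ (fderiv ℝ y) (u, t) (1, 0) (0, 1)) (-fderiv ℝ y (u, t) (0, 1)) with hC'
  have dA : ∀ u s t, HasDerivAt (fun u => gaussA x y u s t) (F u s t) u := fun u s t =>
    HasDerivAt.gaussForm (hasDerivAt_fderiv_left hx u s _) (hasDerivAt_fderiv_left hy u t _)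
      ((hasDerivAt_left dx u s).sub (hasDerivAt_left dy u t)) (hz u s t)
  have dB : ∀ u s t, HasDerivAt (fun s => B u s t) (B' u s t) s := fun u s t => by
    have h := HasDerivAt.gaussForm
      ((hasDerivAt_fderiv_right hx u s (1, 0)).sub_const (fderiv ℝ y (u, t) (1, 0)))
      (hasDerivAt_const s (fderiv ℝ y (u, t) (0, 1)))
      ((hasDerivAt_right dx u s).sub_const (y (u, t))) (hz u s t)
    rw [fderiv_fderiv_symm hx] at h
    exact h
  have dC : ∀ u s t, HasDerivAt (fun t => gaussC x y u s t) (C' u s t) t := fun u s t => by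
    have h := HasDerivAt.gaussForm (hasDerivAt_const t (fderiv ℝ x (u, s) (0, 1)))
      ((hasDerivAt_fderiv_right hy u t (1, 0)).const_sub (fderiv ℝ x (u, s) (1, 0)))
      ((hasDerivAt_right dy u t).const_sub (x (u, s))) (hz u s t)
    rw [fderiv_fderiv_symm hy] at h
    exact h
  have hFBC : ∀ u s t, F u s t = B' u s t - C' u s t := fun u s t =>
    gaussFormDeriv_closed _ _ _ _ _ _ _ (hz u s t)
  -- continuity of all integrands, as functions of the triple `(u, s, t)`
  have cx := hx.continuous
  have cy := hy.continuous
  have cx' := hx.continuous_fderiv (by simp)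
  have cy' := hy.continuous_fderiv (by simp)
  have cx'' := (contDiff_infty_iff_fderiv.1 hx).2.continuous_fderiv (by simp)
  have cy'' := (contDiff_infty_iff_fderiv.1 hy).2.continuous_fderiv (by simp)
  have p1 : Continuous fun q : ℝ × ℝ × ℝ => (q.1, q.2.1) := by fun_prop
  have p2 : Continuous fun q : ℝ × ℝ × ℝ => (q.1, q.2.2) := by fun_prop
  have kx := cx.comp p1
  have ky := cy.comp p2
  have kx' : ∀ v, Continuous fun q : ℝ × ℝ × ℝ => fderiv ℝ x (q.1, q.2.1) v := fun v =>
    (cx'.comp p1).clm_apply continuous_const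
  have ky' : ∀ v, Continuous fun q : ℝ × ℝ × ℝ => fderiv ℝ y (q.1, q.2.2) v := fun v =>
    (cy'.comp p2).clm_apply continuous_const
  have kx'' : ∀ v w, Continuous fun q : ℝ × ℝ × ℝ => fderiv ℝ (fderiv ℝ x) (q.1, q.2.1) v w :=
    fun v w => ((cx''.comp p1).clm_apply continuous_const).clm_apply continuous_const
  have ky'' : ∀ v w, Continuous fun q : ℝ × ℝ × ℝ => fderiv ℝ (fderiv ℝ y) (q.1, q.2.2) v w :=
    fun v w => ((cy''.comp p2).clm_apply continuous_const).clm_apply continuous_const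
  have hz' : ∀ q : ℝ × ℝ × ℝ, x (q.1, q.2.1) - y (q.1, q.2.2) ≠ 0 := fun q => hz _ _ _
  have cA : Continuous fun q : ℝ × ℝ × ℝ => gaussA x y q.1 q.2.1 q.2.2 :=
    continuous_gaussForm (kx' _) (ky' _) (kx.sub ky) hz'
  have cB' : Continuous fun q : ℝ × ℝ × ℝ => B' q.1 q.2.1 q.2.2 :=
    continuous_gaussFormDeriv ((kx' _).sub (ky' _)) (ky' _) (kx.sub ky) (kx'' _ _)
      continuous_const (kx' _) hz'
  have cC' : Continuous fun q : ℝ × ℝ × ℝ => C' q.1 q.2.1 q.2.2 :=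
    continuous_gaussFormDeriv (kx' _) ((kx' _).sub (ky' _)) (kx.sub ky) continuous_const
      (ky'' _ _).neg (ky' _).neg hz'
  have cF : Continuous fun q : ℝ × ℝ × ℝ => F q.1 q.2.1 q.2.2 := by
    simp only [hFBC]
    exact cB'.sub cC'
  have hBper : ∀ u t, B u 1 t = B u 0 t := fun u t => by
    have e1 := hper u 0
    have e2 := fderiv_add_one hper u 0
    rw [zero_add] at e1 e2
    simp only [hB, e1, e2]
  clear_value F B B' C'
  -- integrals of the exact terms
  have iA : ∀ s t, gaussA x y 1 s t - gaussA x y 0 s t = ∫ u in (0 : ℝ)..1, F u s t := fun s t =>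
    (intervalIntegral.integral_eq_sub_of_hasDerivAt (fun u _ => dA u s t)
      ((cF.comp (g := fun q : ℝ × ℝ × ℝ => F q.1 q.2.1 q.2.2) (f := fun u => (u, s, t))
        (by fun_prop)).intervalIntegrable _ _)).symm
  have iB : ∀ u t, ∫ s in (0 : ℝ)..1, B' u s t = 0 := fun u t => by
    rw [intervalIntegral.integral_eq_sub_of_hasDerivAt (fun s _ => dB u s t)
      ((cB'.comp (g := fun q : ℝ × ℝ × ℝ => B' q.1 q.2.1 q.2.2) (f := fun s => (u, s, t))
        (by fun_prop)).intervalIntegrable _ _), hBper, sub_self]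
  have iC : ∀ u s, ∫ t in a..b, C' u s t = gaussC x y u s b - gaussC x y u s a := fun u s =>
    intervalIntegral.integral_eq_sub_of_hasDerivAt (fun t _ => dC u s t)
      ((cC'.comp (g := fun q : ℝ × ℝ × ℝ => C' q.1 q.2.1 q.2.2) (f := fun t => (u, s, t))
        (by fun_prop)).intervalIntegrable _ _)
  have cont : ∀ {K : ℝ → ℝ → ℝ → ℝ}, (Continuous fun q : ℝ × ℝ × ℝ => K q.1 q.2.1 q.2.2) →
      ∀ {X : Type} [TopologicalSpace X] {f g h : X → ℝ}, Continuous f → Continuous g →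
      Continuous h → Continuous fun r => K (f r) (g r) (h r) := fun hK _ _ _ _ _ hf hg hh =>
    hK.comp (hf.prodMk (hg.prodMk hh))
  have cint : ∀ {X : Type} [TopologicalSpace X] {G : X → ℝ → ℝ} (c d : ℝ),
      (Continuous fun q : X × ℝ => G q.1 q.2) → Continuous fun r => ∫ u in c..d, G r u := by
    intro X _ G c d hG
    exact intervalIntegral.continuous_parametric_intervalIntegral_of_continuous' hG c d
  have cInt1 : ∀ u, Continuous fun s => ∫ t in a..b, gaussA x y u s t := fun u =>
    cint a b (cont cA continuous_const continuous_fst continuous_snd)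
  have cIntK : ∀ {K : ℝ → ℝ → ℝ → ℝ}, (Continuous fun q : ℝ × ℝ × ℝ => K q.1 q.2.1 q.2.2) →
      Continuous fun q : ℝ × ℝ => ∫ u in (0 : ℝ)..1, K u q.1 q.2 := fun hK =>
    cint 0 1 (cont hK continuous_snd (continuous_fst.comp continuous_fst)
      (continuous_snd.comp continuous_fst))
  have hslice : ∀ s, (∫ t in a..b, gaussA x y 1 s t) - (∫ t in a..b, gaussA x y 0 s t) =
      (∫ t in a..b, ∫ u in (0 : ℝ)..1, B' u s t) - ∫ t in a..b, ∫ u in (0 : ℝ)..1, C' u s t := by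
    intro s
    have cs : ∀ u, Continuous fun t => gaussA x y u s t := fun u =>
      cont cA continuous_const continuous_const continuous_id
    have cK : ∀ {K : ℝ → ℝ → ℝ → ℝ}, (Continuous fun q : ℝ × ℝ × ℝ => K q.1 q.2.1 q.2.2) →
        Continuous fun t => ∫ u in (0 : ℝ)..1, K u s t := fun hK =>
      (cIntK hK).comp (continuous_const.prodMk continuous_id)
    rw [← intervalIntegral.integral_sub ((cs 1).intervalIntegrable _ _)
      ((cs 0).intervalIntegrable _ _), ← intervalIntegral.integral_sub
      ((cK cB').intervalIntegrable _ _) ((cK cC').intervalIntegrable _ _)]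
    congr 1
    ext1 t
    have cB : Continuous fun u => B' u s t := cont cB' continuous_id continuous_const continuous_const
    have cC : Continuous fun u => C' u s t := cont cC' continuous_id continuous_const continuous_const
    rw [iA, ← intervalIntegral.integral_sub (cB.intervalIntegrable _ _) (cC.intervalIntegrable _ _)]
    simp only [hFBC]
  have cK2 : ∀ {K : ℝ → ℝ → ℝ → ℝ}, (Continuous fun q : ℝ × ℝ × ℝ => K q.1 q.2.1 q.2.2) →
      Continuous fun s => ∫ t in a..b, ∫ u in (0 : ℝ)..1, K u s t := fun hK =>
    cint a b (cIntK hK)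
  rw [← intervalIntegral.integral_sub ((cInt1 1).intervalIntegrable _ _)
    ((cInt1 0).intervalIntegrable _ _)]
  simp only [hslice]
  rw [intervalIntegral.integral_sub ((cK2 cB').intervalIntegrable _ _)
    ((cK2 cC').intervalIntegrable _ _)]
  have hB0 : ∫ s in (0 : ℝ)..1, ∫ t in a..b, ∫ u in (0 : ℝ)..1, B' u s t = 0 := by
    rw [integral_swap_of_continuous (f := fun s t => ∫ u in (0 : ℝ)..1, B' u s t) (cIntK cB')]
    have : ∀ t, ∫ s in (0 : ℝ)..1, ∫ u in (0 : ℝ)..1, B' u s t = 0 := fun t => by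
      rw [integral_swap_of_continuous (f := fun s u => B' u s t)
        (cont cB' continuous_snd continuous_fst continuous_const)]
      simp only [iB, intervalIntegral.integral_zero]
    simp only [this, intervalIntegral.integral_zero]
  rw [hB0, zero_sub]
  congr 2
  ext1 s
  rw [integral_swap_of_continuous (f := fun t u => C' u s t)
    (cont cC' continuous_snd continuous_const continuous_fst)]
  simp only [iC]

/-- Gauss's integral of two disjoint closed curves is invariant under link homotopy. -/
theorem gauss_eq_of_homotopy {x y : ℝ × ℝ → E3} (hx : ContDiff ℝ ∞ x) (hy : ContDiff ℝ ∞ y)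
    (hxp : ∀ u s, x (u, s + 1) = x (u, s)) (hyp : ∀ u s, y (u, s + 1) = y (u, s))
    (hne : ∀ u s t, x (u, s) ≠ y (u, t)) :
    gauss (fun s => x (1, s)) (fun t => y (1, t)) = gauss (fun s => x (0, s)) (fun t => y (0, t)) := by
  have h := gauss_homotopy hx hy hxp hne 0 1
  have hC : ∀ u s, gaussC x y u s 1 = gaussC x y u s 0 := fun u s => by
    have e1 := hyp u 0
    have e2 := fderiv_add_one hyp u 0
    rw [zero_add] at e1 e2
    simp only [gaussC, e1, e2]
  simp only [hC, sub_self, intervalIntegral.integral_zero, neg_zero] at h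
  have hg : ∀ u, gauss (fun s => x (u, s)) (fun t => y (u, t)) =
      ∫ s in (0 : ℝ)..1, ∫ t in (0 : ℝ)..1, gaussA x y u s t := fun u => by
    simp only [gauss, gaussA, (hasDerivAt_right (hx.differentiable (by simp)) u _).deriv,
      (hasDerivAt_right (hy.differentiable (by simp)) u _).deriv]
  rw [hg, hg]
  linarith

/-- A version of `gauss_eq_of_homotopy` for homotopies defined for parameters in `[0, 1]` only. -/
theorem gauss_eq_of_homotopy_Icc {x y : ℝ × ℝ → E3}
    (hx : ∀ u ∈ Set.Icc (0 : ℝ) 1, ∀ s, ContDiffAt ℝ ∞ x (u, s))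
    (hy : ∀ u ∈ Set.Icc (0 : ℝ) 1, ∀ s, ContDiffAt ℝ ∞ y (u, s))
    (hxp : ∀ u ∈ Set.Icc (0 : ℝ) 1, ∀ s, x (u, s + 1) = x (u, s))
    (hyp : ∀ u ∈ Set.Icc (0 : ℝ) 1, ∀ s, y (u, s + 1) = y (u, s))
    (hne : ∀ u ∈ Set.Icc (0 : ℝ) 1, ∀ s t, x (u, s) ≠ y (u, t)) :
    gauss (fun s => x (1, s)) (fun t => y (1, t)) = gauss (fun s => x (0, s)) (fun t => y (0, t)) := by
  -- reparametrize the homotopy by a smooth function with values in `[0, 1]`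
  have hσ : ∀ u, Real.smoothTransition u ∈ Set.Icc (0 : ℝ) 1 := fun u =>
    ⟨Real.smoothTransition.nonneg u, Real.smoothTransition.le_one u⟩
  have hr : ContDiff ℝ ∞ fun q : ℝ × ℝ => (Real.smoothTransition q.1, q.2) :=
    (Real.smoothTransition.contDiff.comp contDiff_fst).prodMk contDiff_snd
  have h := gauss_eq_of_homotopy (x := fun q => x (Real.smoothTransition q.1, q.2))
    (y := fun q => y (Real.smoothTransition q.1, q.2))
    (contDiff_iff_contDiffAt.2 fun q => (hx _ (hσ _) _).comp q hr.contDiffAt)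
    (contDiff_iff_contDiffAt.2 fun q => (hy _ (hσ _) _).comp q hr.contDiffAt)
    (fun u s => hxp _ (hσ u) s) (fun u s => hyp _ (hσ u) s) (fun u s t => hne _ (hσ u) s t)
  simpa only [Real.smoothTransition.zero, Real.smoothTransition.one] using h

/-! ### Invariance of the Gauss integral, and its vanishing for trivial links -/

namespace SmoothLink

variable {m : ℕ}

theorem gauss_eq_of_isotopic {L L' : SmoothLink m} (h : L.Isotopic L') {i j : Fin m} (hij : i ≠ j) :
    gauss (L'.toFun i) (L'.toFun j) = gauss (L.toFun i) (L.toFun j) := by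
  obtain ⟨H, G, hH, hG, hGH, hHG, h0, h1⟩ := h
  have hs : ∀ i, ContDiff ℝ ∞ fun q : ℝ × ℝ => H (q.1, L.toFun i q.2) := fun i =>
    hH.comp (contDiff_fst.prodMk ((L.smooth i).comp contDiff_snd))
  have hp : ∀ i u s, H (u, L.toFun i (s + 1)) = H (u, L.toFun i s) := fun i u s => by
    rw [L.periodic i s]
  have := gauss_eq_of_homotopy (hs i) (hs j) (hp i) (hp j) fun u s t e => by
    have e' := congrArg (fun x => G (u, x)) e
    simp only [hGH] at e'
    exact hij (L.injective i j s t e').1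
  simp only [h0, h1] at this
  exact this

theorem gauss_eq_zero_of_isTrivial {L : SmoothLink m} (h : L.IsTrivial) {i j : Fin m} (hij : i ≠ j) :
    gauss (L.toFun i) (L.toFun j) = 0 := by
  obtain ⟨e, he, hb, hd⟩ := h
  obtain ⟨Φ, hΦ, h0, -⟩ := exists_isThickDisk (he i) isClosed_empty (Set.disjoint_empty _)
  obtain ⟨V, Ψ, hV, hc⟩ := exists_isChart isCompact_stdCylinder hΦ.1
  -- the coordinate of the `i`-th component in the boundary of its disk
  set β : ℝ → ℂ := fun s => (Ψ (L.toFun i s)).1 with hβ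
  have key : ∀ s, ∃ z ∈ stdCircle, e i z = L.toFun i s ∧ β s = z ∧ ContDiffAt ℝ ∞ β s := fun s => by
    have : L.toFun i s ∈ e i '' stdCircle := by rw [hb]; exact ⟨s, rfl⟩
    obtain ⟨z, hz, hzs⟩ := this
    have hzV : (z, (0 : ℝ)) ∈ V := hV ⟨Metric.sphere_subset_closedBall hz, by norm_num⟩
    have hs := hc.smooth_inv _ hzV
    have hl := hc.left_inv _ hzV
    rw [h0, hzs] at hs hl
    exact ⟨z, hz, hzs, by rw [hβ]; simp only [hl], (hs.comp s (L.smooth i).contDiffAt).fst⟩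
  have hβn : ∀ s, ‖β s‖ = 1 := fun s => by
    obtain ⟨z, hz, -, e, -⟩ := key s
    rw [e]
    simpa [stdCircle] using hz
  have hβe : ∀ s, e i (β s) = L.toFun i s := fun s => by
    obtain ⟨z, hz, e1, e, -⟩ := key s
    rw [e, e1]
  have hβp : ∀ s, β (s + 1) = β s := fun s => by rw [hβ]; simp only [L.periodic i s]
  have hmem : ∀ u ∈ Set.Icc (0 : ℝ) 1, ∀ s, (1 - u) • β s ∈ stdDisk := fun u hu s => by
    rw [stdDisk, mem_closedBall_zero_iff, norm_smul, hβn, Real.norm_eq_abs,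
      abs_of_nonneg (by linarith [hu.2])]
    linarith [hu.1]
  have hgauss := gauss_eq_of_homotopy_Icc (x := fun q => e i ((1 - q.1) • β q.2))
    (y := fun q => L.toFun j q.2) (fun u hu s => ?_)
    (fun u _ s => ((L.smooth j).comp contDiff_snd).contDiffAt) (fun u _ s => by simp only [hβp])
    (fun u _ s => L.periodic j s) (fun u hu s t h => ?_)
  · simp only [sub_self, zero_smul, sub_zero, one_smul, hβe] at hgauss
    rw [← hgauss]
    simp [gauss, gaussForm, det3_eq]
  · obtain ⟨-, -, -, -, hβs⟩ := key s
    refine ContDiffAt.comp (g := e i) (u, s) ((he i).contDiffAt (hmem u hu s)) ?_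
    exact (contDiffAt_const.sub contDiffAt_fst).smul
      (ContDiffAt.comp (g := β) (f := Prod.snd) (u, s) hβs contDiffAt_snd)
  · have h2 : L.toFun j t ∈ e j '' stdDisk := by
      have : L.toFun j t ∈ e j '' stdCircle := by rw [hb]; exact ⟨t, rfl⟩
      exact Set.image_mono Metric.sphere_subset_closedBall this
    exact Set.disjoint_left.1 (hd i j hij) ⟨_, hmem u hu s, h⟩ h2

end SmoothLink

/-! ### The Gauss integral of a small meridian -/

theorem abs_det3_le (u v w : E3) : |det3 u v w| ≤ 6 * (‖u‖ * ‖v‖ * ‖w‖) := by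
  have h : ∀ i j k : Fin 3, |u i * (v j * w k)| ≤ ‖u‖ * ‖v‖ * ‖w‖ := fun i j k => by
    have hu := PiLp.norm_apply_le u i
    have hv := PiLp.norm_apply_le v j
    have hw := PiLp.norm_apply_le w k
    rw [Real.norm_eq_abs] at hu hv hw
    rw [abs_mul, abs_mul, ← mul_assoc]
    gcongr
  rw [det3_eq]
  have h1 := abs_le.1 (h 0 1 2)
  have h2 := abs_le.1 (h 0 2 1)
  have h3 := abs_le.1 (h 1 0 2)
  have h4 := abs_le.1 (h 1 2 0)
  have h5 := abs_le.1 (h 2 0 1)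
  have h6 := abs_le.1 (h 2 1 0)
  rw [abs_le]
  constructor <;> nlinarith

theorem det3_sub_det3 (a b c a' b' c' : E3) : det3 a' b' c' - det3 a b c =
    det3 (a' - a) b' c' + det3 a (b' - b) c' + det3 a b (c' - c) := by
  simp only [det3_eq, PiLp.sub_apply]
  ring

theorem det3_smul_mid (r : ℝ) (a b c : E3) : det3 a (r • b) c = r * det3 a b c := by
  simp only [det3_eq, PiLp.smul_apply, smul_eq_mul]
  ring

/-- The circle of radius `ρ ‖w‖` about `0` in the coordinates `κ` of a disk, run through `k` times. If
a strand crosses the disk at `κ 0`, this is a meridian of the strand. -/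
def meridian (κ : ℂ → E3) (k : ℤ) (w : ℂ) (ρ u : ℝ) : E3 := κ (ρ • rot (2 * Real.pi * k * u) w)

theorem hasDerivAt_rot (k : ℤ) (w : ℂ) (u : ℝ) : HasDerivAt (fun u : ℝ => rot (2 * Real.pi * k * u) w)
    ((2 * Real.pi * k) • (Complex.I * rot (2 * Real.pi * k * u) w)) u := by
  have h1 : HasDerivAt (fun u : ℝ => ((2 * Real.pi * k * u : ℝ) : ℂ)) ((2 * Real.pi * k : ℝ) : ℂ) u := by
    simpa using ((hasDerivAt_id u).const_mul (2 * Real.pi * k)).ofReal_comp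
  have h2 := ((h1.mul_const Complex.I).cexp).mul_const w
  refine h2.congr_deriv ?_
  simp only [rot, Complex.real_smul]
  ring

section meridian

variable {γ : ℝ → E3} {κ : ℂ → E3} {a : ℝ} {k : ℤ} {w : ℂ}

theorem hasDerivAt_meridian (hκ : ∀ z, ‖z‖ < 1 → ContDiffAt ℝ ∞ κ z) (hw1 : ‖w‖ < 1) {ρ : ℝ}
    (hρ : 0 ≤ ρ) (hρ1 : ρ ≤ 1) (u : ℝ) : HasDerivAt (meridian κ k w ρ)
      (ρ • fderiv ℝ κ (ρ • rot (2 * Real.pi * k * u) w)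
        ((2 * Real.pi * k) • (Complex.I * rot (2 * Real.pi * k * u) w))) u := by
  have hn : ‖ρ • rot (2 * Real.pi * k * u) w‖ < 1 := by
    rw [norm_smul, norm_rot, Real.norm_eq_abs, abs_of_nonneg hρ]
    nlinarith [norm_nonneg w]
  have h := ((hκ _ hn).differentiableAt (by simp)).hasFDerivAt.comp_hasDerivAt u
    ((hasDerivAt_rot k w u).const_smul ρ)
  rw [map_smul] at h
  exact h

/-- A strand and a disk that are transverse diverge linearly, to first order. -/
theorem exists_le_norm_smul_sub {v : E3} {D : ℂ →L[ℝ] E3} (h : det3 v (D 1) (D Complex.I) ≠ 0) :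
    ∃ c > 0, ∀ (τ : ℝ) (z : ℂ), c * |τ| ≤ ‖τ • v - D z‖ ∧ c * ‖z‖ ≤ ‖τ • v - D z‖ := by
  set B : ℂ × ℝ →L[ℝ] E3 := (ContinuousLinearMap.snd ℝ ℂ ℝ).smulRight v -
    D.comp (ContinuousLinearMap.fst ℝ ℂ ℝ) with hB
  have hBv : ∀ (z : ℂ) (τ : ℝ), B (z, τ) = τ • v - D z := fun z τ => rfl
  have hinj : Function.Injective B := by
    refine injective_of_det3_ne_zero _ ?_
    have : det3 (B (1, 0)) (B (Complex.I, 0)) (B (0, 1)) = det3 v (D 1) (D Complex.I) := by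
      simp only [hBv, zero_smul, zero_sub, one_smul, map_zero, sub_zero, det3_eq, PiLp.neg_apply]
      ring
    rwa [this]
  obtain ⟨K, hK, hanti⟩ := (B : ℂ × ℝ →ₗ[ℝ] E3).exists_antilipschitzWith
    (LinearMap.ker_eq_bot.2 hinj)
  have hK' : (0 : ℝ) < K := hK
  refine ⟨1 / K, by positivity, fun τ z => ?_⟩
  have h := hanti.le_mul_dist (z, τ) 0
  have e : dist ((B : ℂ × ℝ →ₗ[ℝ] E3) (z, τ)) ((B : ℂ × ℝ →ₗ[ℝ] E3) 0) = ‖τ • v - D z‖ := by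
    rw [map_zero, dist_eq_norm, sub_zero]
    exact congrArg norm (hBv z τ)
  rw [e, dist_eq_norm, sub_zero, Prod.norm_def] at h
  rw [one_div, ← div_eq_inv_mul, ← div_eq_inv_mul, div_le_iff₀ hK', div_le_iff₀ hK', mul_comm _ (K : ℝ)]
  exact ⟨(le_max_right _ _).trans h, (le_max_left _ _).trans h⟩

/-- Stability of the Gauss form under perturbations. Here `v`, `b`, `g` stand for the linear model of a
line and a circle of radius `ρ` around it, where the triple product is a constant `C` times `ρ`; `v'`,
`b'`, `f` are the true vectors, and `X` is comparable to the distance. Multiplication by `C` makes the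
main term positive. -/
theorem gaussForm_lower_of_approx {v v' b b' g f : E3} {P Q R c₀ e X ρ C : ℝ} (hR : 0 < R)
    (hc₀ : 0 < c₀) (he : 0 ≤ e) (hX : 0 < X) (hρ : 0 < ρ) (hv : ‖v‖ ≤ P) (hb : ‖b‖ ≤ Q)
    (hb' : ‖b'‖ ≤ Q) (hf : ‖f‖ ≤ R * X) (hvv : ‖v' - v‖ ≤ e) (hbb : ‖b' - b‖ ≤ e)
    (hfg : ‖f - g‖ ≤ e * X) (hfl : c₀ * X ≤ ‖f‖) (hdet : det3 v b g = C * ρ) :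
    C ^ 2 / R ^ 3 * ρ ^ 2 / X ^ 3 -
        |C| * (6 * (Q * R + P * R + P * Q)) / c₀ ^ 3 * e * ρ / X ^ 2 ≤
      C * gaussForm v' (ρ • b') f := by
  have hP : 0 ≤ P := (norm_nonneg v).trans hv
  have hQ : 0 ≤ Q := (norm_nonneg b).trans hb
  set E₀ := 6 * (Q * R + P * R + P * Q) with hE₀
  have hfpos : 0 < ‖f‖ := lt_of_lt_of_le (by positivity) hfl
  have herr : |det3 v' b' f - C * ρ| ≤ E₀ * e * X := by
    rw [← hdet, det3_sub_det3]
    have u1 : ‖v' - v‖ * ‖b'‖ * ‖f‖ ≤ e * Q * (R * X) := by gcongr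
    have u2 : ‖v‖ * ‖b' - b‖ * ‖f‖ ≤ P * e * (R * X) := by gcongr
    have u3 : ‖v‖ * ‖b‖ * ‖f - g‖ ≤ P * Q * (e * X) := by gcongr
    have t1 := abs_det3_le (v' - v) b' f
    have t2 := abs_det3_le v (b' - b) f
    have t3 := abs_det3_le v b (f - g)
    refine (abs_add_three _ _ _).trans ?_
    rw [hE₀]
    linarith
  have hnum : C ^ 2 * ρ ^ 2 - |C| * E₀ * e * ρ * X ≤ C * (ρ * det3 v' b' f) := by
    have h1 : -(|C| * (E₀ * e * X)) ≤ C * (det3 v' b' f - C * ρ) := by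
      refine le_trans (neg_le_neg ?_) (neg_abs_le _)
      rw [abs_mul]
      exact mul_le_mul_of_nonneg_left herr (abs_nonneg C)
    have h2 := mul_le_mul_of_nonneg_left h1 hρ.le
    linarith
  have hA : C ^ 2 / R ^ 3 * ρ ^ 2 / X ^ 3 ≤ C ^ 2 * ρ ^ 2 / ‖f‖ ^ 3 := by
    have : C ^ 2 / R ^ 3 * ρ ^ 2 / X ^ 3 = C ^ 2 * ρ ^ 2 / (R * X) ^ 3 := by field_simp
    rw [this]
    gcongr
  have hB : |C| * E₀ * e * ρ * X / ‖f‖ ^ 3 ≤ |C| * E₀ / c₀ ^ 3 * e * ρ / X ^ 2 := by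
    have : |C| * E₀ / c₀ ^ 3 * e * ρ / X ^ 2 = |C| * E₀ * e * ρ * X / (c₀ * X) ^ 3 := by field_simp
    rw [this]
    gcongr
  rw [gaussForm, det3_smul_mid]
  calc _ ≤ C ^ 2 * ρ ^ 2 / ‖f‖ ^ 3 - |C| * E₀ * e * ρ * X / ‖f‖ ^ 3 := sub_le_sub hA hB
    _ = (C ^ 2 * ρ ^ 2 - |C| * E₀ * e * ρ * X) / ‖f‖ ^ 3 := (sub_div _ _ _).symm
    _ ≤ C * (ρ * det3 v' b' f) / ‖f‖ ^ 3 := by gcongr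
    _ = _ := by rw [mul_div_assoc]

theorem det3_meridian (v : E3) (D : ℂ →L[ℝ] E3) (c τ ρ : ℝ) (z : ℂ) :
    det3 v (D (c • (Complex.I * z))) (τ • v - D (ρ • z)) =
      c * ‖z‖ ^ 2 * det3 v (D 1) (D Complex.I) * ρ := by
  have hD : ∀ ζ : ℂ, D ζ = ζ.re • D 1 + ζ.im • D Complex.I := fun ζ => by
    rw [← map_smul, ← map_smul, ← map_add]
    congr 1
    apply Complex.ext <;> simp
  have hW : ‖z‖ ^ 2 = z.re ^ 2 + z.im ^ 2 := by
    rw [← Complex.normSq_eq_norm_sq, Complex.normSq_apply]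
    ring
  rw [hW, hD (c • (Complex.I * z)), hD (ρ • z)]
  simp only [det3_eq, PiLp.add_apply, PiLp.smul_apply, PiLp.sub_apply, smul_eq_mul,
    Complex.smul_re, Complex.smul_im, Complex.mul_re, Complex.mul_im, Complex.I_re, Complex.I_im]
  ring

/-- First order approximation of a strand and of a disk at their intersection. -/
theorem exists_linear_approx (hγ : ContDiff ℝ ∞ γ) (hκ : ContDiffAt ℝ ∞ κ 0) {η : ℝ} (hη : 0 < η) :
    ∃ δ > 0, δ < 1 / 2 ∧ (∀ s, |s - a| ≤ δ → ‖deriv γ s - deriv γ a‖ ≤ η ∧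
      ‖γ s - γ a - (s - a) • deriv γ a‖ ≤ η * |s - a|) ∧ ∀ z, ‖z‖ ≤ δ →
      ‖fderiv ℝ κ z - fderiv ℝ κ 0‖ ≤ η ∧ ‖κ z - κ 0 - fderiv ℝ κ 0 z‖ ≤ η * ‖z‖ := by
  have e1 : ∀ᶠ s in 𝓝 a, ‖deriv γ s - deriv γ a‖ < η := by
    have hc : ContinuousAt (deriv γ) a := (hγ.continuous_deriv (by simp)).continuousAt
    simpa only [dist_eq_norm] using Metric.continuousAt_iff'.1 hc η hη
  have e2 : ∀ᶠ s in 𝓝 a, ‖γ s - γ a - (s - a) • deriv γ a‖ ≤ η * ‖s - a‖ :=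
    (hasDerivAt_iff_isLittleO.1 (hγ.differentiable (by simp) a).hasDerivAt).def hη
  have e3 : ∀ᶠ z in 𝓝 (0 : ℂ), ‖fderiv ℝ κ z - fderiv ℝ κ 0‖ < η := by
    have hc : ContinuousAt (fderiv ℝ κ) 0 := (hκ.fderiv_right (m := 0) (by simp)).continuousAt
    simpa only [dist_eq_norm] using Metric.continuousAt_iff'.1 hc η hη
  have e4 : ∀ᶠ z in 𝓝 (0 : ℂ), ‖κ z - κ 0 - fderiv ℝ κ 0 (z - 0)‖ ≤ η * ‖z - 0‖ :=
    (hasFDerivAt_iff_isLittleO.1 (hκ.differentiableAt (by simp)).hasFDerivAt).def hη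
  obtain ⟨δ₁, hδ₁, H1⟩ := Metric.eventually_nhds_iff.1 (e1.and e2)
  obtain ⟨δ₂, hδ₂, H2⟩ := Metric.eventually_nhds_iff.1 (e3.and e4)
  obtain ⟨δ, hδ, hd⟩ := exists_between (show 0 < min δ₁ (min δ₂ (1 / 2)) by positivity)
  simp only [lt_min_iff] at hd
  refine ⟨δ, hδ, hd.2.2, fun s hs => ?_, fun z hz => ?_⟩
  · obtain ⟨h1, h2⟩ := H1 (y := s) (by rw [Real.dist_eq]; linarith)
    exact ⟨h1.le, h2⟩
  · obtain ⟨h1, h2⟩ := H2 (y := z) (by rw [dist_eq_norm, sub_zero]; linarith)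
    rw [sub_zero] at h2
    exact ⟨h1.le, h2⟩

/-- Lower bound for the Gauss integrand of a strand and a small meridian near the point where the
strand crosses the disk. -/
theorem gaussForm_meridian_lower (hγ : ContDiff ℝ ∞ γ) (hκ : ∀ z, ‖z‖ < 1 → ContDiffAt ℝ ∞ κ z)
    (h0 : κ 0 = γ a) (hk : k ≠ 0) (hw : w ≠ 0) (hw1 : ‖w‖ < 1)
    (hdet : det3 (deriv γ a) (fderiv ℝ κ 0 1) (fderiv ℝ κ 0 Complex.I) ≠ 0) :
    ∃ C A B : ℝ, 0 < A ∧ 0 < B ∧ ∀ η > 0, ∃ δ > 0, δ < 1 / 2 ∧ ∀ s, |s - a| ≤ δ →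
      ∀ ρ, 0 < ρ → ρ ≤ δ → ∀ u,
        A * ρ ^ 2 / (|s - a| + ρ) ^ 3 - B * η * ρ / (|s - a| + ρ) ^ 2 ≤
          C * gaussForm (deriv γ s) (deriv (meridian κ k w ρ) u) (γ s - meridian κ k w ρ u) := by
  obtain ⟨c, hc, hlow⟩ := exists_le_norm_smul_sub hdet
  have happ := fun η hη => exists_linear_approx (a := a) (η := η) hγ (hκ 0 (by simp)) hη
  simp only [h0] at happ
  generalize deriv γ a = v at *
  generalize fderiv ℝ κ 0 = D at *
  have hW : 0 < ‖w‖ := norm_pos_iff.2 hw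
  have hk0 : (2 * Real.pi * k : ℝ) ≠ 0 :=
    mul_ne_zero (mul_ne_zero two_ne_zero Real.pi_ne_zero) (Int.cast_ne_zero.2 hk)
  have hder := fun ρ (h : 0 ≤ ρ) h' u => (hasDerivAt_meridian (k := k) hκ hw1 (ρ := ρ) h h' u).deriv
  have hmer : ∀ ρ u, meridian κ k w ρ u = κ (ρ • rot (2 * Real.pi * k * u) w) := fun _ _ => rfl
  have hnorm : ∀ u : ℝ, ‖rot (2 * Real.pi * k * u) w‖ = ‖w‖ := fun u => norm_rot _ _
  generalize 2 * Real.pi * (k : ℝ) = c' at *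
  generalize ‖w‖ = W at *
  set C : ℝ := c' * W ^ 2 * det3 v (D 1) (D Complex.I) with hC
  have hC0 : C ≠ 0 := mul_ne_zero (mul_ne_zero hk0 (pow_ne_zero 2 hW.ne')) hdet
  set Q : ℝ := (‖D‖ + 1) * (|c'| * W) with hQ
  set R : ℝ := ‖v‖ + ‖D‖ + 2 with hR
  set c₀ : ℝ := c * W / 4 with hc₀
  set M : ℝ := 2 + |c'| * W with hM
  have hMpos : 0 < M := by positivity
  have hQnn : 0 ≤ Q := by positivity
  have hRpos : 0 < R := by positivity
  have hc₀pos : 0 < c₀ := by positivity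
  refine ⟨C, C ^ 2 / R ^ 3, |C| * (6 * (Q * R + ‖v‖ * R + ‖v‖ * Q)) / c₀ ^ 3 * M + 1, by positivity,
    by positivity, fun η₀ hη₀ => ?_⟩
  obtain ⟨η, hη, hηη, hη1, hηc⟩ : ∃ η > 0, η ≤ η₀ ∧ η ≤ 1 ∧ η ≤ c₀ :=
    ⟨min η₀ (min 1 c₀), by positivity, min_le_left _ _,
      (min_le_right _ _).trans (min_le_left _ _), (min_le_right _ _).trans (min_le_right _ _)⟩
  obtain ⟨δ, hδ, hδ2, H1, H2⟩ := happ η hη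
  refine ⟨δ, hδ, hδ2, fun s hs ρ hρ hρδ u => ?_⟩
  have hz := hnorm u
  rw [hder ρ hρ.le (by linarith) u, hmer]
  generalize rot (c' * u) w = z at *
  have hρz : ‖ρ • z‖ = ρ * W := by rw [norm_smul, hz, Real.norm_eq_abs, abs_of_pos hρ]
  have hρW : ρ * W ≤ ρ := mul_le_of_le_one_right hρ.le hw1.le
  obtain ⟨f1, f2⟩ := H1 s hs
  obtain ⟨f3, f4⟩ := H2 (ρ • z) (by rw [hρz]; linarith)
  rw [hρz] at f4
  obtain ⟨l1, l2⟩ := hlow (s - a) (ρ • z)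
  rw [hρz] at l2
  have hτ0 := abs_nonneg (s - a)
  have hIz : ‖c' • (Complex.I * z)‖ = |c'| * W := by
    rw [norm_smul, norm_mul Complex.I, Complex.norm_I, one_mul, hz, Real.norm_eq_abs]
  have hfg : ‖(γ s - κ (ρ • z)) - ((s - a) • v - D (ρ • z))‖ ≤ η * (|s - a| + ρ) := by
    have : (γ s - κ (ρ • z)) - ((s - a) • v - D (ρ • z)) =
      (γ s - γ a - (s - a) • v) - (κ (ρ • z) - γ a - D (ρ • z)) := by abel
    rw [this]
    refine (norm_sub_le _ _).trans ((add_le_add f2 f4).trans ?_)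
    rw [← mul_add]
    gcongr
  have hb : ∀ T : ℂ →L[ℝ] E3, ‖T (c' • (Complex.I * z))‖ ≤ ‖T‖ * (|c'| * W) := fun T => by
    have h1 := T.le_opNorm (c' • (Complex.I * z))
    rwa [hIz] at h1
  have hD' : ‖fderiv ℝ κ (ρ • z)‖ ≤ ‖D‖ + 1 := by
    have := norm_le_norm_add_norm_sub' (fderiv ℝ κ (ρ • z)) D
    linarith
  have hgn : ‖(s - a) • v - D (ρ • z)‖ ≤ (‖v‖ + ‖D‖) * (|s - a| + ρ) := by
    have h2 := D.le_opNorm (ρ • z)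
    rw [hρz] at h2
    have h3 : ‖D‖ * (ρ * W) ≤ ‖D‖ * ρ := by gcongr
    have h4 := norm_sub_le ((s - a) • v) (D (ρ • z))
    rw [norm_smul, Real.norm_eq_abs] at h4
    have h5 : 0 ≤ ‖v‖ * ρ := by positivity
    have h6 : 0 ≤ ‖D‖ * |s - a| := by positivity
    linarith
  have hX : 0 < |s - a| + ρ := by positivity
  have hηX : η * (|s - a| + ρ) ≤ 1 * (|s - a| + ρ) := by gcongr
  have hηX' : η * (|s - a| + ρ) ≤ c₀ * (|s - a| + ρ) := by gcongr
  have hgl : 2 * c₀ * (|s - a| + ρ) ≤ ‖(s - a) • v - D (ρ • z)‖ := by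
    have h1 : c * W * |s - a| ≤ c * |s - a| := by
      have : c * W ≤ c := mul_le_of_le_one_right hc.le hw1.le
      gcongr
    rw [hc₀]
    linarith
  have key := gaussForm_lower_of_approx (v := v) (v' := deriv γ s) (b := D (c' • (Complex.I * z)))
    (b' := fderiv ℝ κ (ρ • z) (c' • (Complex.I * z))) (g := (s - a) • v - D (ρ • z))
    (f := γ s - κ (ρ • z)) (P := ‖v‖) (Q := Q) (R := R) (c₀ := c₀) (e := η * M)
    (X := |s - a| + ρ) (ρ := ρ) (C := C) hRpos hc₀pos (by positivity) hX hρ le_rfl ?_ ?_ ?_ ?_ ?_ ?_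
    ?_ ?_
  · refine le_trans (sub_le_sub_left ?_ _) key
    have hE : 0 ≤ |C| * (6 * (Q * R + ‖v‖ * R + ‖v‖ * Q)) / c₀ ^ 3 := by positivity
    generalize |C| * (6 * (Q * R + ‖v‖ * R + ‖v‖ * Q)) / c₀ ^ 3 = E at *
    have h1 : E * (η * M) ≤ (E * M + 1) * η₀ := by
      have : E * M * η ≤ E * M * η₀ := by gcongr
      linarith
    gcongr
  · exact (hb D).trans (by rw [hQ]; gcongr; linarith)
  · exact (hb _).trans (by rw [hQ]; gcongr)
  · have h1 := norm_le_norm_add_norm_sub' (γ s - κ (ρ • z)) ((s - a) • v - D (ρ • z))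
    rw [hR]
    linarith
  · have : η * 1 ≤ η * M := by
      gcongr
      rw [hM]
      have : 0 ≤ |c'| * W := by positivity
      linarith
    linarith
  · have h1 := hb (fderiv ℝ κ (ρ • z) - D)
    have h2 : ‖fderiv ℝ κ (ρ • z) - D‖ * (|c'| * W) ≤ η * (|c'| * W) := by gcongr
    have h3 : η * (|c'| * W) ≤ η * M := by
      gcongr
      rw [hM]
      linarith
    exact h1.trans (h2.trans h3)
  · refine hfg.trans ?_
    have : η * 1 ≤ η * M := by
      gcongr
      rw [hM]
      have : 0 ≤ |c'| * W := by positivity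
      linarith
    rw [mul_one] at this
    gcongr
  · have h1 := norm_le_norm_add_norm_sub' ((s - a) • v - D (ρ • z)) (γ s - κ (ρ • z))
    rw [norm_sub_rev] at hfg
    linarith
  · rw [det3_meridian, hz]

/-- Away from the point where a strand crosses a disk, the Gauss integrand of the strand and a small
meridian is small. -/
theorem gaussForm_meridian_far (hγ : ContDiff ℝ ∞ γ) (hκ : ∀ z, ‖z‖ < 1 → ContDiffAt ℝ ∞ κ z)
    (hw1 : ‖w‖ < 1) {S : Set ℝ} (hS : IsCompact S) (hne : ∀ s ∈ S, γ s ≠ κ 0) :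
    ∃ K ρ₀ : ℝ, 0 ≤ K ∧ 0 < ρ₀ ∧ ∀ s ∈ S, ∀ ρ, 0 < ρ → ρ ≤ ρ₀ → ∀ u,
      |gaussForm (deriv γ s) (deriv (meridian κ k w ρ) u) (γ s - meridian κ k w ρ u)| ≤ K * ρ := by
  obtain ⟨d, hd, hd'⟩ := hS.exists_forall_le' (f := fun s => ‖γ s - κ 0‖) (a := 0)
    ((hγ.continuous.sub continuous_const).norm.continuousOn)
    (fun s hs => norm_pos_iff.2 (sub_ne_zero.2 (hne s hs)))
  obtain ⟨G, hG⟩ := hS.exists_bound_of_continuousOn (hγ.continuous_deriv (by simp)).continuousOn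
  obtain ⟨δ, hδ, hδ2, -, H⟩ := exists_linear_approx (a := 0) (η := 1) hγ (hκ 0 (by simp)) one_pos
  set N := ‖fderiv ℝ κ 0‖ + 1 with hN
  have hNpos : 0 < N := by positivity
  have hG' : 0 ≤ |G| := abs_nonneg G
  refine ⟨6 * (|G| * (N * |2 * Real.pi * k|)) / (d / 2) ^ 2, min δ (d / (2 * N)), by positivity,
    by positivity, fun s hs ρ hρ hρ' u => ?_⟩
  have hρδ := hρ'.trans (min_le_left _ _)
  have hρd := hρ'.trans (min_le_right _ _)
  rw [(hasDerivAt_meridian hκ hw1 hρ.le (by linarith) u).deriv]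
  have hm : meridian κ k w ρ u = κ (ρ • rot (2 * Real.pi * k * u) w) := rfl
  rw [hm]
  have hz : ‖rot (2 * Real.pi * k * u) w‖ ≤ 1 := (norm_rot _ _).trans_le hw1.le
  generalize rot (2 * Real.pi * k * u) w = z at *
  generalize 2 * Real.pi * (k : ℝ) = c' at *
  have hρz : ‖ρ • z‖ ≤ ρ := by
    rw [norm_smul, Real.norm_eq_abs, abs_of_pos hρ]
    nlinarith
  obtain ⟨f1, f2⟩ := H (ρ • z) (hρz.trans hρδ)
  have hT : ‖fderiv ℝ κ (ρ • z)‖ ≤ N := by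
    have := norm_le_norm_add_norm_sub' (fderiv ℝ κ (ρ • z)) (fderiv ℝ κ 0)
    linarith
  have hf : d / 2 ≤ ‖γ s - κ (ρ • z)‖ := by
    have h1 : ‖κ (ρ • z) - κ 0‖ ≤ N * ρ := by
      have h2 := norm_le_norm_add_norm_sub' (κ (ρ • z) - κ 0) (fderiv ℝ κ 0 (ρ • z))
      have h3 : ‖fderiv ℝ κ 0 (ρ • z)‖ ≤ ‖fderiv ℝ κ 0‖ * ρ :=
        ((fderiv ℝ κ 0).le_opNorm _).trans (by gcongr)
      linarith
    have h2 : N * ρ ≤ d / 2 := by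
      rw [le_div_iff₀ (by positivity)] at hρd
      linarith
    have h3 := hd' s hs
    have h4 : ‖γ s - κ 0‖ ≤ ‖γ s - κ (ρ • z)‖ + ‖κ (ρ • z) - κ 0‖ := by
      have := norm_add_le (γ s - κ (ρ • z)) (κ (ρ • z) - κ 0)
      rwa [sub_add_sub_cancel] at this
    linarith
  generalize γ s - κ (ρ • z) = f at *
  have hfpos : 0 < ‖f‖ := lt_of_lt_of_le (by positivity) hf
  have hb : ‖fderiv ℝ κ (ρ • z) (c' • (Complex.I * z))‖ ≤ N * |c'| := by
    refine ((fderiv ℝ κ (ρ • z)).le_opNorm _).trans ?_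
    have : ‖c' • (Complex.I * z)‖ ≤ |c'| := by
      rw [norm_smul, norm_mul Complex.I, Complex.norm_I, one_mul, Real.norm_eq_abs]
      exact mul_le_of_le_one_right (abs_nonneg _) hz
    gcongr
  have hv : ‖deriv γ s‖ ≤ |G| := (hG s hs).trans (le_abs_self G)
  rw [gaussForm, det3_smul_mid, abs_div, abs_mul, abs_of_pos hρ, abs_of_pos (pow_pos hfpos 3),
    div_le_iff₀ (pow_pos hfpos 3)]
  generalize fderiv ℝ κ (ρ • z) (c' • (Complex.I * z)) = b at *
  have h1 : |det3 (deriv γ s) b f| ≤ 6 * (|G| * (N * |c'|) * ‖f‖) :=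
    (abs_det3_le _ _ _).trans (by gcongr)
  have h2 : 6 * (|G| * (N * |c'|)) / (d / 2) ^ 2 * ρ * ‖f‖ ^ 3 =
      ρ * (6 * (|G| * (N * |c'|)) * ‖f‖) * (‖f‖ ^ 2 / (d / 2) ^ 2) := by
    field_simp
  have h3 : 1 ≤ ‖f‖ ^ 2 / (d / 2) ^ 2 := by
    rw [one_le_div (by positivity)]
    gcongr
  rw [h2]
  calc ρ * |det3 (deriv γ s) b f| ≤ ρ * (6 * (|G| * (N * |c'|) * ‖f‖)) := by gcongr
    _ = ρ * (6 * (|G| * (N * |c'|)) * ‖f‖) * 1 := by ring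
    _ ≤ _ := by gcongr

/-- The model integrand has an elementary primitive; its error term has the scale-invariant size `B * η`. -/
theorem le_integral_model {A B η ρ δ : ℝ} (hA : 0 < A) (hB : 0 < B) (hη : 0 < η) (hηB : B * η ≤ A / 8)
    (hρ : 0 < ρ) (hρδ : ρ ≤ δ) :
    A / 4 ≤ ∫ τ in (0 : ℝ)..δ, (A * ρ ^ 2 / (τ + ρ) ^ 3 - B * η * ρ / (τ + ρ) ^ 2) := by
  have hpos : ∀ τ ∈ Set.uIcc 0 δ, 0 < τ + ρ := fun τ hτ => by
    rw [Set.uIcc_of_le (by linarith)] at hτ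
    linarith [hτ.1]
  have hderiv : ∀ τ ∈ Set.uIcc 0 δ, HasDerivAt
      (fun τ => B * η * ρ / (τ + ρ) - A * ρ ^ 2 / 2 / (τ + ρ) ^ 2)
      (A * ρ ^ 2 / (τ + ρ) ^ 3 - B * η * ρ / (τ + ρ) ^ 2) τ := fun τ hτ => by
    have h0 := (hpos τ hτ).ne'
    have h1 : HasDerivAt (fun τ => τ + ρ) 1 τ := (hasDerivAt_id τ).add_const ρ
    have h2 := ((h1.inv h0).const_mul (B * η * ρ)).sub (((h1.pow 2).inv (pow_ne_zero 2 h0)).const_mul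
      (A * ρ ^ 2 / 2))
    have h3 : (fun τ => B * η * ρ / (τ + ρ) - A * ρ ^ 2 / 2 / (τ + ρ) ^ 2) =
        fun τ => B * η * ρ * (τ + ρ)⁻¹ - A * ρ ^ 2 / 2 * ((τ + ρ) ^ 2)⁻¹ := by
      simp only [div_eq_mul_inv]
    rw [h3]
    refine h2.congr_deriv ?_
    simp only [Pi.pow_apply]
    field_simp
    push_cast
    ring
  have hcont : ContinuousOn (fun τ => A * ρ ^ 2 / (τ + ρ) ^ 3 - B * η * ρ / (τ + ρ) ^ 2)
      (Set.uIcc 0 δ) :=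
    (continuousOn_const.div (by fun_prop) fun τ hτ => pow_ne_zero 3 (hpos τ hτ).ne').sub
      (continuousOn_const.div (by fun_prop) fun τ hτ => pow_ne_zero 2 (hpos τ hτ).ne')
  rw [intervalIntegral.integral_eq_sub_of_hasDerivAt hderiv hcont.intervalIntegrable, zero_add]
  have hδ : 0 < δ + ρ := by linarith
  have e1 : B * η * ρ / ρ = B * η := by field_simp
  have e2 : A * ρ ^ 2 / 2 / ρ ^ 2 = A / 2 := by field_simp
  have e3 : A * ρ ^ 2 / 2 / (δ + ρ) ^ 2 ≤ A / 8 := by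
    rw [div_le_iff₀ (by positivity)]
    have : (2 * ρ) ^ 2 ≤ (δ + ρ) ^ 2 := by gcongr; linarith
    nlinarith
  have e4 : 0 ≤ B * η * ρ / (δ + ρ) := by positivity
  rw [e1, e2]
  linarith

/-- A small meridian of a strand of a closed curve, which meets the closed curve nowhere else, has
nonzero Gauss integral with it. Near the strand the integrand is to first order the one for a line
and a circle around it, which has constant sign. -/
theorem exists_gauss_meridian_ne_zero (hγ : ContDiff ℝ ∞ γ) (hp : Function.Periodic γ 1)
    (hκ : ∀ z, ‖z‖ < 1 → ContDiffAt ℝ ∞ κ z) (h0 : κ 0 = γ a) (hk : k ≠ 0) (hw : w ≠ 0)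
    (hw1 : ‖w‖ < 1) (hdet : det3 (deriv γ a) (fderiv ℝ κ 0 1) (fderiv ℝ κ 0 Complex.I) ≠ 0)
    (hγ0 : ∀ s ∈ Set.Ioo a (a + 1), γ s ≠ κ 0)
    (hne : ∀ ρ, 0 < ρ → ρ ≤ 1 → ∀ s u, γ s ≠ meridian κ k w ρ u) :
    ∃ ρ, 0 < ρ ∧ ρ ≤ 1 ∧ gauss γ (meridian κ k w ρ) ≠ 0 := by
  obtain ⟨C, A, B, hA, hB, hnear⟩ := gaussForm_meridian_lower (k := k) hγ hκ h0 hk hw hw1 hdet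
  have hη : 0 < A / (8 * B) := by positivity
  obtain ⟨δ, hδ, hδ2, hnear⟩ := hnear _ hη
  obtain ⟨K, ρ₀, hK, hρ₀, hfar⟩ := gaussForm_meridian_far (k := k) hγ hκ hw1
    (S := Set.Icc (a + δ) (a + 1 - δ)) isCompact_Icc
    (fun s hs => hγ0 s ⟨by linarith [hs.1], by linarith [hs.2]⟩)
  obtain ⟨ρ, hρ, hρδ, hρρ₀, hρK⟩ : ∃ ρ > 0, ρ ≤ δ ∧ ρ ≤ ρ₀ ∧ |C| * K * ρ < A / 2 :=
    ⟨min δ (min ρ₀ (A / (4 * (|C| * K + 1)))), by positivity, min_le_left _ _,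
      (min_le_right _ _).trans (min_le_left _ _), by
        have h1 : min δ (min ρ₀ (A / (4 * (|C| * K + 1)))) ≤ A / (4 * (|C| * K + 1)) :=
          (min_le_right _ _).trans (min_le_right _ _)
        have h2 : 0 ≤ |C| * K := by positivity
        rw [le_div_iff₀ (by positivity)] at h1
        have h3 : 0 < min δ (min ρ₀ (A / (4 * (|C| * K + 1)))) := by positivity
        nlinarith⟩
  refine ⟨ρ, hρ, by linarith, fun hzero => ?_⟩
  -- the integrand, multiplied by `C`
  set F : ℝ → ℝ → ℝ := fun s u => C * gaussForm (deriv γ s) (deriv (meridian κ k w ρ) u)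
    (γ s - meridian κ k w ρ u) with hF
  have hder := fun u => hasDerivAt_meridian (k := k) hκ hw1 hρ.le (by linarith) u
  have hρz : ∀ u : ℝ, ‖ρ • rot (2 * Real.pi * k * u) w‖ < 1 := fun u => by
    rw [norm_smul, norm_rot, Real.norm_eq_abs, abs_of_pos hρ]
    nlinarith [norm_nonneg w]
  have hrot : ContDiff ℝ ∞ fun u : ℝ => ρ • rot (2 * Real.pi * k * u) w := by
    have h : ContDiff ℝ ∞ fun u : ℝ => rot (2 * Real.pi * k * u) w :=
      contDiff_rot.comp (f := fun u : ℝ => (2 * Real.pi * k * u, w))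
        ((contDiff_const.mul contDiff_id).prodMk contDiff_const)
    exact h.const_smul ρ
  have hms : ContDiff ℝ ∞ (meridian κ k w ρ) := contDiff_iff_contDiffAt.2 fun u =>
    (hκ _ (hρz u)).comp u hrot.contDiffAt
  have hFc : Continuous fun q : ℝ × ℝ => F q.1 q.2 := continuous_const.mul <| continuous_gaussForm
    ((hγ.continuous_deriv (by simp)).comp continuous_fst)
    ((hms.continuous_deriv (by simp)).comp continuous_snd)
    ((hγ.continuous.comp continuous_fst).sub (hms.continuous.comp continuous_snd))
    fun q => sub_ne_zero.2 (hne ρ hρ (by linarith) _ _)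
  set I : ℝ → ℝ := fun s => ∫ u in (0 : ℝ)..1, F s u with hI
  have hIc : Continuous I :=
    intervalIntegral.continuous_parametric_intervalIntegral_of_continuous' hFc 0 1
  have hFs : ∀ s, IntervalIntegrable (F s) MeasureTheory.volume 0 1 := fun s =>
    (hFc.comp (continuous_const.prodMk continuous_id)).intervalIntegrable _ _
  have hIp : Function.Periodic I 1 := fun s => by
    have h2 : deriv γ (s + 1) = deriv γ s := by
      rw [← deriv_comp_add_const]
      exact congrArg (fun f => deriv f s) (funext hp)
    simp only [hI, hF, h2, hp s]
  have hint : ∫ s in (0 : ℝ)..1, I s = 0 := by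
    simp only [hI, hF, intervalIntegral.integral_const_mul]
    have h : ∫ s in (0 : ℝ)..1, ∫ u in (0 : ℝ)..1, gaussForm (deriv γ s)
      (deriv (meridian κ k w ρ) u) (γ s - meridian κ k w ρ u) = 0 := hzero
    rw [h, mul_zero]
  have hsplit : ∫ s in (0 : ℝ)..1, I s = (∫ s in (a - δ)..a, I s) + (∫ s in a..(a + δ), I s) +
      ∫ s in (a + δ)..(a + 1 - δ), I s := by
    have h1 := hIp.intervalIntegral_add_eq 0 (a - δ)
    rw [zero_add] at h1
    rw [h1, intervalIntegral.integral_add_adjacent_intervals (hIc.intervalIntegrable _ _)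
      (hIc.intervalIntegrable _ _), intervalIntegral.integral_add_adjacent_intervals
      (hIc.intervalIntegrable _ _) (hIc.intervalIntegrable _ _)]
    congr 1
    ring
  have hlow : ∀ s, |s - a| ≤ δ → A * ρ ^ 2 / (|s - a| + ρ) ^ 3 -
      B * (A / (8 * B)) * ρ / (|s - a| + ρ) ^ 2 ≤ I s := fun s hs => by
    have h := intervalIntegral.integral_mono_on (a := (0 : ℝ)) (b := 1) zero_le_one
      (intervalIntegrable_const (c := A * ρ ^ 2 / (|s - a| + ρ) ^ 3 -
      B * (A / (8 * B)) * ρ / (|s - a| + ρ) ^ 2)) (hFs s) (fun u _ => hnear s hs ρ hρ hρδ u)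
    simpa using h
  have hmodel : Continuous fun s => A * ρ ^ 2 / (|s - a| + ρ) ^ 3 -
      B * (A / (8 * B)) * ρ / (|s - a| + ρ) ^ 2 := by
    have hp : ∀ s, |s - a| + ρ ≠ 0 := fun s => by positivity
    exact (continuous_const.div (by fun_prop) fun s => pow_ne_zero 3 (hp s)).sub
      (continuous_const.div (by fun_prop) fun s => pow_ne_zero 2 (hp s))
  have hmod := le_integral_model hA hB hη (by
    have : B * (A / (8 * B)) = A / 8 := by field_simp
    exact this.le) hρ hρδ
  have hright : A / 4 ≤ ∫ s in a..(a + δ), I s := by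
    refine hmod.trans ?_
    have h1 : ∫ s in a..(a + δ), (A * ρ ^ 2 / (|s - a| + ρ) ^ 3 -
        B * (A / (8 * B)) * ρ / (|s - a| + ρ) ^ 2) = ∫ τ in (0 : ℝ)..δ,
        (A * ρ ^ 2 / (τ + ρ) ^ 3 - B * (A / (8 * B)) * ρ / (τ + ρ) ^ 2) := by
      have h := intervalIntegral.integral_comp_sub_right (a := a) (b := a + δ) (fun τ : ℝ =>
        A * ρ ^ 2 / (|τ| + ρ) ^ 3 - B * (A / (8 * B)) * ρ / (|τ| + ρ) ^ 2) a
      rw [sub_self, add_sub_cancel_left] at h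
      rw [h]
      refine intervalIntegral.integral_congr fun τ hτ => ?_
      rw [Set.uIcc_of_le hδ.le] at hτ
      simp only [abs_of_nonneg hτ.1]
    rw [← h1]
    refine intervalIntegral.integral_mono_on (by linarith) (hmodel.intervalIntegrable _ _)
      (hIc.intervalIntegrable _ _) fun s hs => hlow s ?_
    rw [abs_of_nonneg (by linarith [hs.1])]
    linarith [hs.2]
  have hleft : A / 4 ≤ ∫ s in (a - δ)..a, I s := by
    refine hmod.trans ?_
    have h1 : ∫ s in (a - δ)..a, (A * ρ ^ 2 / (|s - a| + ρ) ^ 3 -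
        B * (A / (8 * B)) * ρ / (|s - a| + ρ) ^ 2) = ∫ τ in (0 : ℝ)..δ,
        (A * ρ ^ 2 / (τ + ρ) ^ 3 - B * (A / (8 * B)) * ρ / (τ + ρ) ^ 2) := by
      have h := intervalIntegral.integral_comp_sub_left (a := a - δ) (b := a) (fun τ : ℝ =>
        A * ρ ^ 2 / (|τ| + ρ) ^ 3 - B * (A / (8 * B)) * ρ / (|τ| + ρ) ^ 2) a
      rw [sub_self, sub_sub_cancel] at h
      simp only [abs_sub_comm a] at h
      rw [h]
      refine intervalIntegral.integral_congr fun τ hτ => ?_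
      rw [Set.uIcc_of_le hδ.le] at hτ
      simp only [abs_of_nonneg hτ.1]
    rw [← h1]
    refine intervalIntegral.integral_mono_on (by linarith) (hmodel.intervalIntegrable _ _)
      (hIc.intervalIntegrable _ _) fun s hs => hlow s ?_
    rw [abs_sub_comm, abs_of_nonneg (by linarith [hs.2])]
    linarith [hs.1]
  have hfarI : |∫ s in (a + δ)..(a + 1 - δ), I s| ≤ |C| * K * ρ := by
    have h1 : ∀ s ∈ Set.uIoc (a + δ) (a + 1 - δ), ‖I s‖ ≤ |C| * K * ρ := fun s hs => by
      rw [Set.uIoc_of_le (by linarith)] at hs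
      have h2 : ∀ u ∈ Set.uIoc (0 : ℝ) 1, ‖F s u‖ ≤ |C| * K * ρ := fun u _ => by
        rw [Real.norm_eq_abs, hF, abs_mul, mul_assoc]
        exact mul_le_mul_of_nonneg_left (hfar s ⟨hs.1.le, hs.2⟩ ρ hρ hρρ₀ u) (abs_nonneg C)
      simpa using intervalIntegral.norm_integral_le_of_norm_le_const h2
    have h2 := intervalIntegral.norm_integral_le_of_norm_le_const h1
    rw [Real.norm_eq_abs] at h2
    refine h2.trans ?_
    have h3 : |a + 1 - δ - (a + δ)| ≤ 1 := by
      rw [abs_le]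
      constructor <;> linarith
    have h4 : 0 ≤ |C| * K * ρ := by positivity
    exact mul_le_of_le_one_right h4 h3
  have := (abs_le.1 hfarI).1
  rw [hint] at hsplit
  linarith

end meridian

/-! ### Rotations of the disk about an arbitrary centre -/

/-- The Möbius transformation of the unit disk that takes `0` to `a`. -/
def mobius (a z : ℂ) : ℂ := (z + a) / (1 + starRingEnd ℂ a * z)

section mobius

variable {a z : ℂ}

theorem mobius_denom_ne_zero (ha : ‖a‖ < 1) (hz : ‖z‖ ≤ 1) : 1 + starRingEnd ℂ a * z ≠ 0 := fun h => by
  have h1 : ‖starRingEnd ℂ a * z‖ = 1 := by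
    rw [eq_neg_of_add_eq_zero_right h, norm_neg, norm_one]
  rw [norm_mul, RCLike.norm_conj] at h1
  nlinarith [norm_nonneg a, norm_nonneg z]

theorem norm_sq_mobius_denom_sub (a z : ℂ) :
    ‖1 + starRingEnd ℂ a * z‖ ^ 2 - ‖z + a‖ ^ 2 = (1 - ‖a‖ ^ 2) * (1 - ‖z‖ ^ 2) := by
  simp only [← Complex.normSq_eq_norm_sq, Complex.normSq_apply, Complex.add_re, Complex.add_im,
    Complex.mul_re, Complex.mul_im, Complex.conj_re, Complex.conj_im, Complex.one_re, Complex.one_im]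
  ring

theorem norm_mobius_le (ha : ‖a‖ < 1) (hz : ‖z‖ ≤ 1) : ‖mobius a z‖ ≤ 1 := by
  have hd := norm_pos_iff.2 (mobius_denom_ne_zero ha hz)
  rw [mobius, norm_div, div_le_one hd]
  have h := norm_sq_mobius_denom_sub a z
  have h1 : 0 ≤ (1 - ‖a‖ ^ 2) * (1 - ‖z‖ ^ 2) :=
    mul_nonneg (by nlinarith [norm_nonneg a]) (by nlinarith [norm_nonneg z])
  exact pow_le_pow_iff_left₀ (norm_nonneg _) hd.le two_ne_zero |>.1 (by linarith)

theorem norm_mobius_lt (ha : ‖a‖ < 1) (hz : ‖z‖ < 1) : ‖mobius a z‖ < 1 := by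
  have hd := norm_pos_iff.2 (mobius_denom_ne_zero ha hz.le)
  rw [mobius, norm_div, div_lt_one hd]
  have h := norm_sq_mobius_denom_sub a z
  have h1 : 0 < (1 - ‖a‖ ^ 2) * (1 - ‖z‖ ^ 2) :=
    mul_pos (by nlinarith [norm_nonneg a]) (by nlinarith [norm_nonneg z])
  exact pow_lt_pow_iff_left₀ (norm_nonneg _) hd.le two_ne_zero |>.1 (by linarith)

theorem mobius_zero_right (a : ℂ) : mobius a 0 = a := by simp [mobius]

theorem mobius_zero_left (z : ℂ) : mobius 0 z = z := by simp [mobius]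

theorem mobius_neg_mobius (ha : ‖a‖ < 1) (hz : ‖z‖ ≤ 1) : mobius (-a) (mobius a z) = z := by
  have h1 := mobius_denom_ne_zero ha hz
  have h2 := mobius_denom_ne_zero (a := -a) (by rwa [norm_neg]) (norm_mobius_le ha hz)
  rw [mobius, div_eq_iff h2]
  simp only [mobius, map_neg]
  generalize starRingEnd ℂ a = c at *
  have h3 : (z + a) / (1 + c * z) * (1 + c * z) = z + a := div_mul_cancel₀ _ h1
  generalize (z + a) / (1 + c * z) = m at *
  refine mul_right_cancel₀ h1 ?_
  linear_combination (1 + c * z) * h3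

theorem mobius_mobius_neg (ha : ‖a‖ < 1) (hz : ‖z‖ ≤ 1) : mobius a (mobius (-a) z) = z := by
  have := mobius_neg_mobius (a := -a) (by rwa [norm_neg]) hz
  rwa [neg_neg] at this

theorem mobius_eq_self_iff (ha : ‖a‖ < 1) (hz : ‖z‖ ≤ 1) : mobius a z = a ↔ z = 0 := by
  refine ⟨fun h => ?_, fun h => by rw [h, mobius_zero_right]⟩
  rw [← mobius_neg_mobius ha hz, h]
  simp [mobius]

theorem contDiffAt_mobius (ha : ‖a‖ < 1) (hz : ‖z‖ ≤ 1) :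
    ContDiffAt ℝ ∞ (fun q : ℂ × ℂ => mobius q.1 q.2) (a, z) := by
  have hc : ContDiffAt ℝ ∞ (fun q : ℂ × ℂ => starRingEnd ℂ q.1) (a, z) :=
    (Complex.conjCLE.contDiff (n := ∞)).contDiffAt.comp (a, z) contDiffAt_fst
  have hd : ContDiffAt ℝ ∞ (fun q : ℂ × ℂ => 1 + starRingEnd ℂ q.1 * q.2) (a, z) :=
    contDiffAt_const.add (hc.mul contDiffAt_snd)
  have hn : ContDiffAt ℝ ∞ (fun q : ℂ × ℂ => q.2 + q.1) (a, z) := contDiffAt_snd.add contDiffAt_fst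
  simp only [mobius, div_eq_mul_inv]
  refine hn.mul (ContDiffAt.inv hd ?_)
  exact mobius_denom_ne_zero ha hz

theorem hasFDerivAt_mobius_zero (a : ℂ) :
    HasFDerivAt (mobius a) ((1 - ‖a‖ ^ 2) • ContinuousLinearMap.id ℝ ℂ) 0 := by
  have h1 : HasDerivAt (fun z => z + a) 1 (0 : ℂ) := (hasDerivAt_id 0).add_const a
  have h2 : HasDerivAt (fun z => 1 + starRingEnd ℂ a * z) (starRingEnd ℂ a) (0 : ℂ) := by
    simpa using ((hasDerivAt_id (0 : ℂ)).const_mul (starRingEnd ℂ a)).const_add 1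
  have h3 := (h1.div h2 (by simp)).complexToReal_fderiv
  refine h3.congr_fderiv ?_
  ext1
  simp [Complex.mul_conj, Complex.normSq_eq_norm_sq]

end mobius

/-- The rotation of the unit disk, in its hyperbolic metric, by the angle `θ` about the point `a`. -/
def rotAbout (a : ℂ) (θ : ℝ) (z : ℂ) : ℂ := mobius a (rot θ (mobius (-a) z))

section rotAbout

variable {a z : ℂ}

theorem norm_rotAbout_le (ha : ‖a‖ < 1) (hz : ‖z‖ ≤ 1) (θ : ℝ) : ‖rotAbout a θ z‖ ≤ 1 :=
  norm_mobius_le ha (by rw [norm_rot]; exact norm_mobius_le (by rwa [norm_neg]) hz)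

theorem rotAbout_zero_left (θ : ℝ) (z : ℂ) : rotAbout 0 θ z = rot θ z := by
  rw [rotAbout, neg_zero, mobius_zero_left, mobius_zero_left]

theorem rotAbout_neg_rotAbout (ha : ‖a‖ < 1) (hz : ‖z‖ ≤ 1) (θ : ℝ) :
    rotAbout a (-θ) (rotAbout a θ z) = z := by
  have hz' : ‖mobius (-a) z‖ ≤ 1 := norm_mobius_le (by rwa [norm_neg]) hz
  rw [rotAbout, rotAbout, mobius_neg_mobius ha (by rwa [norm_rot]), rot_neg_rot,
    mobius_mobius_neg ha hz]

theorem rotAbout_int (ha : ‖a‖ < 1) (hz : ‖z‖ ≤ 1) (n : ℤ) :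
    rotAbout a (2 * Real.pi * n) z = z := by
  rw [rotAbout, rot_int, mobius_mobius_neg ha hz]

theorem rotAbout_zero (ha : ‖a‖ < 1) (hz : ‖z‖ ≤ 1) : rotAbout a 0 z = z := by
  rw [rotAbout, rot_zero, mobius_mobius_neg ha hz]

theorem rotAbout_self (a : ℂ) (θ : ℝ) : rotAbout a θ a = a := by
  have h : mobius (-a) a = 0 := by simp [mobius]
  rw [rotAbout, h, rot, mul_zero, mobius_zero_right]

theorem rotAbout_eq_self_iff (ha : ‖a‖ < 1) (hz : ‖z‖ ≤ 1) (θ : ℝ) : rotAbout a θ z = a ↔ z = a := by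
  refine ⟨fun h => ?_, fun h => by rw [h, rotAbout_self]⟩
  rw [← rotAbout_neg_rotAbout ha hz θ, h, rotAbout_self]

theorem contDiffAt_rotAbout (ha : ‖a‖ < 1) (hz : ‖z‖ ≤ 1) (θ : ℝ) :
    ContDiffAt ℝ ∞ (fun q : ℂ × ℝ × ℂ => rotAbout q.1 q.2.1 q.2.2) (a, θ, z) := by
  have ha' : ‖-a‖ < 1 := by rwa [norm_neg]
  have h1 : ContDiffAt ℝ ∞ (fun q : ℂ × ℝ × ℂ => mobius (-q.1) q.2.2) (a, θ, z) :=
    ContDiffAt.comp (g := fun q : ℂ × ℂ => mobius q.1 q.2) (a, θ, z) (contDiffAt_mobius ha' hz)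
      (contDiffAt_fst.neg.prodMk contDiffAt_snd.snd)
  have h2 : ContDiffAt ℝ ∞ (fun q : ℂ × ℝ × ℂ => rot q.2.1 (mobius (-q.1) q.2.2)) (a, θ, z) :=
    ContDiffAt.comp (g := fun q : ℝ × ℂ => rot q.1 q.2) (a, θ, z) contDiff_rot.contDiffAt
      (contDiffAt_snd.fst.prodMk h1)
  exact ContDiffAt.comp (g := fun q : ℂ × ℂ => mobius q.1 q.2) (a, θ, z)
    (contDiffAt_mobius ha (by rw [norm_rot]; exact norm_mobius_le ha' hz)) (contDiffAt_fst.prodMk h2)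

end rotAbout

/-! ### Twisting a strand around another strand -/

/-- The closed curve `γ` meets the thick disk `Φ` only in the fibre over the interior point `p`; it
is transverse to the disk at time `a`, and passes through the point `Φ (p, 0)` only once per
period. -/
structure IsStrand (Φ : ℂ × ℝ → E3) (γ : ℝ → E3) (p : ℂ) (a : ℝ) : Prop where
  smooth : ContDiff ℝ ∞ γ
  periodic : Function.Periodic γ 1
  norm_lt : ‖p‖ < 1
  fibre : ∀ s, ∀ y ∈ stdCylinder, Φ y = γ s → y.1 = p
  apply_eq : γ a = Φ (p, 0)
  deriv_eq : ∃ r : ℝ, r ≠ 0 ∧ deriv γ a = r • fderiv ℝ Φ (p, 0) (0, 1)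
  injective : ∀ s, γ s = γ a → ∃ k : ℤ, s - a = k

namespace IsStrand

variable {Φ : ℂ × ℝ → E3} {γ η : ℝ → E3} {p q : ℂ} {a b : ℝ} {k : ℤ}

theorem notMem_side (h : IsStrand Φ γ p a) (s : ℝ) : γ s ∉ Φ '' stdSide := by
  rintro ⟨⟨z, t⟩, hy, e⟩
  have h1 : z = p := h.fibre s _ (stdSide_subset hy) e
  rw [mem_stdSide, h1] at hy
  exact h.norm_lt.ne hy.1

theorem ne_of_ne (h : IsStrand Φ γ p a) {z : ℂ} {t : ℝ} (hz : ‖z‖ ≤ 1) (ht : |t| ≤ 1) (hzp : z ≠ p)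
    (s : ℝ) : γ s ≠ Φ (z, t) := fun e =>
  hzp (h.fibre s _ (mem_stdCylinder.2 ⟨hz, ht⟩) e.symm)

theorem ne_of_mem_Ioo (h : IsStrand Φ γ p a) {s : ℝ} (hs : s ∈ Set.Ioo a (a + 1)) : γ s ≠ γ a := by
  intro e
  obtain ⟨n, hn⟩ := h.injective s e
  have h1 : (0 : ℝ) < n := by linarith [hs.1]
  have h2 : (n : ℝ) < 1 := by linarith [hs.2]
  have h3 : 0 < n := by exact_mod_cast h1
  have h4 : n < 1 := by exact_mod_cast h2
  omega

end IsStrand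

/-- The angle at height `t` and time `u` of a homotopy from a twist in `[-1, 1]` to a twist in
`[-ε, ε]`. -/
def twistAngle (k : ℤ) (ε u t : ℝ) : ℝ :=
  2 * Real.pi * k * ((1 - u) * Real.smoothTransition ((t + 1) / 2) +
    u * Real.smoothTransition ((t / ε + 1) / 2))

theorem contDiff_twistAngle (k : ℤ) (ε : ℝ) :
    ContDiff ℝ ∞ fun q : ℝ × ℝ => twistAngle k ε q.1 q.2 := by
  have h1 : ContDiff ℝ ∞ fun q : ℝ × ℝ => Real.smoothTransition ((q.2 + 1) / 2) :=
    Real.smoothTransition.contDiff.comp ((contDiff_snd.add contDiff_const).div_const 2)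
  have h2 : ContDiff ℝ ∞ fun q : ℝ × ℝ => Real.smoothTransition ((q.2 / ε + 1) / 2) :=
    Real.smoothTransition.contDiff.comp (((contDiff_snd.div_const ε).add contDiff_const).div_const 2)
  exact contDiff_const.mul (((contDiff_const.sub contDiff_fst).mul h1).add (contDiff_fst.mul h2))

theorem twistAngle_one (k : ℤ) (ε t : ℝ) :
    twistAngle k ε 1 t = 2 * Real.pi * k * Real.smoothTransition ((t / ε + 1) / 2) := by
  rw [twistAngle]
  ring

theorem smoothTransition_of_le_neg {ε t : ℝ} (hε : 0 < ε) (h : t ≤ -ε) :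
    Real.smoothTransition ((t / ε + 1) / 2) = 0 := by
  have : t / ε ≤ -1 := by rw [div_le_iff₀ hε]; linarith
  exact Real.smoothTransition.zero_of_nonpos (by linarith)

theorem smoothTransition_of_le {ε t : ℝ} (hε : 0 < ε) (h : ε ≤ t) :
    Real.smoothTransition ((t / ε + 1) / 2) = 1 := by
  have : 1 ≤ t / ε := by rw [le_div_iff₀ hε]; linarith
  exact Real.smoothTransition.one_of_one_le (by linarith)

theorem twistAngle_eq_int {ε : ℝ} (hε : 0 < ε) (h1 : ε ≤ 1) (k : ℤ) (u : ℝ) {t : ℝ} (ht : 1 ≤ |t|) :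
    ∃ n : ℤ, twistAngle k ε u t = 2 * Real.pi * n := by
  rcases le_abs'.1 ht with h | h
  · have e1 := smoothTransition_of_le_neg (t := t) one_pos h
    rw [div_one] at e1
    refine ⟨0, ?_⟩
    rw [twistAngle, e1, smoothTransition_of_le_neg hε (by linarith)]
    simp
  · have e1 := smoothTransition_of_le (t := t) one_pos h
    rw [div_one] at e1
    refine ⟨k, ?_⟩
    rw [twistAngle, e1, smoothTransition_of_le hε (by linarith)]
    ring

/-- The `k`-fold twist of the cylinder in `[-ε, ε]` that fixes the fibre over `p`. -/
def twistAbout (k : ℤ) (ε : ℝ) (p : ℂ) (y : ℂ × ℝ) : ℂ × ℝ :=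
  (rotAbout p (2 * Real.pi * k * Real.smoothTransition ((y.2 / ε + 1) / 2)) y.1, y.2)

/-- A family of twists of the cylinder which moves the centre of rotation from `0` to `p` and reduces
the height from `1` to `ε`. The time `u` is passed through `Real.smoothTransition`, so that all real `u`
are allowed. -/
def slideTwist (k : ℤ) (ε : ℝ) (p : ℂ) (u : ℝ) (y : ℂ × ℝ) : ℂ × ℝ :=
  (rotAbout (Real.smoothTransition u • p) (twistAngle k ε (Real.smoothTransition u) y.2) y.1, y.2)

section slideTwist

variable {Φ : ℂ × ℝ → E3} {γ η : ℝ → E3} {p q : ℂ} {a b ε : ℝ} {k : ℤ}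

theorem slideTwist_zero (k : ℤ) (ε : ℝ) (p : ℂ) : slideTwist k ε p 0 = fullTwist k := by
  ext1 ⟨z, t⟩
  rw [slideTwist, fullTwist_eq]
  simp [Real.smoothTransition.zero, rotAbout_zero_left, twistAngle]

theorem slideTwist_one (k : ℤ) (ε : ℝ) (p : ℂ) : slideTwist k ε p 1 = twistAbout k ε p := by
  ext1 ⟨z, t⟩
  rw [slideTwist, twistAbout, Real.smoothTransition.one, one_smul, twistAngle_one]

theorem norm_smoothTransition_smul_lt (hp : ‖p‖ < 1) (u : ℝ) : ‖Real.smoothTransition u • p‖ < 1 := by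
  rw [norm_smul, Real.norm_eq_abs, abs_of_nonneg (Real.smoothTransition.nonneg u)]
  nlinarith [norm_nonneg p, Real.smoothTransition.nonneg u, Real.smoothTransition.le_one u]

theorem slideTwist_mapsTo (hp : ‖p‖ < 1) (u : ℝ) :
    Set.MapsTo (slideTwist k ε p u) stdCylinder stdCylinder := by
  rintro ⟨z, t⟩ h
  rw [mem_stdCylinder] at h
  exact mem_stdCylinder.2 ⟨norm_rotAbout_le (norm_smoothTransition_smul_lt hp u) h.1 _, h.2⟩

theorem push_slideTwist_injective (hΦ : Set.InjOn Φ stdCylinder) (hp : ‖p‖ < 1) (u : ℝ) :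
    Function.Injective (push Φ (slideTwist k ε p u)) := by
  refine Function.LeftInverse.injective (g := push Φ fun y => (rotAbout (Real.smoothTransition u • p)
    (-twistAngle k ε (Real.smoothTransition u) y.2) y.1, y.2)) fun x => ?_
  refine push_leftInverse hΦ (slideTwist_mapsTo hp u) ?_
  rintro ⟨z, t⟩ h
  rw [mem_stdCylinder] at h
  simp only [slideTwist, rotAbout_neg_rotAbout (norm_smoothTransition_smul_lt hp u) h.1]

theorem contDiff_push_slideTwist (hΦ : IsSmoothEmbeddingOn Φ stdCylinder) (hε : 0 < ε) (h1 : ε ≤ 1)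
    (hp : ‖p‖ < 1) (h : IsStrand Φ γ q a) :
    ContDiff ℝ ∞ fun v : ℝ × ℝ => push Φ (slideTwist k ε p v.1) (γ v.2) := by
  refine contDiff_iff_contDiffAt.2 fun ⟨u, s⟩ => ?_
  have key : ContDiffAt ℝ ∞ (fun v : ℝ × E3 => push Φ (slideTwist k ε p v.1) v.2) (u, γ s) := by
    refine contDiffAt_push_of_notMem_side hΦ (h.notMem_side s) ?_ (slideTwist_mapsTo hp u) ?_
    · rintro ⟨z, t⟩ hy -
      rw [mem_stdCylinder] at hy
      have e1 : ContDiffAt ℝ ∞ (fun v : ℝ × (ℂ × ℝ) => Real.smoothTransition v.1) (u, (z, t)) :=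
        Real.smoothTransition.contDiff.contDiffAt.comp _ contDiffAt_fst
      have e2 : ContDiffAt ℝ ∞ (fun v : ℝ × (ℂ × ℝ) => Real.smoothTransition v.1 • p) (u, (z, t)) :=
        e1.smul contDiffAt_const
      have e3 : ContDiffAt ℝ ∞ (fun v : ℝ × (ℂ × ℝ) =>
          twistAngle k ε (Real.smoothTransition v.1) v.2.2) (u, (z, t)) :=
        ContDiffAt.comp (g := fun q : ℝ × ℝ => twistAngle k ε q.1 q.2) _
          (contDiff_twistAngle k ε).contDiffAt (e1.prodMk contDiffAt_snd.snd)
      have e4 := ContDiffAt.comp (g := fun q : ℂ × ℝ × ℂ => rotAbout q.1 q.2.1 q.2.2)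
        (f := fun v : ℝ × (ℂ × ℝ) => (Real.smoothTransition v.1 • p,
          twistAngle k ε (Real.smoothTransition v.1) v.2.2, v.2.1)) (u, (z, t))
        (contDiffAt_rotAbout (norm_smoothTransition_smul_lt hp u) hy.1 _)
        (e2.prodMk (e3.prodMk contDiffAt_snd.fst))
      exact e4.prodMk contDiffAt_snd.snd
    · intro u z t hz ht
      obtain ⟨n, hn⟩ := twistAngle_eq_int hε h1 k (Real.smoothTransition u) ht
      simp only [slideTwist, hn, rotAbout_int (norm_smoothTransition_smul_lt hp u) hz]
  exact key.comp (f := fun v : ℝ × ℝ => (v.1, γ v.2)) (u, s)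
    (contDiffAt_fst.prodMk (h.smooth.contDiffAt.comp (u, s) contDiffAt_snd))

/-- Up to link homotopy, a full twist of two strands fixes one of them and twists the other around
it. -/
theorem gauss_twistMap (hΦ : IsSmoothEmbeddingOn Φ stdCylinder) (hγ : IsStrand Φ γ p a)
    (hη : IsStrand Φ η q b) (hne : ∀ s t, γ s ≠ η t) (hε : 0 < ε) (h1 : ε ≤ 1) :
    gauss (fun s => twistMap Φ k (γ s)) (fun t => twistMap Φ k (η t)) =
      gauss γ (fun t => push Φ (twistAbout k ε p) (η t)) := by
  have h := gauss_eq_of_homotopy (x := fun v => push Φ (slideTwist k ε p v.1) (γ v.2))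
    (y := fun v => push Φ (slideTwist k ε p v.1) (η v.2))
    (contDiff_push_slideTwist hΦ hε h1 hγ.norm_lt hγ) (contDiff_push_slideTwist hΦ hε h1 hγ.norm_lt hη)
    (fun u s => by simp only [hγ.periodic s]) (fun u s => by simp only [hη.periodic s])
    (fun u s t e => hne s t (push_slideTwist_injective hΦ.2.1 hγ.norm_lt u e))
  simp only [slideTwist_zero, slideTwist_one] at h
  rw [← h]
  congr 1
  ext1 s
  refine push_eq_self hΦ.2.1 ?_
  rintro ⟨z, t⟩ hy e
  obtain rfl : z = p := hγ.fibre s _ hy e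
  rw [twistAbout, rotAbout_self]

theorem contDiff_push_twistAbout (hΦ : IsSmoothEmbeddingOn Φ stdCylinder) (hε : 0 < ε) (h1 : ε ≤ 1)
    (hp : ‖p‖ < 1) (h : IsStrand Φ η q b) :
    ContDiff ℝ ∞ fun t => push Φ (twistAbout k ε p) (η t) := by
  have := (contDiff_push_slideTwist (k := k) hΦ hε h1 hp h).comp
    (f := fun t : ℝ => ((1 : ℝ), t)) (contDiff_const.prodMk contDiff_id)
  simpa only [Function.comp_def, slideTwist_one] using this

end slideTwist

/-! ### The loop around a strand -/

section crossing

variable {Φ : ℂ × ℝ → E3} {γ η : ℝ → E3} {p q : ℂ} {a b ε : ℝ} {k : ℤ}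

/-- Near its intersection with the disk a strand runs along a fibre, with a height `h` that may be
extended to a smooth function on the line. -/
theorem IsStrand.exists_height (hΦ : IsSmoothEmbeddingOn Φ stdCylinder) (hη : IsStrand Φ η q b) :
    ∃ (h : ℝ → ℝ) (r δ : ℝ), r ≠ 0 ∧ 0 < δ ∧ δ < 1 / 4 ∧ ContDiff ℝ ∞ h ∧ (∀ t, |h t| ≤ 1) ∧
      (∀ t, |t - b| < 2 * δ → η t = Φ (q, h t)) ∧ h b = 0 ∧ HasDerivAt h r b := by
  obtain ⟨V, Ψ, hV, hc⟩ := exists_isChart isCompact_stdCylinder hΦ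
  have hq := hη.norm_lt
  have hq0 : (q, (0 : ℝ)) ∈ V := hV (mem_stdCylinder.2 ⟨hq.le, by simp⟩)
  have hΨ := hc.smooth_inv _ hq0
  rw [← hη.apply_eq] at hΨ
  have hΨη : ContDiffAt ℝ ∞ (fun t => Ψ (η t)) b := hΨ.comp b hη.smooth.contDiffAt
  have hΨb : Ψ (η b) = (q, 0) := by rw [hη.apply_eq, hc.left_inv _ hq0]
  -- the points near `η b` lie in the interior of the cylinder
  have hnear : ∀ᶠ t in 𝓝 b, ∃ y ∈ V, Φ y = η t ∧ ‖y.1‖ < 1 ∧ |y.2| < 1 := by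
    refine hη.smooth.continuous.continuousAt.eventually (p := fun x => ∃ y ∈ V, Φ y = x ∧
      ‖y.1‖ < 1 ∧ |y.2| < 1) ?_
    rw [hη.apply_eq, ← hc.nhds _ hq0, eventually_map]
    have e1 : ∀ᶠ y : ℂ × ℝ in 𝓝 (q, 0), ‖y.1‖ < 1 :=
      (continuousAt_fst.norm).eventually_lt continuousAt_const hq
    have e2 : ∀ᶠ y : ℂ × ℝ in 𝓝 (q, 0), |y.2| < 1 :=
      (continuousAt_snd.abs).eventually_lt continuousAt_const (by simp)
    filter_upwards [hc.isOpen.mem_nhds hq0, e1, e2] with y h1 h2 h3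
    exact ⟨y, h1, rfl, h2, h3⟩
  have hsm : ∀ᶠ t in 𝓝 b, ContDiffAt ℝ ∞ (fun t => Ψ (η t)) t := by
    filter_upwards [hnear] with t ⟨y, hy, e, _⟩
    have := hc.smooth_inv _ hy
    rw [e] at this
    exact this.comp t hη.smooth.contDiffAt
  have hfib : ∀ᶠ t in 𝓝 b, η t = Φ (q, (Ψ (η t)).2) ∧ |(Ψ (η t)).2| < 1 := by
    filter_upwards [hnear] with t ⟨y, hy, e, h1, h2⟩
    have hyq : y.1 = q := hη.fibre t y (mem_stdCylinder.2 ⟨h1.le, h2.le⟩) e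
    rw [← e, hc.left_inv _ hy, ← hyq]
    exact ⟨rfl, h2⟩
  obtain ⟨δ₀, hδ₀, H⟩ := Metric.eventually_nhds_iff.1 (hsm.and hfib)
  obtain ⟨δ, hδ, hδ'⟩ := exists_between (show 0 < min (δ₀ / 4) (1 / 4) by positivity)
  rw [lt_min_iff] at hδ'
  let f : ContDiffBump b := ⟨2 * δ, 3 * δ, by positivity, by linarith⟩
  have hone : ∀ t, |t - b| < 2 * δ → f t = 1 := fun t ht =>
    f.one_of_mem_closedBall (by rw [Metric.mem_closedBall, Real.dist_eq]; exact ht.le)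
  have heq : (fun t => f t * (Ψ (η t)).2) =ᶠ[𝓝 b] fun t => (Ψ (η t)).2 := by
    filter_upwards [Metric.ball_mem_nhds b (show 0 < 2 * δ by positivity)] with t ht
    rw [hone t (by rwa [Metric.mem_ball, Real.dist_eq] at ht), one_mul]
  have hder : HasDerivAt (fun t => (Ψ (η t)).2) (deriv (fun t => (Ψ (η t)).2) b) b :=
    (hΨη.snd.differentiableAt (by simp)).hasDerivAt
  refine ⟨fun t => f t * (Ψ (η t)).2, deriv (fun t => (Ψ (η t)).2) b, δ, fun h0 => ?_, hδ, hδ'.2,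
    contDiff_iff_contDiffAt.2 fun t => ?_, fun t => ?_, fun t ht => ?_, ?_,
    hder.congr_of_eventuallyEq heq⟩
  · -- a vanishing derivative of the height contradicts transversality
    rw [h0] at hder
    obtain ⟨r, hr, hd⟩ := hη.deriv_eq
    have e1 : η =ᶠ[𝓝 b] fun t => Φ (q, (Ψ (η t)).2) := hfib.mono fun t ht => ht.1
    have e2 : HasFDerivAt Φ (fderiv ℝ Φ (q, 0)) (q, (Ψ (η b)).2) := by
      rw [hΨb]
      exact ((hc.smooth _ hq0).differentiableAt (by simp)).hasFDerivAt
    have e3 := (HasFDerivAt.comp_hasDerivAt (l := Φ) b e2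
      ((hasDerivAt_const b q).prodMk hder)).congr_of_eventuallyEq e1
    rw [e3.deriv, ← map_smul] at hd
    have := hc.inj _ hq0 hd
    simp only [Prod.smul_mk, smul_zero, smul_eq_mul, mul_one, Prod.mk.injEq, true_and] at this
    exact hr this.symm
  · by_cases ht : dist t b < δ₀
    · exact f.contDiffAt.mul (H ht).1.snd
    · have : ∀ᶠ t' in 𝓝 t, f t' * (Ψ (η t')).2 = 0 := by
        have hc : ContinuousAt (fun t' : ℝ => dist t' b) t := by fun_prop
        have h3 : 3 * δ < dist t b := by linarith [not_lt.1 ht]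
        filter_upwards [continuousAt_const.eventually_lt hc h3] with t' ht'
        rw [f.zero_of_le_dist ht'.le, zero_mul]
      exact contDiffAt_const.congr_of_eventuallyEq this
  · by_cases ht : dist t b < δ₀
    · rw [abs_mul, abs_of_nonneg f.nonneg]
      exact mul_le_one₀ f.le_one (abs_nonneg _) (H ht).2.2.le
    · have h3 : 3 * δ ≤ dist t b := by linarith [not_lt.1 ht]
      simp only [f.zero_of_le_dist h3, zero_mul, abs_zero, zero_le_one]
  · have : dist t b < δ₀ := by
      rw [Real.dist_eq]
      linarith
    simp only [hone t ht, one_mul]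
    exact (H this).2.1
  · simp only [hΨb, mul_zero]

/-- The height function of `IsStrand.exists_height` changes sign. -/
theorem exists_sign_change {h : ℝ → ℝ} {r δ : ℝ} (hr : r ≠ 0) (hδ : 0 < δ) (h0 : h b = 0)
    (hd : HasDerivAt h r b) : ∃ d, 0 < d ∧ d < δ ∧ h (b - d) * h (b + d) < 0 := by
  have h1 : ∀ᶠ t in 𝓝 b, ‖h t - h b - (t - b) • r‖ ≤ |r| / 2 * ‖t - b‖ :=
    (hasDerivAt_iff_isLittleO.1 hd).def (by positivity)
  obtain ⟨δ₁, hδ₁, H⟩ := Metric.eventually_nhds_iff.1 h1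
  obtain ⟨d, hd0, hd1⟩ := exists_between (show 0 < min δ₁ δ by positivity)
  rw [lt_min_iff] at hd1
  refine ⟨d, hd0, hd1.2, ?_⟩
  have h2 := H (y := b - d) (by rw [Real.dist_eq]; simpa [abs_of_pos hd0] using hd1.1)
  have h3 := H (y := b + d) (by rw [Real.dist_eq]; simpa [abs_of_pos hd0] using hd1.1)
  rw [h0, Real.norm_eq_abs, Real.norm_eq_abs, abs_le, smul_eq_mul] at h2 h3
  rw [show b - d - b = -d by ring, abs_neg, abs_of_pos hd0] at h2
  rw [show b + d - b = d by ring, abs_of_pos hd0] at h3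
  rcases lt_or_gt_of_ne hr with hr | hr
  · rw [abs_of_neg hr] at h2 h3
    have : d * r < 0 := mul_neg_of_pos_of_neg hd0 hr
    exact mul_neg_of_pos_of_neg (by linarith) (by linarith)
  · rw [abs_of_pos hr] at h2 h3
    have : 0 < d * r := mul_pos hd0 hr
    exact mul_neg_of_neg_of_pos (by linarith) (by linarith)

/-- Away from its intersection with the disk, a strand avoids a piece of the fibre. -/
theorem IsStrand.exists_fibre_avoid (hΦ : IsSmoothEmbeddingOn Φ stdCylinder) (hη : IsStrand Φ η q b)
    {d : ℝ} (hd : 0 < d) : ∃ ε, 0 < ε ∧ ε ≤ 1 ∧ ∀ s ∈ Set.Icc (b + d) (b + 1 - d), ∀ t, |t| ≤ ε →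
      η s ≠ Φ (q, t) := by
  have hcl : IsClosed (η '' Set.Icc (b + d) (b + 1 - d)) :=
    (isCompact_Icc.image hη.smooth.continuous).isClosed
  have h0 : Φ (q, 0) ∉ η '' Set.Icc (b + d) (b + 1 - d) := by
    rintro ⟨s, hs, e⟩
    exact hη.ne_of_mem_Ioo ⟨by linarith [hs.1], by linarith [hs.2]⟩ (e.trans hη.apply_eq.symm)
  have hc : ContinuousAt (fun t : ℝ => Φ (q, t)) 0 :=
    ContinuousAt.comp (g := Φ) (f := fun t : ℝ => (q, t))
      (hΦ.contDiffAt (mem_stdCylinder.2 ⟨hη.norm_lt.le, by simp⟩)).continuousAt (by fun_prop)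
  obtain ⟨ε, hε, H⟩ := Metric.eventually_nhds_iff.1
    (hc.eventually (hcl.isOpen_compl.mem_nhds h0))
  refine ⟨min (ε / 2) 1, by positivity, min_le_right _ _, fun s hs t ht e => ?_⟩
  refine H (y := t) ?_ ⟨s, hs, e⟩
  rw [Real.dist_eq, sub_zero]
  linarith [ht.trans (min_le_left _ _)]

/-- The loop that the point over `q` at height `τ` describes when it is rotated around the fibre over
`p`. -/
def fibreLoop (Φ : ℂ × ℝ → E3) (k : ℤ) (p q : ℂ) (τ u : ℝ) : E3 :=
  Φ (rotAbout p (2 * Real.pi * k * u) q, τ)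

/-- Gauss's integral of a strand with a loop around it is not zero: contract the loop to a small
meridian. -/
theorem gauss_fibreLoop_ne_zero (hΦ : IsThickDisk Φ) (hγ : IsStrand Φ γ p a) (hq : ‖q‖ < 1)
    (hpq : p ≠ q) (hk : k ≠ 0) {τ : ℝ} (hτ : |τ| ≤ 1) : gauss γ (fibreLoop Φ k p q τ) ≠ 0 := by
  have hp := hγ.norm_lt
  set w : ℂ := mobius (-p) q with hw
  have hw1 : ‖w‖ < 1 := norm_mobius_lt (by rwa [norm_neg]) hq
  have hw0 : w ≠ 0 := fun h => hpq <| by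
    rw [← mobius_mobius_neg hp hq.le, ← hw, h, mobius_zero_right]
  set κ : ℂ → E3 := fun z => Φ (mobius p z, 0) with hκ
  have hmob : ∀ z, ‖z‖ < 1 → ContDiffAt ℝ ∞ (mobius p) z := fun z hz =>
    ContDiffAt.comp (g := fun q : ℂ × ℂ => mobius q.1 q.2) (f := fun z : ℂ => (p, z)) z
      (contDiffAt_mobius hp hz.le) (contDiffAt_const.prodMk contDiffAt_id)
  have hκs : ∀ z, ‖z‖ < 1 → ContDiffAt ℝ ∞ κ z := fun z hz =>
    ContDiffAt.comp (g := Φ) (f := fun z : ℂ => (mobius p z, (0 : ℝ))) z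
      (hΦ.1.contDiffAt (mem_stdCylinder.2 ⟨(norm_mobius_lt hp hz).le, by simp⟩))
      ((hmob z hz).prodMk contDiffAt_const)
  have hκ0 : κ 0 = γ a := by rw [hκ, hγ.apply_eq]; simp only [mobius_zero_right]
  have hκd : ∀ v, fderiv ℝ κ 0 v = (1 - ‖p‖ ^ 2) • fderiv ℝ Φ (p, 0) (v, 0) := fun v => by
    have h1 : HasFDerivAt Φ (fderiv ℝ Φ (p, 0)) (mobius p 0, 0) := by
      rw [mobius_zero_right]
      exact ((hΦ.1.contDiffAt (mem_stdCylinder.2 ⟨hp.le, by simp⟩)).differentiableAt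
        (by simp)).hasFDerivAt
    have h2 := HasFDerivAt.comp (g := Φ) (0 : ℂ) h1
      ((hasFDerivAt_mobius_zero p).prodMk (hasFDerivAt_const (0 : ℝ) (0 : ℂ)))
    have h3 : fderiv ℝ κ 0 = _ := h2.fderiv
    rw [h3, ← map_smul]
    simp
  have hρn : ∀ (ρ u : ℝ), 0 < ρ → ρ ≤ 1 → ‖ρ • rot (2 * Real.pi * k * u) w‖ < 1 ∧
      ρ • rot (2 * Real.pi * k * u) w ≠ 0 := fun ρ u hρ hρ1 => by
    have e : ‖ρ • rot (2 * Real.pi * k * u) w‖ = ρ * ‖w‖ := by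
      rw [norm_smul, norm_rot, Real.norm_eq_abs, abs_of_pos hρ]
    have hwp := norm_pos_iff.2 hw0
    refine ⟨by rw [e]; nlinarith, norm_pos_iff.1 ?_⟩
    rw [e]
    positivity
  have hne : ∀ (ρ u t s : ℝ), 0 < ρ → ρ ≤ 1 → |t| ≤ 1 →
      γ s ≠ Φ (mobius p (ρ • rot (2 * Real.pi * k * u) w), t) := fun ρ u t s hρ hρ1 ht => by
    obtain ⟨h1, h2⟩ := hρn ρ u hρ hρ1
    exact hγ.ne_of_ne (norm_mobius_le hp h1.le) ht (fun e => h2 ((mobius_eq_self_iff hp h1.le).1 e)) s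
  have hdet : det3 (deriv γ a) (fderiv ℝ κ 0 1) (fderiv ℝ κ 0 Complex.I) ≠ 0 := by
    obtain ⟨r, hr, hd⟩ := hγ.deriv_eq
    have h1 := hΦ.2 (p, 0) (mem_stdCylinder.2 ⟨hp.le, by simp⟩)
    have h2 : 1 - ‖p‖ ^ 2 ≠ 0 := by nlinarith [norm_nonneg p]
    have h3 : det3 (deriv γ a) (fderiv ℝ κ 0 1) (fderiv ℝ κ 0 Complex.I) =
        r * (1 - ‖p‖ ^ 2) ^ 2 * det3 (fderiv ℝ Φ (p, 0) (1, 0)) (fderiv ℝ Φ (p, 0) (Complex.I, 0))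
          (fderiv ℝ Φ (p, 0) (0, 1)) := by
      rw [hκd, hκd, hd]
      simp only [det3_eq, PiLp.smul_apply, smul_eq_mul]
      ring
    rw [h3]
    exact mul_ne_zero (mul_ne_zero hr (pow_ne_zero 2 h2)) h1.ne'
  obtain ⟨ρ, hρ, hρ1, hg⟩ := exists_gauss_meridian_ne_zero hγ.smooth hγ.periodic hκs hκ0 hk hw0 hw1
    hdet (fun s hs => by rw [hκ0]; exact hγ.ne_of_mem_Ioo hs)
    fun ρ hρ hρ1 s u => hne ρ u 0 s hρ hρ1 (by simp)
  have hv : ∀ v ∈ Set.Icc (0 : ℝ) 1, 0 < (1 - v) + v * ρ ∧ (1 - v) + v * ρ ≤ 1 ∧ |(1 - v) * τ| ≤ 1 :=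
    fun v hv => by
      refine ⟨?_, by nlinarith [hv.1], ?_⟩
      · rcases hv.1.eq_or_lt with h | h
        · rw [← h]; norm_num
        · have := mul_pos h hρ
          linarith [hv.2]
      · rw [abs_mul, abs_of_nonneg (by linarith [hv.2])]
        nlinarith [hv.1, hv.2, abs_nonneg τ]
  have hrot : ContDiff ℝ ∞ fun v : ℝ × ℝ => rot (2 * Real.pi * k * v.2) w :=
    contDiff_rot.comp (f := fun v : ℝ × ℝ => (2 * Real.pi * k * v.2, w))
      ((contDiff_const.mul contDiff_snd).prodMk contDiff_const)
  have hper : ∀ u : ℝ, rot (2 * Real.pi * k * (u + 1)) w = rot (2 * Real.pi * k * u) w := fun u => by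
    rw [mul_add, mul_one, ← rot_rot, rot_int]
  have := gauss_eq_of_homotopy_Icc (x := fun v => γ v.2)
    (y := fun v => Φ (mobius p (((1 - v.1) + v.1 * ρ) • rot (2 * Real.pi * k * v.2) w),
      (1 - v.1) * τ)) (fun v _ u => (hγ.smooth.comp contDiff_snd).contDiffAt) (fun v hv' u => ?_)
    (fun v _ s => hγ.periodic s) (fun v _ u => by simp only [hper])
    (fun v hv' s u => hne _ u _ s (hv v hv').1 (hv v hv').2.1 (hv v hv').2.2)
  · simp only [sub_self, zero_add, one_mul, zero_mul, sub_zero, add_zero, one_smul] at this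
    intro h0
    exact hg (this.trans h0)
  · obtain ⟨h1, h2, h3⟩ := hv v hv'
    have hn := (hρn _ u h1 h2).1
    have e1 : ContDiffAt ℝ ∞ (fun v : ℝ × ℝ =>
        ((1 - v.1) + v.1 * ρ) • rot (2 * Real.pi * k * v.2) w) (v, u) :=
      ContDiffAt.smul ((contDiffAt_const.sub contDiffAt_fst).add (contDiffAt_fst.mul contDiffAt_const))
        hrot.contDiffAt
    have e2 := ContDiffAt.comp (g := mobius p) (v, u) (hmob _ hn) e1
    have e3 : ContDiffAt ℝ ∞ (fun v : ℝ × ℝ => (1 - v.1) * τ) (v, u) :=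
      (contDiffAt_const.sub contDiffAt_fst).mul contDiffAt_const
    exact ContDiffAt.comp (g := Φ) (v, u)
      (hΦ.1.contDiffAt (mem_stdCylinder.2 ⟨norm_mobius_le hp hn.le, h3⟩)) (e2.prodMk e3)

end crossing

/-! ### Crossings of different components change the Gauss integral -/

section crossing

variable {Φ : ℂ × ℝ → E3} {γ η η' : ℝ → E3} {p q : ℂ} {a b d : ℝ} {k : ℤ}

theorem Function.Periodic.deriv_one (h : Function.Periodic γ 1) : Function.Periodic (deriv γ) 1 :=
  fun s => by
    rw [← deriv_comp_add_const]
    exact congrArg (fun f => deriv f s) (funext h)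

/-- The part of Gauss's integral of two closed curves that comes from an arc of the second one. -/
def gaussArc (γ η : ℝ → E3) (a b : ℝ) : ℝ :=
  ∫ s in (0 : ℝ)..1, ∫ t in a..b, gaussForm (deriv γ s) (deriv η t) (γ s - η t)

theorem gauss_eq_add_gaussArc (hγ : ContDiff ℝ ∞ γ) (hη : ContDiff ℝ ∞ η)
    (hp : Function.Periodic η 1) (hne : ∀ s t, γ s ≠ η t) (a b : ℝ) :
    gauss γ η = gaussArc γ η a b + gaussArc γ η b (a + 1) := by
  have hc : Continuous fun v : ℝ × ℝ =>
      gaussForm (deriv γ v.1) (deriv η v.2) (γ v.1 - η v.2) := continuous_gaussForm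
    ((hγ.continuous_deriv (by simp)).comp continuous_fst)
    ((hη.continuous_deriv (by simp)).comp continuous_snd)
    ((hγ.continuous.comp continuous_fst).sub (hη.continuous.comp continuous_snd))
    fun v => sub_ne_zero.2 (hne _ _)
  have hi : ∀ s a b, IntervalIntegrable (fun t => gaussForm (deriv γ s) (deriv η t) (γ s - η t))
      MeasureTheory.volume a b := fun s a b =>
    (hc.comp (continuous_const.prodMk continuous_id)).intervalIntegrable a b
  have hI : ∀ a b, Continuous fun s => ∫ t in a..b, gaussForm (deriv γ s) (deriv η t) (γ s - η t) :=
    fun a b => intervalIntegral.continuous_parametric_intervalIntegral_of_continuous'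
      (f := fun s t => gaussForm (deriv γ s) (deriv η t) (γ s - η t)) hc a b
  rw [gaussArc, gaussArc, ← intervalIntegral.integral_add ((hI _ _).intervalIntegrable _ _)
    ((hI _ _).intervalIntegrable _ _), gauss]
  refine intervalIntegral.integral_congr fun s _ => ?_
  have hper : Function.Periodic (fun t => gaussForm (deriv γ s) (deriv η t) (γ s - η t)) 1 :=
    fun t => by simp only [hp t, hp.deriv_one t]
  have h1 := hper.intervalIntegral_add_eq 0 a
  rw [zero_add] at h1
  simp only [gaussForm] at h1 hi ⊢
  rw [h1, intervalIntegral.integral_add_adjacent_intervals (hi _ _ _) (hi _ _ _)]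

theorem gaussArc_congr (hab : a ≤ b) (h : ∀ t ∈ Set.Icc a b, η =ᶠ[𝓝 t] η') :
    gaussArc γ η a b = gaussArc γ η' a b := by
  refine intervalIntegral.integral_congr fun s _ => intervalIntegral.integral_congr fun t ht => ?_
  rw [Set.uIcc_of_le hab] at ht
  simp only [(h t ht).deriv_eq, (h t ht).eq_of_nhds]

theorem contDiff_fibreLoop (hΦ : IsSmoothEmbeddingOn Φ stdCylinder) (hp : ‖p‖ < 1) (hq : ‖q‖ < 1)
    {h S : ℝ → ℝ} (hh : ContDiff ℝ ∞ h) (hS : ContDiff ℝ ∞ S) (h1 : ∀ t, |h t| ≤ 1) :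
    ContDiff ℝ ∞ fun v : ℝ × ℝ => fibreLoop Φ k p q (h v.2) (v.1 * S v.2) := by
  refine contDiff_iff_contDiffAt.2 fun v => ?_
  have e1 : ContDiffAt ℝ ∞ (fun v : ℝ × ℝ => 2 * Real.pi * k * (v.1 * S v.2)) v :=
    (contDiff_const.mul (contDiff_fst.mul (hS.comp contDiff_snd))).contDiffAt
  have e2 : ContDiffAt ℝ ∞ (fun v : ℝ × ℝ => rotAbout p (2 * Real.pi * k * (v.1 * S v.2)) q) v :=
    ContDiffAt.comp (g := fun q : ℂ × ℝ × ℂ => rotAbout q.1 q.2.1 q.2.2)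
      (f := fun v : ℝ × ℝ => (p, 2 * Real.pi * k * (v.1 * S v.2), q)) v
      (contDiffAt_rotAbout hp hq.le _) (contDiffAt_const.prodMk (e1.prodMk contDiffAt_const))
  exact ContDiffAt.comp (g := Φ) v
    (hΦ.contDiffAt (mem_stdCylinder.2 ⟨norm_rotAbout_le hp hq.le _, h1 _⟩))
    (e2.prodMk (hh.comp contDiff_snd).contDiffAt)

/-- Twisting a short arc of a strand around another strand changes Gauss's integral, by the flux
through the loop that the end of the arc describes. -/
theorem gaussArc_twist_ne (hΦ : IsThickDisk Φ) (hγ : IsStrand Φ γ p a) (hq : ‖q‖ < 1)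
    (hpq : p ≠ q) (hk : k ≠ 0) {h : ℝ → ℝ} (hh : ContDiff ℝ ∞ h) (h1 : ∀ t, |h t| ≤ 1) {ε c₀ c₁ : ℝ}
    (hε : 0 < ε) (h0 : ε < |h c₀|) (h0' : ε < |h c₁|) (hs : h c₀ * h c₁ < 0) :
    gaussArc γ (fun t => Φ (twistAbout k ε p (q, h t))) c₀ c₁ ≠
      gaussArc γ (fun t => Φ (q, h t)) c₀ c₁ := by
  have hp := hγ.norm_lt
  set S : ℝ → ℝ := fun t => Real.smoothTransition ((h t / ε + 1) / 2) with hS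
  have hSs : ContDiff ℝ ∞ S :=
    Real.smoothTransition.contDiff.comp (((hh.div_const ε).add contDiff_const).div_const 2)
  set y : ℝ × ℝ → E3 := fun v => fibreLoop Φ k p q (h v.2) (v.1 * S v.2) with hy
  have hys : ContDiff ℝ ∞ y := contDiff_fibreLoop hΦ.1 hp hq hh hSs h1
  have hyd := hys.differentiable (by simp)
  have hxs : ContDiff ℝ ∞ fun v : ℝ × ℝ => γ v.2 := hγ.smooth.comp contDiff_snd
  have hxd := hxs.differentiable (by simp)
  have hne : ∀ u s t, γ s ≠ y (u, t) := fun u s t =>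
    hγ.ne_of_ne (norm_rotAbout_le hp hq.le _) (h1 t)
      (fun e => hpq ((rotAbout_eq_self_iff hp hq.le _).1 e).symm) s
  have key := gauss_homotopy hxs hys (fun u s => hγ.periodic s) hne c₀ c₁
  have hA : ∀ u s t, gaussA (fun v : ℝ × ℝ => γ v.2) y u s t =
      gaussForm (deriv γ s) (deriv (fun t => y (u, t)) t) (γ s - y (u, t)) := fun u s t => by
    rw [gaussA, (hasDerivAt_right hyd u t).deriv, ← (hasDerivAt_right hxd u s).deriv]
  have hC : ∀ u s t, gaussC (fun v : ℝ × ℝ => γ v.2) y u s t =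
      gaussForm (deriv γ s) (-deriv (fun u => y (u, t)) u) (γ s - y (u, t)) := fun u s t => by
    have e : fderiv ℝ (fun v : ℝ × ℝ => γ v.2) (u, s) (1, 0) = 0 :=
      (hasDerivAt_left hxd u s).unique (hasDerivAt_const u (γ s))
    rw [gaussC, (hasDerivAt_left hyd u t).deriv, ← (hasDerivAt_right hxd u s).deriv, e, zero_sub]
  have hy1 : ∀ t, y (1, t) = Φ (twistAbout k ε p (q, h t)) := fun t => by
    simp only [hy, fibreLoop, twistAbout, one_mul, hS]
  have hy0 : ∀ t, y (0, t) = Φ (q, h t) := fun t => by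
    simp only [hy, fibreLoop, zero_mul, mul_zero, rotAbout_zero hp hq.le]
  simp only [hA, hC, hy1, hy0] at key
  -- the flux through the ends of the arc
  have hlow : ∀ t, h t < -ε → ∀ u s,
      gaussForm (deriv γ s) (-deriv (fun u => y (u, t)) u) (γ s - y (u, t)) = 0 := fun t ht u s => by
    have e : (fun u => y (u, t)) = fun _ => y (0, t) := by
      ext1 u
      simp only [hy, hS, smoothTransition_of_le_neg hε ht.le, mul_zero]
    rw [e, deriv_const]
    simp [gaussForm, det3_eq]
  have hhigh : ∀ t, ε < h t → ∀ u s,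
      gaussForm (deriv γ s) (-deriv (fun u => y (u, t)) u) (γ s - y (u, t)) =
      -gaussForm (deriv γ s) (deriv (fibreLoop Φ k p q (h t)) u)
        (γ s - fibreLoop Φ k p q (h t) u) := fun t ht u s => by
    have e : (fun u => y (u, t)) = fibreLoop Φ k p q (h t) := by
      ext1 u
      simp only [hy, hS, smoothTransition_of_le hε ht.le, mul_one]
    rw [e, congrFun e u, gaussForm, gaussForm, ← neg_one_smul ℝ, det3_smul_mid]
    ring
  have hgauss : ∀ t, ∫ s in (0 : ℝ)..1, ∫ u in (0 : ℝ)..1,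
      gaussForm (deriv γ s) (deriv (fibreLoop Φ k p q (h t)) u)
        (γ s - fibreLoop Φ k p q (h t) u) ≠ 0 := fun t =>
    gauss_fibreLoop_ne_zero hΦ hγ hq hpq hk (h1 t)
  intro heq
  change (∫ s in (0 : ℝ)..1, ∫ t in c₀..c₁, _) = ∫ s in (0 : ℝ)..1, ∫ t in c₀..c₁, _ at heq
  rw [heq, sub_self] at key
  rcases lt_or_gt_of_ne (left_ne_zero_of_mul hs.ne) with hc | hc
  · have hc' : 0 < h c₁ := by nlinarith
    rw [abs_of_neg hc] at h0
    rw [abs_of_pos hc'] at h0'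
    refine hgauss c₁ ?_
    simpa only [hlow c₀ (by linarith), hhigh c₁ h0', sub_zero, intervalIntegral.integral_neg, neg_neg,
      eq_comm] using key
  · have hc' : h c₁ < 0 := by nlinarith
    rw [abs_of_pos hc] at h0
    rw [abs_of_neg hc'] at h0'
    refine hgauss c₀ ?_
    simpa only [hlow c₁ (by linarith), hhigh c₀ h0, zero_sub, neg_neg, intervalIntegral.integral_neg,
      zero_eq_neg] using key

/-- Twisting a strand around another strand changes Gauss's integral. -/
theorem gauss_twistAbout_ne (hΦ : IsThickDisk Φ) (hγ : IsStrand Φ γ p a) (hη : IsStrand Φ η q b)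
    (hne : ∀ s t, γ s ≠ η t) (hpq : p ≠ q) (hk : k ≠ 0) : ∃ ε, 0 < ε ∧ ε ≤ 1 ∧
      gauss γ (fun t => push Φ (twistAbout k ε p) (η t)) ≠ gauss γ η := by
  obtain ⟨h, r, δ, hr, hδ, hδ4, hh, h1, hηh, hb, hd⟩ := hη.exists_height hΦ.1
  obtain ⟨d, hd0, hdδ, hs⟩ := exists_sign_change hr hδ hb hd
  obtain ⟨ε, hε, hε1, hav⟩ := hη.exists_fibre_avoid hΦ.1 (half_pos hd0)
  have hp := hγ.norm_lt
  have hq := hη.norm_lt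
  have hη₀ : ∀ t, |t - b| ≤ d → η =ᶠ[𝓝 t] fun t => Φ (q, h t) := fun t ht => by
    have hc : ContinuousAt (fun t => |t - b|) t := by fun_prop
    filter_upwards [hc.eventually_lt continuousAt_const (show |t - b| < 2 * δ by linarith)] with t' ht'
    exact hηh t' ht'
  have hη₁ : ∀ t, |t - b| ≤ d → (fun t => push Φ (twistAbout k ε p) (η t)) =ᶠ[𝓝 t]
      fun t => Φ (twistAbout k ε p (q, h t)) := fun t ht => by
    filter_upwards [hη₀ t ht] with t' ht'
    rw [ht', push_apply hΦ.1.2.1 (mem_stdCylinder.2 ⟨hq.le, h1 t'⟩)]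
  have hη₂ : ∀ t ∈ Set.Icc (b + d) (b + 1 - d), (fun t => push Φ (twistAbout k ε p) (η t)) =ᶠ[𝓝 t] η :=
    fun t ht => by
      filter_upwards [Icc_mem_nhds (show b + d / 2 < t by linarith [ht.1])
        (show t < b + 1 - d / 2 by linarith [ht.2])] with t' ht'
      refine push_eq_self hΦ.1.2.1 ?_
      rintro ⟨z, τ⟩ hy e
      have hz : z = q := hη.fibre t' _ hy e
      subst hz
      have hτ : ε < |τ| := by
        by_contra! hτ
        exact hav t' ht' τ hτ e.symm
      have hzn := (mem_stdCylinder.1 hy).1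
      rcases lt_abs.1 hτ with h | h
      · rw [twistAbout]
        simp only [smoothTransition_of_le hε h.le, mul_one, rotAbout_int hp hzn]
      · rw [twistAbout]
        simp only [smoothTransition_of_le_neg hε (show τ ≤ -ε by linarith), mul_zero,
          rotAbout_zero hp hzn]
  have hend : ∀ t, |t - b| = d → ε < |h t| := fun t ht => by
    by_contra! hle
    have e := hηh t (by linarith)
    rcases abs_eq hd0.le |>.1 ht with h | h
    · exact hav t ⟨by linarith, by linarith⟩ _ hle e
    · refine hav (t + 1) ⟨by linarith, by linarith⟩ _ hle ?_
      rw [hη.periodic t, e]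
  have hηs := contDiff_push_twistAbout (k := k) hΦ.1 hε hε1 hp hη
  have hne' : ∀ s t, γ s ≠ push Φ (twistAbout k ε p) (η t) := fun s t e => by
    rw [← slideTwist_one] at e
    have : push Φ (slideTwist k ε p 1) (γ s) = γ s := by
      refine push_eq_self hΦ.1.2.1 ?_
      rintro ⟨z, t⟩ hy e
      obtain rfl : z = p := hγ.fibre s _ hy e
      rw [slideTwist_one, twistAbout, rotAbout_self]
    exact hne s t (push_slideTwist_injective hΦ.1.2.1 hp 1 (this.trans e))
  refine ⟨ε, hε, hε1, fun heq => ?_⟩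
  rw [gauss_eq_add_gaussArc hγ.smooth hηs (fun t => by simp only [hη.periodic t]) hne' (b - d) (b + d),
    gauss_eq_add_gaussArc hγ.smooth hη.smooth hη.periodic hne (b - d) (b + d),
    show b - d + 1 = b + 1 - d by ring, gaussArc_congr (by linarith) hη₂, add_left_inj] at heq
  have habs : ∀ t ∈ Set.Icc (b - d) (b + d), |t - b| ≤ d := fun t ht =>
    abs_le.2 ⟨by linarith [ht.1], by linarith [ht.2]⟩
  rw [gaussArc_congr (by linarith) fun t ht => hη₁ t (habs t ht),
    gaussArc_congr (by linarith) fun t ht => hη₀ t (habs t ht)] at heq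
  exact gaussArc_twist_ne hΦ hγ hq hpq hk hh h1 hε (hend _ (by simp [abs_of_pos hd0]))
    (hend _ (by simp [abs_of_pos hd0])) hs heq

end crossing

/-! ### Unlinking crossings -/

namespace SmoothLink

variable {m : ℕ} {L L' : SmoothLink m} {Φ : ℂ × ℝ → E3} {i j : Fin m}

/-- The components that meet at a crossing of different components are strands in the collar. -/
theorem isStrand (hij : i ≠ j) (hΦ : IsThickDisk Φ) {p q : ℂ} {a b r : ℝ} (hp : ‖p‖ < 1)
    (hq : ‖q‖ < 1)
    (hcyl : (⋃ k, Set.range (L.toFun k)) ∩ Φ '' stdCylinder =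
      Φ '' (({p, q} : Set ℂ) ×ˢ Set.Icc (-1) 1))
    (ha : L.toFun i a = Φ (p, 0)) (hr : deriv (L.toFun i) a = r • fderiv ℝ Φ (p, 0) (0, 1))
    (hb : L.toFun j b = Φ (q, 0)) : IsStrand Φ (L.toFun i) p a where
  smooth := L.smooth i
  periodic := L.periodic i
  norm_lt := hp
  fibre s := by
    rintro ⟨z, t⟩ hy e
    have h1 : L.toFun i s ∈ Φ '' (({p, q} : Set ℂ) ×ˢ Set.Icc (-1) 1) := by
      rw [← hcyl]
      exact ⟨Set.mem_iUnion.2 ⟨i, s, rfl⟩, _, hy, e⟩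
    obtain ⟨⟨z', t'⟩, ⟨hz', ht'⟩, e'⟩ := h1
    have hn : ‖z'‖ ≤ 1 := by
      rcases hz' with h | h
      · exact (congrArg norm h).trans_le hp.le
      · exact (congrArg norm h).trans_le hq.le
    have h2 := hΦ.1.2.1 hy (mem_stdCylinder.2 ⟨hn, abs_le.2 ht'⟩) (e.trans e'.symm)
    rw [Prod.mk.injEq] at h2
    rcases hz' with h | h
    · exact h2.1.trans h
    · obtain rfl : z' = q := h
      have h3 := L.fibre_subset_range hΦ.1.continuousOn hq (i := j) (fun t ht => by
        have : Φ (z', t) ∈ Φ '' (({p, z'} : Set ℂ) ×ˢ Set.Icc (-1) 1) := ⟨_, ⟨by simp, ht⟩, rfl⟩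
        rw [← hcyl] at this
        exact this.1) ⟨b, hb⟩ t' ht'
      rw [e'] at h3
      exact (Set.disjoint_left.1 (L.disjoint_range hij) ⟨s, rfl⟩ h3).elim
  apply_eq := ha
  deriv_eq := ⟨r, fun h => L.regular i a (by rw [hr, h, zero_smul]), hr⟩
  injective s h := (L.injective i i s a h).2

/-- A crossing change between different components changes Gauss's integral. -/
theorem gauss_ne_of_crossingChange (hij : i ≠ j) (h : CrossingChange i j L L') :
    gauss (L'.toFun i) (L'.toFun j) ≠ gauss (L.toFun i) (L.toFun j) := by
  obtain ⟨Φ, ⟨hΦ, p, q, hp, hq, hpq, hcyl, a, b, r, r', ha, hr, hb, hr', -⟩, htw⟩ := h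
  have hk : ∃ k : ℤ, k ≠ 0 ∧ TwistAlong Φ k L L' := by
    rcases htw with h | h
    · exact ⟨1, one_ne_zero, h⟩
    · exact ⟨-1, by norm_num, h⟩
  obtain ⟨k, hk, htw⟩ := hk
  have hγ := isStrand hij hΦ hp hq hcyl ha hr hb
  have hη := isStrand hij.symm hΦ hq hp (by rw [hcyl, Set.pair_comm]) hb hr' ha
  have hne : ∀ s t, L.toFun i s ≠ L.toFun j t := fun s t e => hij (L.injective i j s t e).1
  obtain ⟨ε, hε, hε1, hg⟩ := gauss_twistAbout_ne hΦ hγ hη hne hpq hk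
  have h1 : ∀ i, L'.toFun i = fun s => twistMap Φ k (L.toFun i s) := fun i =>
    funext (((twistAlong_iff hΦ.1.2.1).1 htw).2 i)
  rw [h1 i, h1 j, gauss_twistMap hΦ.1 hγ hη hne hε hε1]
  exact hg

theorem CrossingChange.symm (h : CrossingChange i j L L') : CrossingChange j i L L' := by
  obtain ⟨Φ, ⟨hΦ, p, q, hp, hq, hpq, hcyl, a, b, r, r', ha, hr, hb, hr', hi⟩, htw⟩ := h
  exact ⟨Φ, ⟨hΦ, q, p, hq, hp, hpq.symm, by rw [hcyl, Set.pair_comm], b, a, r', r, hb, hr', ha, hr,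
    fun e => mul_comm r r' ▸ hi e.symm⟩, htw⟩

/-- If a crossing change between the components `i ≠ j` makes a link trivial, then these components
are linked. -/
theorem linkingNumber_ne_zero_of_isUnlinkingCrossing (hij : i ≠ j) (h : L.IsUnlinkingCrossing i j) :
    L.linkingNumber i j ≠ 0 := by
  obtain ⟨L₁, L₂, h1, h2, h3⟩ := h
  have h4 := gauss_ne_of_crossingChange hij h2
  rw [gauss_eq_zero_of_isTrivial h3 hij, gauss_eq_of_isotopic h1 hij] at h4
  rw [linkingNumber_eq]
  exact mul_ne_zero (by positivity) h4.symm

theorem exists_isUnlinkingCrossing (h : L.unlinkingNumber = 1) :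
    ∃ i j, L.IsUnlinkingCrossing i j := by
  have h2 : L.unlinkingNumber < 2 := by
    rw [h]
    exact Nat.one_lt_ofNat
  simp only [unlinkingNumber, iInf_lt_iff] at h2
  obtain ⟨n, hn, hn2⟩ := h2
  have hn1 : (1 : ℕ∞) ≤ n := h ▸ iInf₂_le n hn
  obtain rfl : n = 1 := by
    have e1 : n < 2 := by exact_mod_cast hn2
    have e2 : 1 ≤ n := by exact_mod_cast hn1
    omega
  obtain ⟨L₁, L₂, hL, ⟨i, j, hc⟩, ht⟩ := hn
  exact ⟨i, j, L₁, L₂, hL, hc, ht⟩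

end SmoothLink

end

theorem lemmaA3 (L : SmoothLink 2) (hu : L.unlinkingNumber = 1)
    (hlk : L.linkingNumber 0 1 = 0) :
    (∃ i j : Fin 2, L.IsUnlinkingCrossing i j) ∧
    ∀ i j : Fin 2, L.IsUnlinkingCrossing i j →
      i = j ∧
      ∀ c : Fin 2, c ≠ i →
        (L.component c).IsTrivial ∧
        ∀ n : ℤ,
          (∃ J : SmoothLink 1, SmoothLink.IsTwistAbout (L.component i) (L.component c) n J) ∧
          ∀ J : SmoothLink 1, SmoothLink.IsTwistAbout (L.component i) (L.component c) n J →
            J.unlinkingNumber ≤ 1 := by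
  refine ⟨SmoothLink.exists_isUnlinkingCrossing hu, fun i j h => ?_⟩
  have hij : i = j := by
    by_contra hij
    have h01 : L.IsUnlinkingCrossing 0 1 := by
      obtain ⟨L₁, L₂, h1, h2, h3⟩ := h
      have h4 : i = 0 ∧ j = 1 ∨ i = 1 ∧ j = 0 := by omega
      obtain ⟨rfl, rfl⟩ | ⟨rfl, rfl⟩ := h4
      · exact ⟨L₁, L₂, h1, h2, h3⟩
      · exact ⟨L₁, L₂, h1, h2.symm, h3⟩
    exact SmoothLink.linkingNumber_ne_zero_of_isUnlinkingCrossing (by decide) h01 hlk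
  subst hij
  refine ⟨rfl, fun c hc => ?_⟩
  obtain ⟨ht, hJ⟩ := SmoothLink.unlinkingNumber_twist_le_one hc h
  exact ⟨ht, fun n => ⟨SmoothLink.exists_isTwistAbout (K := L.component i) ht (L.disjoint_range hc) n, hJ n⟩⟩
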